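/- All objects are germs at the origin $O=(0,0)$ of $\mathbb R^2$ with coordinates $(x,\xi)$, and real-analytic. Let $k\ge 2$. A real-analytic function $H$ has an $A_{k-1}$ singularity (with sign $\pm$) at $O$ if in suitable real-analytic local coordinates centred at $O$ it has the form $H=\xi^2\pm x^k+\mathrm{const}$. Two pairs $(H_0,\omega_0)$ and $(H_1,\omega_1)$, each consisting of a real-analytic function and a real-analytic symplectic form near $O$, are called analytically fibration-preserving equivalent if there are a real-analytic $\tilde H_1$ defining the same singular foliation as $H_1$ near $O$ (that is, $\ker d\tilde H_1=\ker dH_1$ at every point near $O$) and a real-analytic diffeomorphism germ $\psi:(\mathbb R^2,0)\to(\mathbb R^2,0)$ (orientation-reversing ones are allowed) such that $\psi^*\tilde H_1=H_0$ and $\psi^*\omega_1=\omega_0$. **Theorem.** Fix $k\ge2$ and a sign $\pm$, and let $H$ be a real-analytic Hamiltonian with an $A_{k-1}$ singularity at $O$ with this sign and $\omega$ a real-analytic symplectic form near $O$. Then, under analytic fibration-preserving equivalence, $(H,\omega)$ is equivalent to a normal form $$\Big(\xi^2\pm x^k,\ \Big(1+\sum_{i=1}^{k-2}x^i\,\hat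 c_i(\xi^2\pm x^k)\Big)\,d\xi\wedge dx\Big)$$ with germs $\hat c_1,\dots,\hat c_{k-2}$ at $0\in\mathbb R$ of real-analytic functions of one variable. The germs $\hat c_i$ are unique if $k$ is odd; if $k$ is even they are unique up to simultaneously changing the sign of all the odd-indexed ones, and this change does give an equivalent normal form. Moreover, these germs, taken up to that relation, form a complete and minimal set of invariants: two pairs $(H_0,\omega_0)$, $(H_1,\omega_1)$, both with an $A_{k-1}$ singularity with the given sign, are equivalent if and only if the germs of their normal forms coincide (for $k$ even: coincide up to simultaneously changing the sign of all the odd-indexed ones), and every family $\hat c_1,\dots,\hat c_{k-2}$ of real-analytic germs occurs. -/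

import Mathlib

open Filter Topology

/-- Symplectic germs live on the plane `ℝ²` with coordinates `(x, ξ)`: `p.1 = x`, `p.2 = ξ`. -/
abbrev Plane : Type := ℝ × ℝ

/-- Differential 2-forms on the plane. -/
abbrev TwoForm : Type := Plane → Plane [⋀^Fin 2]→L[ℝ] ℝ

/-- The constant form `dξ ∧ dx`, i.e. `(v, w) ↦ ξ(v) x(w) - ξ(w) x(v)`. -/
def dXiWedgeDx : Plane [⋀^Fin 2]→L[ℝ] ℝ where
  toFun m := (m 0).2 * (m 1).1 - (m 1).2 * (m 0).1
  map_update_add' m i u v := by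
    fin_cases i <;> simp [Function.update] <;> ring
  map_update_smul' m i t v := by
    fin_cases i <;> simp [Function.update] <;> ring
  map_eq_zero_of_eq' m i j h hij := by
    fin_cases i <;> fin_cases j <;> simp_all
  cont := by fun_prop

theorem dXiWedgeDx_apply (m : Fin 2 → Plane) :
    dXiWedgeDx m = (m 0).2 * (m 1).1 - (m 1).2 * (m 0).1 := rfl

/-- Pull-back `ψ^* ω` of a 2-form. -/
noncomputable def pullbackForm (ψ : Plane → Plane) (ω : TwoForm) : TwoForm :=
  fun p => (ω (ψ p)).compContinuousLinearMap (fderiv ℝ ψ p)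

/-- `ψ` represents a real-analytic diffeomorphism germ `(ℝ², 0) → (ℝ², 0)`: it is analytic at the
origin, fixes it, and has an analytic inverse near it. Orientation may be reversed. -/
def IsAnalyticDiffeoGerm (ψ : Plane → Plane) : Prop :=
  AnalyticAt ℝ ψ 0 ∧ ψ 0 = 0 ∧
    ∃ χ : Plane → Plane, AnalyticAt ℝ χ 0 ∧ χ 0 = 0 ∧
      (∀ᶠ p in 𝓝 (0 : Plane), χ (ψ p) = p) ∧ (∀ᶠ p in 𝓝 (0 : Plane), ψ (χ p) = p)

/-- `ω` represents a germ at the origin of a real-analytic symplectic form: analytic, closed and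
nondegenerate. -/
def IsAnalyticSymplecticGerm (ω : TwoForm) : Prop :=
  AnalyticAt ℝ ω 0 ∧ (∀ᶠ p in 𝓝 (0 : Plane), extDeriv ω p = 0) ∧
    ∀ᶠ p in 𝓝 (0 : Plane), ∀ v : Plane, (∀ w : Plane, ω p ![v, w] = 0) → v = 0

/-- The model Hamiltonian `ξ² + s x^k` (with `s = ±1`). -/
def modelH (k : ℕ) (s : ℝ) : Plane → ℝ :=
  fun p => p.2 ^ 2 + s * p.1 ^ k

/-- `H` is real-analytic at the origin and has there a singularity of type `A_{k-1}` with sign `s`: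
in suitable real-analytic local coordinates, `H = ξ² + s x^k + const`. -/
def HasAnalyticASingularity (k : ℕ) (s : ℝ) (H : Plane → ℝ) : Prop :=
  AnalyticAt ℝ H 0 ∧ ∃ φ : Plane → Plane, IsAnalyticDiffeoGerm φ ∧ ∃ a : ℝ,
    ∀ᶠ p in 𝓝 (0 : Plane), H (φ p) = modelH k s p + a

/-- `H` and `H'` define the same singular foliation near the origin: at every point near the
origin the two foliations have the same tangent space, `ker dH = ker dH'`. (The singular points
are those where this kernel is the whole plane.) -/
def SameFoliation (H H' : Plane → ℝ) : Prop :=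
  ∀ᶠ p in 𝓝 (0 : Plane), ∀ v : Plane, fderiv ℝ H p v = 0 ↔ fderiv ℝ H' p v = 0

/-- Analytic fibration-preserving equivalence of pairs `(H₀, ω₀)` and `(H₁, ω₁)`: for some analytic
`H'` defining the same singular foliation as `H₁`, the pair `(H₀, ω₀)` is the pull-back of
`(H', ω₁)` by an analytic diffeomorphism germ. -/
def FibrationEquiv (H₀ : Plane → ℝ) (ω₀ : TwoForm) (H₁ : Plane → ℝ) (ω₁ : TwoForm) : Prop :=
  ∃ (H' : Plane → ℝ) (ψ : Plane → Plane),
    AnalyticAt ℝ H' 0 ∧ SameFoliation H' H₁ ∧ IsAnalyticDiffeoGerm ψ ∧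
      (∀ᶠ p in 𝓝 (0 : Plane), H' (ψ p) = H₀ p) ∧
      (∀ᶠ p in 𝓝 (0 : Plane), pullbackForm ψ ω₁ p = ω₀ p)

/-- `c 1, …, c (k - 2)` are germs at `0` of real-analytic functions of one variable (the other
members of the family are irrelevant). -/
def IsAnalyticFamily (k : ℕ) (c : ℕ → ℝ → ℝ) : Prop :=
  ∀ i ∈ Finset.Icc 1 (k - 2), AnalyticAt ℝ (c i) 0

/-- The form `(1 + ∑_{i=1}^{k-2} x^i c_i(H)) dξ ∧ dx` with `H = ξ² + s x^k`. -/
noncomputable def normalForm (k : ℕ) (s : ℝ) (c : ℕ → ℝ → ℝ) : TwoForm :=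
  fun p => (1 + ∑ i ∈ Finset.Icc 1 (k - 2), p.1 ^ i * c i (modelH k s p)) • dXiWedgeDx

/-- Equality of the families of germs `c 1, …, c (k - 2)` and `c' 1, …, c' (k - 2)`, up to
changing simultaneously the sign of all odd-indexed members when `k` is even. -/
def SameInvariants (k : ℕ) (c c' : ℕ → ℝ → ℝ) : Prop :=
  (∀ i ∈ Finset.Icc 1 (k - 2), c i =ᶠ[𝓝 0] c' i) ∨
    (Even k ∧ ∀ i ∈ Finset.Icc 1 (k - 2), c i =ᶠ[𝓝 0] fun h => (-1) ^ i * c' i h)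

/-! In adapted coordinates `H = ξ² + s x^k` up to a constant and `ω = f dξ ∧ dx`, so it remains to
normalise the density `f` by maps that respect the level sets of `H`. Let `D` be the derivative
along the Hamiltonian field; `D η` is the density of `dH ∧ dη`.

Existence. Modulo the image of `D`, analytic germs form a free module over germs in `h = H` with
basis `1, x, …, x^(k-2)` (the Brieskorn lattice; `exists_decomposition`, `decomposition_unique`). In
the coordinates `(x, h)` the operator `D` exchanges the parts even and odd in `ξ`, and the claim
becomes a recursion on power series coefficients with geometric bounds. A term `D η` is then
absorbed by a map preserving `H`: follow the Hamiltonian flow from `p` for the time `τ p` during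
which the density integrates to `η p - η 0` (`exists_moser`). Finally the map `(l(H)² x, l(H)^k ξ)`,
with `l` obtained from an Euler-type differential equation, makes the leading coefficient `1`
(`fibrationEquiv_normalForm`).

Uniqueness. A map `ψ` between two normal forms satisfies `H ∘ ψ = G(H)` and sends the class of `x^i
dξ ∧ dx` to a combination of the `x^j` with coefficients `a_j(h)`. The form `k ξ dx - 2 x dξ`, whose
wedge product with `dH` is `2 k H dξ ∧ dx`, yields differential equations for the `a_j`
(`gaussManin_compat`). A nonzero `a_j` of order `n` at `0` would need `n k = i - j`, impossible for
`j ≠ i` because `|i - j| < k`; so only `a_i` survives. Leading coefficients equal to `1` then force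
`G` to be linear, `G = γ h`, and the `a_i` to be constant (`exists_linear_base`). For `k ≥ 3` the
linear part of `ψ` (`multiplier_eq`, `linear_part_constraints`) gives `c_i(t) = a^i c'_i(γ t)` with
`γ a² = 1` and `γ = a^k`. Hence `a^(k+2) = 1`, so `γ = 1` and `a = 1`, or `a = -1` with `k` even,
which is the sign change. For `k = 2` there are no coefficients to compare. -/

/-! ### Convergent double power series -/

/-- The coefficients `a i j` grow at most geometrically. -/
def GeomBounded (a : ℕ → ℕ → ℝ) : Prop :=
  ∃ C R : ℝ, 0 ≤ C ∧ 1 ≤ R ∧ ∀ i j, |a i j| ≤ C * R ^ (i + j)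

/-- Near the origin of the plane, `f (x, y) = ∑ a i j x ^ i y ^ j`, with absolute convergence. -/
def HasCoeffs (f : Plane → ℝ) (a : ℕ → ℕ → ℝ) : Prop :=
  GeomBounded a ∧
    ∀ᶠ p in 𝓝 (0 : Plane), HasSum (fun q : ℕ × ℕ => a q.1 q.2 * (p.1 ^ q.1 * p.2 ^ q.2)) (f p)

theorem eventually_abs_lt {r : ℝ} (hr : 0 < r) : ∀ᶠ p in 𝓝 (0 : Plane), |p.1| < r ∧ |p.2| < r := by
  filter_upwards [Metric.ball_mem_nhds (0 : Plane) hr] with p hp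
  rw [mem_ball_zero_iff, Prod.norm_def, max_lt_iff] at hp
  exact hp

/-- On the polydisc of radius `1 / (2R)` the series is dominated by a product of two geometric
series of ratio `1/2`. -/
theorem summable_of_abs_le {a : ℕ → ℕ → ℝ} {C R : ℝ} (hR : 1 ≤ R)
    (ha : ∀ i j, |a i j| ≤ C * R ^ (i + j)) {x y : ℝ} (hx : |x| ≤ 1 / (2 * R))
    (hy : |y| ≤ 1 / (2 * R)) :
    Summable fun q : ℕ × ℕ => a q.1 q.2 * (x ^ q.1 * y ^ q.2) := by
  have h2 : Summable fun q : ℕ × ℕ => C * ((1 / 2 : ℝ) ^ q.1 * (1 / 2 : ℝ) ^ q.2) :=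
    (summable_geometric_two.mul_of_nonneg summable_geometric_two
      (fun i => by positivity) (fun i => by positivity)).mul_left C
  refine Summable.of_norm_bounded h2 fun q => ?_
  have hR0 : 0 < R := by linarith
  rw [Real.norm_eq_abs, abs_mul, abs_mul, abs_pow, abs_pow]
  calc |a q.1 q.2| * (|x| ^ q.1 * |y| ^ q.2)
      ≤ C * R ^ (q.1 + q.2) * ((1 / (2 * R)) ^ q.1 * (1 / (2 * R)) ^ q.2) := by
        have : 0 ≤ C * R ^ (q.1 + q.2) := (abs_nonneg _).trans (ha _ _)
        gcongr
        exact ha _ _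
    _ = C * ((1 / 2 : ℝ) ^ q.1 * (1 / 2 : ℝ) ^ q.2) := by
        have h1 : (1 / 2 : ℝ) = R * (1 / (2 * R)) := by field_simp
        rw [h1, mul_pow, mul_pow, pow_add]
        ring

theorem GeomBounded.eventually_summable {a : ℕ → ℕ → ℝ} (ha : GeomBounded a) :
    ∀ᶠ p in 𝓝 (0 : Plane),
      Summable fun q : ℕ × ℕ => a q.1 q.2 * (p.1 ^ q.1 * p.2 ^ q.2) := by
  obtain ⟨C, R, hC, hR, h⟩ := ha
  filter_upwards [eventually_abs_lt (r := 1 / (2 * R)) (by positivity)] with p hp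
  exact summable_of_abs_le hR h hp.1.le hp.2.le

theorem GeomBounded.hasCoeffs_tsum {a : ℕ → ℕ → ℝ} (ha : GeomBounded a) :
    HasCoeffs (fun p => ∑' q : ℕ × ℕ, a q.1 q.2 * (p.1 ^ q.1 * p.2 ^ q.2)) a :=
  ⟨ha, ha.eventually_summable.mono fun _ h => h.hasSum⟩

theorem HasCoeffs.congr {f g : Plane → ℝ} {a : ℕ → ℕ → ℝ} (hf : HasCoeffs f a)
    (h : f =ᶠ[𝓝 0] g) : HasCoeffs g a :=
  ⟨hf.1, by filter_upwards [hf.2, h] with p h1 h2; rwa [← h2]⟩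

theorem HasCoeffs.eventuallyEq {f g : Plane → ℝ} {a : ℕ → ℕ → ℝ} (hf : HasCoeffs f a)
    (hg : HasCoeffs g a) : f =ᶠ[𝓝 0] g := by
  filter_upwards [hf.2, hg.2] with p h1 h2 using h1.unique h2

theorem GeomBounded.of_le {a b : ℕ → ℕ → ℝ} (ha : GeomBounded a)
    (h : ∀ i j, |b i j| ≤ |a i j|) : GeomBounded b := by
  obtain ⟨C, R, hC, hR, h'⟩ := ha
  exact ⟨C, R, hC, hR, fun i j => (h i j).trans (h' i j)⟩

theorem GeomBounded.add {a b : ℕ → ℕ → ℝ} (ha : GeomBounded a) (hb : GeomBounded b) :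
    GeomBounded fun i j => a i j + b i j := by
  obtain ⟨C, R, hC, hR, h⟩ := ha
  obtain ⟨C', R', hC', hR', h'⟩ := hb
  refine ⟨C + C', max R R', by positivity, le_max_of_le_left hR, fun i j => ?_⟩
  calc |a i j + b i j| ≤ |a i j| + |b i j| := abs_add_le _ _
    _ ≤ C * R ^ (i + j) + C' * R' ^ (i + j) := add_le_add (h i j) (h' i j)
    _ ≤ C * (max R R') ^ (i + j) + C' * (max R R') ^ (i + j) := by
      gcongr
      · exact le_max_left _ _
      · exact le_max_right _ _
    _ = _ := by ring

theorem HasCoeffs.add {f g : Plane → ℝ} {a b : ℕ → ℕ → ℝ} (hf : HasCoeffs f a)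
    (hg : HasCoeffs g b) : HasCoeffs (fun p => f p + g p) fun i j => a i j + b i j := by
  refine ⟨hf.1.add hg.1, ?_⟩
  filter_upwards [hf.2, hg.2] with p h1 h2
  simpa only [add_mul] using h1.add h2

theorem HasCoeffs.const_mul {f : Plane → ℝ} {a : ℕ → ℕ → ℝ} (c : ℝ) (hf : HasCoeffs f a) :
    HasCoeffs (fun p => c * f p) fun i j => c * a i j := by
  obtain ⟨⟨C, R, hC, hR, h⟩, h'⟩ := hf
  refine ⟨⟨|c| * C, R, by positivity, hR, fun i j => ?_⟩, ?_⟩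
  · rw [abs_mul, mul_assoc]
    exact mul_le_mul_of_nonneg_left (h i j) (abs_nonneg c)
  · filter_upwards [h'] with p hp
    simpa only [mul_assoc] using hp.mul_left c

theorem hasCoeffs_zero : HasCoeffs (fun _ => 0) fun _ _ => 0 :=
  ⟨⟨0, 1, le_rfl, le_rfl, by simp⟩, by simp [hasSum_zero]⟩

theorem HasCoeffs.sum {ι : Type*} (s : Finset ι) {f : ι → Plane → ℝ} {a : ι → ℕ → ℕ → ℝ}
    (hf : ∀ n ∈ s, HasCoeffs (f n) (a n)) :
    HasCoeffs (fun p => ∑ n ∈ s, f n p) fun i j => ∑ n ∈ s, a n i j := by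
  classical
  induction s using Finset.induction_on with
  | empty => simpa using hasCoeffs_zero
  | insert n s hn ih =>
    simp only [Finset.sum_insert hn]
    exact (hf n (Finset.mem_insert_self n s)).add
      (ih fun m hm => hf m (Finset.mem_insert_of_mem hm))

/-- Multiplication by a monomial shifts the coefficients. -/
theorem HasCoeffs.shift {f : Plane → ℝ} {a : ℕ → ℕ → ℝ} (m n : ℕ) (hf : HasCoeffs f a) :
    HasCoeffs (fun p => p.1 ^ m * p.2 ^ n * f p)
      fun i j => if m ≤ i ∧ n ≤ j then a (i - m) (j - n) else 0 := by
  obtain ⟨⟨C, R, hC, hR, h⟩, h'⟩ := hf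
  refine ⟨⟨C, R, hC, hR, fun i j => ?_⟩, ?_⟩
  · dsimp only
    split_ifs with hij
    · refine (h _ _).trans ?_
      exact mul_le_mul_of_nonneg_left (pow_le_pow_right₀ hR (by omega)) hC
    · simpa using by positivity
  · filter_upwards [h'] with p hp
    have hinj : Function.Injective fun q : ℕ × ℕ => (q.1 + m, q.2 + n) := by
      rintro ⟨i, j⟩ ⟨i', j'⟩ hq
      simpa using hq
    rw [← hinj.hasSum_iff]
    · convert! hp.mul_left (p.1 ^ m * p.2 ^ n) using 2 with q
      simp [pow_add]
      ring
    · rintro ⟨i, j⟩ hq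
      rw [if_neg, zero_mul]
      rintro ⟨hi, hj⟩
      exact hq ⟨(i - m, j - n), by simp [hi, hj]⟩

/-- A convergent double power series is analytic. -/
theorem HasCoeffs.analyticAt {f : Plane → ℝ} {a : ℕ → ℕ → ℝ} (hf : HasCoeffs f a) :
    AnalyticAt ℝ f 0 := by
  obtain ⟨⟨C, R, hC, hR, h⟩, h'⟩ := hf
  have hR0 : 0 < R := by linarith
  -- The monomial `x^i y^(n-i)` as an `n`-linear form: the first `i` slots read `x`, the others `y`.
  -- It need not be symmetric.
  let mono (n i : ℕ) : ContinuousMultilinearMap ℝ (fun _ : Fin n => Plane) ℝ :=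
    (ContinuousMultilinearMap.mkPiAlgebra ℝ (Fin n) ℝ).compContinuousLinearMap
      fun l => if (l : ℕ) < i then ContinuousLinearMap.fst ℝ ℝ ℝ else ContinuousLinearMap.snd ℝ ℝ ℝ
  have mono_norm (n i : ℕ) : ‖mono n i‖ ≤ 1 := by
    refine (ContinuousMultilinearMap.norm_compContinuousLinearMap_le _ _).trans ?_
    rw [ContinuousMultilinearMap.norm_mkPiAlgebra, one_mul]
    refine Finset.prod_le_one (fun _ _ => norm_nonneg _) fun l _ => ?_
    split_ifs
    · exact ContinuousLinearMap.norm_fst_le ..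
    · exact ContinuousLinearMap.norm_snd_le ..
  have mono_apply (i j : ℕ) (p : Plane) : mono (i + j) i (fun _ => p) = p.1 ^ i * p.2 ^ j := by
    have : mono (i + j) i (fun _ => p) = ∏ l : Fin (i + j), if (l : ℕ) < i then p.1 else p.2 := by
      simp only [mono, ContinuousMultilinearMap.compContinuousLinearMap_apply,
        ContinuousMultilinearMap.mkPiAlgebra_apply]
      refine Finset.prod_congr rfl fun l _ => ?_
      split_ifs <;> rfl
    rw [this, Fin.prod_univ_add]
    simp
  let P : FormalMultilinearSeries ℝ Plane ℝ := fun n =>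
    ∑ q ∈ Finset.HasAntidiagonal.antidiagonal n, a q.1 q.2 • mono n q.1
  have P_norm (n : ℕ) : ‖P n‖ ≤ (n + 1) * (C * R ^ n) := by
    refine (norm_sum_le _ _).trans ?_
    have : ∀ q ∈ Finset.HasAntidiagonal.antidiagonal n, ‖a q.1 q.2 • mono n q.1‖ ≤ C * R ^ n := by
      intro q hq
      rw [norm_smul]
      have h1 := h q.1 q.2
      rw [Finset.HasAntidiagonal.mem_antidiagonal.1 hq] at h1
      calc _ ≤ C * R ^ n * 1 := mul_le_mul h1 (mono_norm _ _) (norm_nonneg _) (by positivity)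
        _ = _ := mul_one _
    refine (Finset.sum_le_card_nsmul _ _ _ this).trans ?_
    simp
  -- The degree `n` part has `n + 1 ≤ 2^n` monomials, which halves the radius `1 / R`.
  have hrad : 0 < P.radius := by
    refine lt_of_lt_of_le ?_
      (P.le_radius_of_bound (r := ⟨1 / (2 * R), by positivity⟩) C fun n => ?_)
    · exact ENNReal.coe_pos.2 (show (0 : ℝ) < 1 / (2 * R) by positivity)
    · have h2 : ((n : ℝ) + 1) ≤ 2 ^ n := by exact_mod_cast Nat.lt_two_pow_self
      calc ‖P n‖ * (1 / (2 * R)) ^ n ≤ 2 ^ n * (C * R ^ n) * (1 / (2 * R)) ^ n := by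
            gcongr
            exact (P_norm n).trans (by gcongr)
        _ = C := by
          rw [one_div, inv_pow, mul_pow]
          field_simp
  have key : f =ᶠ[𝓝 0] P.sum := by
    filter_upwards [h'] with p hp
    have h1 := ((Finset.HasAntidiagonal.sigmaAntidiagonalEquivProd (A := ℕ)).hasSum_iff.2 hp).sigma
      fun n => hasSum_fintype _
    rw [FormalMultilinearSeries.sum, ← h1.tsum_eq]
    refine tsum_congr fun n => ?_
    simp only [P, sum_apply, smul_apply]
    rw [← Finset.sum_coe_sort (Finset.HasAntidiagonal.antidiagonal n)]
    refine Finset.sum_congr rfl fun q _ => ?_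
    obtain ⟨⟨i, j⟩, hq⟩ := q
    rw [Finset.HasAntidiagonal.mem_antidiagonal] at hq
    simp only at hq
    subst hq
    simp [mono_apply, Finset.HasAntidiagonal.sigmaAntidiagonalEquivProd]
  exact ((P.hasFPowerSeriesOnBall hrad).analyticAt).congr key.symm

/-- An analytic germ of two variables is a convergent double power series. -/
theorem AnalyticAt.exists_hasCoeffs {f : Plane → ℝ} (hf : AnalyticAt ℝ f 0) :
    ∃ a, HasCoeffs f a := by
  obtain ⟨P, r, hP⟩ := hf
  obtain ⟨ρ, hρ0, hρ⟩ := ENNReal.lt_iff_exists_nnreal_btwn.1 (hP.r_pos.trans_le hP.r_le)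
  obtain ⟨C, hC, hPC⟩ := P.norm_mul_pow_le_of_lt_radius hρ
  have hρ0 : (0 : ℝ) < ρ := by exact_mod_cast ENNReal.coe_pos.1 hρ0
  let e : (n : ℕ) → Finset (Fin n) → Fin n → Plane :=
    fun n S => S.piecewise (fun _ => ((1, 0) : Plane)) fun _ => ((0, 1) : Plane)
  -- Expanding `P n` at `x e₁ + y e₂` multilinearly, the coefficient of `x^i y^(n-i)` collects all
  -- choices of `i` slots carrying `e₁`. There are `2^n` choices in all, whence the rate `2 / ρ`
  -- below.
  let b : ℕ → ℕ → ℝ := fun n i => ∑ S ∈ Finset.powersetCard i Finset.univ, P n (e n S)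
  have e_norm (n S l) : ‖e n S l‖ ≤ 1 := by
    by_cases h : l ∈ S <;> simp [e, h, Prod.norm_def]
  have b_le (n i : ℕ) : |b n i| ≤ C * (2 / ρ) ^ n := by
    have h1 : ∀ S : Finset (Fin n), |P n (e n S)| ≤ ‖P n‖ := fun S => by
      refine ((P n).le_opNorm _).trans (mul_le_of_le_one_right (norm_nonneg _) ?_)
      exact Finset.prod_le_one (fun _ _ => norm_nonneg _) fun l _ => e_norm n S l
    calc |b n i| ≤ ∑ S ∈ Finset.powersetCard i Finset.univ, |P n (e n S)| :=
          Finset.abs_sum_le_sum_abs _ _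
      _ ≤ ∑ S : Finset (Fin n), |P n (e n S)| :=
          Finset.sum_le_univ_sum_of_nonneg fun _ => abs_nonneg _
      _ ≤ ∑ _S : Finset (Fin n), ‖P n‖ := Finset.sum_le_sum fun S _ => h1 S
      _ = 2 ^ n * ‖P n‖ := by simp
      _ ≤ 2 ^ n * (C / ρ ^ n) := by
          gcongr
          rw [le_div_iff₀ (by positivity)]
          exact hPC n
      _ = _ := by rw [div_pow]; ring
  have diag (n : ℕ) (p : Plane) : P n (fun _ => p) =
      ∑ q ∈ Finset.HasAntidiagonal.antidiagonal n, b n q.1 * (p.1 ^ q.1 * p.2 ^ q.2) := by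
    have h1 : (fun _ : Fin n => p) =
        (fun _ => p.1 • ((1, 0) : Plane)) + fun _ => p.2 • ((0, 1) : Plane) := by
      ext l <;> simp
    have h2 (S : Finset (Fin n)) :
        P n (S.piecewise (fun _ => p.1 • ((1, 0) : Plane)) fun _ => p.2 • ((0, 1) : Plane)) =
          p.1 ^ S.card * p.2 ^ (n - S.card) * P n (e n S) := by
      have h3 : (S.piecewise (fun _ => p.1 • ((1, 0) : Plane)) fun _ => p.2 • ((0, 1) : Plane)) =
          fun l => (if l ∈ S then p.1 else p.2) • e n S l := by
        ext l <;> by_cases h : l ∈ S <;> simp [e, h]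
      rw [h3, ContinuousMultilinearMap.map_smul_univ, Finset.prod_ite, smul_eq_mul]
      have h4 : (Finset.univ.filter fun l => l ∉ S).card = n - S.card := by
        rw [← Finset.compl_filter, Finset.card_compl, Fintype.card_fin]
        simp
      simp only [Finset.prod_const, h4]
      simp
    rw [h1, ContinuousMultilinearMap.map_add_univ, ← Finset.powerset_univ, Finset.sum_powerset,
      Finset.Nat.sum_antidiagonal_eq_sum_range_succ_mk, Finset.card_univ, Fintype.card_fin]
    refine Finset.sum_congr rfl fun i _ => ?_
    rw [Finset.sum_mul]
    refine Finset.sum_congr rfl fun S hS => ?_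
    rw [h2, (Finset.mem_powersetCard.1 hS).2]
    ring
  have hb : GeomBounded fun i j => b (i + j) i := by
    refine ⟨C, max 1 (2 / ρ), hC.le, le_max_left _ _, fun i j => (b_le _ _).trans ?_⟩
    gcongr
    exact le_max_right _ _
  refine ⟨_, hb, ?_⟩
  filter_upwards [hb.eventually_summable, hP.eventually_hasSum] with p hp1 hp2
  have h1 := hp1.hasSum
  have h2 := ((Finset.HasAntidiagonal.sigmaAntidiagonalEquivProd (A := ℕ)).hasSum_iff.2 h1).sigma
    fun n => hasSum_fintype _
  convert h1 using 1
  refine HasSum.unique (f := fun n => P n fun _ => p) (by simpa using hp2) ?_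
  convert! h2 using 2 with n
  rw [diag, ← Finset.sum_coe_sort (Finset.HasAntidiagonal.antidiagonal n)]
  refine Finset.sum_congr rfl fun q _ => ?_
  obtain ⟨⟨i, j⟩, hq⟩ := q
  rw [Finset.HasAntidiagonal.mem_antidiagonal] at hq
  simp only at hq
  subst hq
  simp [Finset.HasAntidiagonal.sigmaAntidiagonalEquivProd]

theorem coeff_eq_zero_of_hasSum {a : ℕ → ℝ}
    (h : ∀ᶠ x in 𝓝 (0 : ℝ), HasSum (fun n => a n * x ^ n) 0) (n : ℕ) : a n = 0 := by
  have h1 : HasFPowerSeriesAt (fun _ : ℝ => (0 : ℝ)) (FormalMultilinearSeries.ofScalars ℝ a) 0 := by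
    rw [hasFPowerSeriesAt_iff]
    filter_upwards [h] with x hx
    simpa [mul_comm] using hx
  have h2 := h1.eq_zero
  have h3 : (FormalMultilinearSeries.ofScalars ℝ a).coeff n =
      (0 : FormalMultilinearSeries ℝ ℝ ℝ).coeff n := by rw [h2]
  rw [FormalMultilinearSeries.coeff_ofScalars] at h3
  exact h3

/-- The inner sums of a double series. -/
theorem HasCoeffs.exists_rows {f : Plane → ℝ} {a : ℕ → ℕ → ℝ} (hf : HasCoeffs f a) :
    ∃ C R : ℝ, 0 ≤ C ∧ 1 ≤ R ∧ ∃ A : ℕ → ℝ → ℝ,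
      (∀ i, AnalyticAt ℝ (A i) 0) ∧
      (∀ i, ∀ y, |y| ≤ 1 / (2 * R) → HasSum (fun j => a i j * y ^ j) (A i y)) ∧
      (∀ i, ∀ y, |y| ≤ 1 / (2 * R) → |A i y| ≤ C * R ^ i) ∧
      ∀ᶠ p in 𝓝 (0 : Plane), HasSum (fun i => A i p.2 * p.1 ^ i) (f p) := by
  obtain ⟨⟨C, R, hC, hR, h⟩, h'⟩ := hf
  have hR0 : 0 < R := by linarith
  have key (i : ℕ) (y : ℝ) (hy : |y| ≤ 1 / (2 * R)) (j : ℕ) :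
      ‖a i j * y ^ j‖ ≤ C * R ^ i * (1 / 2) ^ j := by
    rw [Real.norm_eq_abs, abs_mul, abs_pow]
    calc |a i j| * |y| ^ j ≤ C * R ^ (i + j) * (1 / (2 * R)) ^ j := by
          gcongr
          exact h i j
      _ = _ := by
        have h1 : (1 / 2 : ℝ) = R * (1 / (2 * R)) := by field_simp
        rw [h1, mul_pow, pow_add]
        ring
  have hsum (i : ℕ) : Summable fun j : ℕ => C * R ^ i * (1 / 2 : ℝ) ^ j :=
    summable_geometric_two.mul_left _
  have hA (i : ℕ) (y : ℝ) (hy : |y| ≤ 1 / (2 * R)) :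
      HasSum (fun j => a i j * y ^ j) (∑' j, a i j * y ^ j) :=
    (Summable.of_norm_bounded (hsum i) (key i y hy)).hasSum
  refine ⟨2 * C, R, by positivity, hR, fun i y => ∑' j, a i j * y ^ j, fun i => ?_, hA, ?_, ?_⟩
  · have h1 : HasFPowerSeriesAt (fun y : ℝ => ∑' j, a i j * y ^ j)
        (FormalMultilinearSeries.ofScalars ℝ (a i)) 0 := by
      rw [hasFPowerSeriesAt_iff]
      filter_upwards [Metric.ball_mem_nhds (0 : ℝ) (show 0 < 1 / (2 * R) by positivity)] with y hy
      rw [mem_ball_zero_iff] at hy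
      simpa [mul_comm] using hA i y hy.le
    exact h1.analyticAt
  · intro i y hy
    refine (tsum_of_norm_bounded (hsum i).hasSum (key i y hy)).trans ?_
    rw [tsum_mul_left, tsum_geometric_two]
    exact le_of_eq (by ring)
  · filter_upwards [h', eventually_abs_lt (r := 1 / (2 * R)) (by positivity)] with p hp hp2
    refine hp.prod_fiberwise fun i => ?_
    convert! (hA i p.2 hp2.2.le).mul_right (p.1 ^ i) using 2 with j
    ring

/-- One-variable uniqueness is used twice: for each fixed small `y` the series in `x` vanishes, so
every row sum `A i y` is zero, and then the series in `y` of each row vanishes. -/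
theorem HasCoeffs.eq_zero {a : ℕ → ℕ → ℝ} (hf : HasCoeffs (fun _ => 0) a) (i j : ℕ) :
    a i j = 0 := by
  obtain ⟨C, R, hC, hR, A, -, hA, -, h⟩ := hf.exists_rows
  have h1 : ∀ᶠ y in 𝓝 (0 : ℝ), A i y = 0 := by
    have h2 : ∀ᶠ y in 𝓝 (0 : ℝ), ∀ᶠ x in 𝓝 (0 : ℝ), HasSum (fun i => A i y * x ^ i) 0 := by
      have := h.curry_nhds
      have h3 : Tendsto Prod.swap (𝓝 ((0 : ℝ), (0 : ℝ))) (𝓝 ((0 : ℝ), (0 : ℝ))) :=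
        continuous_swap.tendsto' _ _ rfl
      exact (h3.eventually h).curry_nhds
    filter_upwards [h2] with y hy using coeff_eq_zero_of_hasSum hy i
  refine coeff_eq_zero_of_hasSum (a := a i) ?_ j
  filter_upwards [h1, Metric.ball_mem_nhds (0 : ℝ) (show 0 < 1 / (2 * R) by positivity)] with y h2 h3
  rw [mem_ball_zero_iff] at h3
  rw [← h2]
  exact hA i y h3.le

theorem HasCoeffs.unique {f : Plane → ℝ} {a b : ℕ → ℕ → ℝ} (hf : HasCoeffs f a)
    (hg : HasCoeffs f b) (i j : ℕ) : a i j = b i j := by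
  have h := (hf.add (hg.const_mul (-1))).congr (g := fun _ => 0) (by simp)
  have := h.eq_zero i j
  linarith

/-- Differentiation of a double power series with respect to its first variable. -/
theorem HasCoeffs.fderiv_fst {f : Plane → ℝ} {a : ℕ → ℕ → ℝ} (hf : HasCoeffs f a) :
    HasCoeffs (fun p => fderiv ℝ f p (1, 0)) fun i j => (i + 1) * a (i + 1) j := by
  have han := hf.analyticAt
  obtain ⟨⟨C, R, hC, hR, h⟩, h'⟩ := hf
  have hR0 : 0 < R := by linarith
  have hbd : GeomBounded fun i j => ((i : ℝ) + 1) * a (i + 1) j := by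
    refine ⟨C * R, 2 * R, by positivity, by linarith, fun i j => ?_⟩
    rw [abs_mul, abs_of_pos (by positivity : (0 : ℝ) < i + 1)]
    have h2 : ((i : ℝ) + 1) ≤ 2 ^ (i + j) := by
      have : i + 1 ≤ 2 ^ i := Nat.lt_two_pow_self
      calc ((i : ℝ) + 1) ≤ 2 ^ i := by exact_mod_cast this
        _ ≤ 2 ^ (i + j) := pow_le_pow_right₀ (by norm_num) (by omega)
    calc ((i : ℝ) + 1) * |a (i + 1) j| ≤ 2 ^ (i + j) * (C * R ^ (i + 1 + j)) :=
          mul_le_mul h2 (h _ _) (abs_nonneg _) (by positivity)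
      _ = _ := by rw [mul_pow]; ring
  refine ⟨hbd, ?_⟩
  -- The factor `i ≤ 2^i` produced by differentiation costs a factor `2` in the `x` radius; with `r
  -- = 1 / (4R)` the terms are still bounded by powers of `1/2`.
  set r : ℝ := 1 / (4 * R) with hr
  have hr0 : 0 < r := by positivity
  let u : ℕ × ℕ → ℝ := fun q => C * (4 * R) * ((1 / 2) ^ q.1 * (1 / 2) ^ q.2)
  have hu : Summable u := (summable_geometric_two.mul_of_nonneg summable_geometric_two
      (fun i => by positivity) (fun i => by positivity)).mul_left _
  let g : ℝ → ℕ × ℕ → ℝ → ℝ := fun y q x => a q.1 q.2 * (x ^ q.1 * y ^ q.2)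
  let g' : ℝ → ℕ × ℕ → ℝ → ℝ := fun y q x => a q.1 q.2 * (q.1 * x ^ (q.1 - 1) * y ^ q.2)
  have hg (y : ℝ) (q : ℕ × ℕ) (x : ℝ) : HasDerivAt (g y q) (g' y q x) x :=
    ((hasDerivAt_pow q.1 x).mul_const _).const_mul _
  have hg' (y : ℝ) (hy : |y| < r) (q : ℕ × ℕ) (x : ℝ) (hx : x ∈ Metric.ball (0 : ℝ) r) :
      ‖g' y q x‖ ≤ u q := by
    rw [mem_ball_zero_iff, Real.norm_eq_abs] at hx
    obtain ⟨i, j⟩ := q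
    simp only [g', u, Real.norm_eq_abs, abs_mul, abs_pow, Nat.abs_cast]
    rcases i with _ | i
    · simp only [Nat.cast_zero, zero_mul, mul_zero]
      positivity
    have h2 : (((i + 1 : ℕ) : ℝ)) ≤ 2 ^ (i + 1) := by exact_mod_cast Nat.lt_two_pow_self.le
    calc |a (i + 1) j| * (((i + 1 : ℕ) : ℝ) * |x| ^ (i + 1 - 1) * |y| ^ j)
        ≤ C * R ^ (i + 1 + j) * (2 ^ (i + 1) * r ^ i * r ^ j) := by
          gcongr
          · exact h _ _
          · rw [Nat.add_sub_cancel]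
            gcongr
      _ ≤ C * (4 * R) * ((1 / 2) ^ (i + 1) * (1 / 4) ^ j) := by
          have h3 : (1 / 4 : ℝ) = R * r := by rw [hr]; field_simp
          have h4 : (1 / 2 : ℝ) = 2 * (R * r) := by rw [hr]; field_simp; norm_num
          rw [h3, h4]
          refine le_of_eq ?_
          calc C * R ^ (i + 1 + j) * (2 ^ (i + 1) * r ^ i * r ^ j)
              = C * ((2 * (R * r)) ^ (i + 1) * (R * r) ^ j) * (1 / r) := by
                field_simp
                simp only [mul_pow, pow_add]
                ring
            _ = _ := by rw [hr]; field_simp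
      _ ≤ C * (4 * R) * ((1 / 2) ^ (i + 1) * (1 / 2) ^ j) := by
          gcongr
          norm_num
  have hball : ∀ᶠ p in 𝓝 (0 : Plane), ∀ᶠ q in 𝓝 p,
      HasSum (fun n : ℕ × ℕ => a n.1 n.2 * (q.1 ^ n.1 * q.2 ^ n.2)) (f q) := h'.eventually_nhds
  filter_upwards [hball, eventually_abs_lt hr0, han.eventually_analyticAt, hbd.eventually_summable]
    with p hp hpr hpa hps
  have hmem : p.1 ∈ Metric.ball (0 : ℝ) r := by
    rw [mem_ball_zero_iff]; exact hpr.1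
  have hd := hasDerivAt_tsum_of_isPreconnected hu Metric.isOpen_ball
    (convex_ball (0 : ℝ) r).isPreconnected (fun q x _ => hg p.2 q x) (hg' p.2 hpr.2) hmem
    (hp.self_of_nhds.summable) hmem
  have hd2 : HasDerivAt (fun x => f (x, p.2)) (fderiv ℝ f p (1, 0)) p.1 := by
    have h1 : HasDerivAt (fun x : ℝ => ((x, p.2) : Plane)) (1, 0) p.1 :=
      (hasDerivAt_id p.1).prodMk (hasDerivAt_const _ _)
    exact (hpa.differentiableAt.hasFDerivAt (x := (p.1, p.2))).comp_hasDerivAt p.1 h1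
  have hcont : Tendsto (fun x : ℝ => ((x, p.2) : Plane)) (𝓝 p.1) (𝓝 p) :=
    (by fun_prop : Continuous fun x : ℝ => ((x, p.2) : Plane)).tendsto' _ _ rfl
  have heq : (fun x => f (x, p.2)) =ᶠ[𝓝 p.1] fun x => ∑' q, g p.2 q x := by
    filter_upwards [hcont.eventually hp] with x hx using hx.tsum_eq.symm
  rw [hd2.unique (hd.congr_of_eventuallyEq heq)]
  convert! hps.hasSum using 1
  have hinj : Function.Injective fun q : ℕ × ℕ => (q.1 + 1, q.2) := by
    rintro ⟨i, j⟩ ⟨i', j'⟩ hq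
    simpa using hq
  rw [← hinj.tsum_eq]
  · refine tsum_congr fun q => ?_
    simp [g']
    ring
  · rintro ⟨i, j⟩ hq
    rcases i with _ | i
    · simp [g'] at hq
    · exact ⟨(i, j), rfl⟩

attribute [fun_prop] analyticAt_fst analyticAt_snd

/-- A double series with finitely many nonzero rows is a polynomial in the first variable. -/
theorem HasCoeffs.exists_eq_sum {f : Plane → ℝ} {a : ℕ → ℕ → ℝ} (hf : HasCoeffs f a) {N : ℕ}
    (ha : ∀ i j, N ≤ i → a i j = 0) :
    ∃ c : ℕ → ℝ → ℝ, (∀ i, AnalyticAt ℝ (c i) 0) ∧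
      ∀ᶠ p in 𝓝 (0 : Plane), f p = ∑ i ∈ Finset.range N, p.1 ^ i * c i p.2 := by
  obtain ⟨C, R, hC, hR, A, hA, hA', -, h⟩ := hf.exists_rows
  refine ⟨A, hA, ?_⟩
  filter_upwards [h, eventually_abs_lt (r := 1 / (2 * R)) (by positivity)] with p hp hpr
  refine hp.unique ?_
  simp only [mul_comm (p.1 ^ _)]
  refine hasSum_sum_of_ne_finset_zero fun i hi => ?_
  have h1 := hA' i p.2 hpr.2.le
  simp only [ha i _ (by simpa using hi), zero_mul] at h1
  rw [h1.unique hasSum_zero, zero_mul]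

theorem analyticAt_comp_snd {c : ℝ → ℝ} (hc : AnalyticAt ℝ c 0) :
    AnalyticAt ℝ (fun p : Plane => c p.2) 0 :=
  AnalyticAt.fun_comp (g := c) (f := fun p : Plane => p.2) hc analyticAt_snd

theorem AnalyticAt.eventually_differentiableAt {E F : Type*} [NormedAddCommGroup E]
    [NormedSpace ℝ E] [NormedAddCommGroup F] [NormedSpace ℝ F] [CompleteSpace F] {f : E → F} {x : E}
    (hf : AnalyticAt ℝ f x) : ∀ᶠ y in 𝓝 x, DifferentiableAt ℝ f y :=
  hf.eventually_analyticAt.mono fun _ h => h.differentiableAt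

/-- The `x`-derivative vanishes, and it multiplies row `i + 1` by the nonzero number `i + 1`. -/
theorem hasCoeffs_comp_snd {c : ℝ → ℝ} (hc : AnalyticAt ℝ c 0) :
    ∃ a, HasCoeffs (fun p => c p.2) a ∧ ∀ i j, a (i + 1) j = 0 := by
  obtain ⟨a, ha⟩ := (analyticAt_comp_snd hc).exists_hasCoeffs
  refine ⟨a, ha, fun i j => ?_⟩
  have h1 : (fun p : Plane => fderiv ℝ (fun p : Plane => c p.2) p (1, 0)) =ᶠ[𝓝 0] fun _ => 0 := by
    have h2 : Tendsto (fun p : Plane => p.2) (𝓝 0) (𝓝 0) := continuous_snd.tendsto' _ _ rfl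
    filter_upwards [h2.eventually hc.eventually_differentiableAt] with p hp
    have := hp.hasFDerivAt.comp p (hasFDerivAt_snd (𝕜 := ℝ) (p := p))
    have h3 := this.fderiv
    simp only [Function.comp_def] at h3
    simp [h3]
  have h2 := (ha.fderiv_fst.congr h1).eq_zero i j
  have h3 : (i : ℝ) + 1 ≠ 0 := by positivity
  exact (mul_eq_zero.1 h2).resolve_left h3

/-! ### The Hamiltonian field and the coordinates `(x, H)` -/

/-- The Hamiltonian vector field of `modelH` with respect to `dξ ∧ dx`. -/
def modelV (k : ℕ) (s : ℝ) (p : Plane) : Plane := (2 * p.2, -(s * k * p.1 ^ (k - 1)))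

/-- Differentiation along the Hamiltonian vector field: `dH ∧ dη = (modelD η) dξ ∧ dx`. -/
noncomputable def modelD (k : ℕ) (s : ℝ) (f : Plane → ℝ) (p : Plane) : ℝ :=
  fderiv ℝ f p (modelV k s p)

theorem modelH_zero {k : ℕ} (hk : k ≠ 0) (s : ℝ) : modelH k s 0 = 0 := by simp [modelH, hk]

theorem analyticAt_modelH (k : ℕ) (s : ℝ) (p : Plane) : AnalyticAt ℝ (modelH k s) p := by
  unfold modelH
  fun_prop

theorem hasFDerivAt_modelH (k : ℕ) (s : ℝ) (p : Plane) :
    HasFDerivAt (modelH k s) ((s * k * p.1 ^ (k - 1)) • ContinuousLinearMap.fst ℝ ℝ ℝ +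
      (2 * p.2) • ContinuousLinearMap.snd ℝ ℝ ℝ) p := by
  have h1 : HasFDerivAt (fun p : Plane => p.1) (ContinuousLinearMap.fst ℝ ℝ ℝ) p := hasFDerivAt_fst
  have h2 : HasFDerivAt (fun p : Plane => p.2) (ContinuousLinearMap.snd ℝ ℝ ℝ) p := hasFDerivAt_snd
  refine ((h2.pow 2).add ((h1.pow k).const_mul s)).congr_fderiv ?_
  ext <;> simp
  ring

theorem fderiv_modelH (k : ℕ) (s : ℝ) (p v : Plane) :
    fderiv ℝ (modelH k s) p v = s * k * p.1 ^ (k - 1) * v.1 + 2 * p.2 * v.2 := by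
  simp [(hasFDerivAt_modelH k s p).fderiv]

theorem modelD_modelH (k : ℕ) (s : ℝ) (p : Plane) : modelD k s (modelH k s) p = 0 := by
  rw [modelD, fderiv_modelH, modelV]
  ring

theorem modelD_mul {k : ℕ} {s : ℝ} {f g : Plane → ℝ} {p : Plane} (hf : DifferentiableAt ℝ f p)
    (hg : DifferentiableAt ℝ g p) :
    modelD k s (fun p => f p * g p) p = f p * modelD k s g p + g p * modelD k s f p := by
  simp [modelD, fderiv_fun_mul hf hg]

theorem modelD_add {k : ℕ} {s : ℝ} {f g : Plane → ℝ} {p : Plane} (hf : DifferentiableAt ℝ f p)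
    (hg : DifferentiableAt ℝ g p) :
    modelD k s (fun p => f p + g p) p = modelD k s f p + modelD k s g p := by
  simp [modelD, fderiv_fun_add hf hg]

theorem modelD_snd (k : ℕ) (s : ℝ) (p : Plane) :
    modelD k s (fun p => p.2) p = -(s * k * p.1 ^ (k - 1)) := by
  simp [modelD, fderiv_snd, modelV]

theorem modelD_comp_modelH {k : ℕ} {s : ℝ} {c : ℝ → ℝ} {p : Plane}
    (hc : DifferentiableAt ℝ c (modelH k s p)) :
    modelD k s (fun p => c (modelH k s p)) p = 0 := by
  have h := (hc.hasFDerivAt.comp p (hasFDerivAt_modelH k s p).differentiableAt.hasFDerivAt).fderiv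
  simp only [Function.comp_def] at h
  have h2 := modelD_modelH k s p
  unfold modelD at *
  rw [h, ContinuousLinearMap.comp_apply, h2, map_zero]

/-- The coordinates `(x, H)`, a double covering of its image. -/
def foldMap (k : ℕ) (s : ℝ) (p : Plane) : Plane := (p.1, modelH k s p)

theorem foldMap_zero {k : ℕ} (hk : k ≠ 0) (s : ℝ) : foldMap k s 0 = 0 := by
  simp [foldMap, modelH_zero hk]

theorem analyticAt_foldMap (k : ℕ) (s : ℝ) (p : Plane) : AnalyticAt ℝ (foldMap k s) p :=
  analyticAt_fst.prod (analyticAt_modelH k s p)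

theorem tendsto_foldMap {k : ℕ} (hk : k ≠ 0) (s : ℝ) :
    Tendsto (foldMap k s) (𝓝 0) (𝓝 0) := by
  have := (analyticAt_foldMap k s 0).continuousAt.tendsto
  rwa [foldMap_zero hk] at this

theorem tendsto_modelH {k : ℕ} (hk : k ≠ 0) (s : ℝ) :
    Tendsto (modelH k s) (𝓝 0) (𝓝 0) := by
  have := (analyticAt_modelH k s 0).continuousAt.tendsto
  rwa [modelH_zero hk] at this

theorem AnalyticAt.comp_foldMap {k : ℕ} (hk : k ≠ 0) {s : ℝ} {f : Plane → ℝ}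
    (hf : AnalyticAt ℝ f 0) : AnalyticAt ℝ (fun p => f (foldMap k s p)) 0 :=
  AnalyticAt.fun_comp (by rwa [foldMap_zero hk]) (analyticAt_foldMap k s 0)

theorem AnalyticAt.comp_modelH {k : ℕ} (hk : k ≠ 0) {s : ℝ} {f : ℝ → ℝ}
    (hf : AnalyticAt ℝ f 0) : AnalyticAt ℝ (fun p => f (modelH k s p)) 0 :=
  AnalyticAt.fun_comp (by rwa [modelH_zero hk]) (analyticAt_modelH k s 0)

theorem modelD_comp_foldMap {k : ℕ} {s : ℝ} {G : Plane → ℝ} {p : Plane}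
    (hG : DifferentiableAt ℝ G (foldMap k s p)) :
    modelD k s (fun p => G (foldMap k s p)) p = 2 * p.2 * fderiv ℝ G (foldMap k s p) (1, 0) := by
  have h1 : HasFDerivAt (foldMap k s)
      ((ContinuousLinearMap.fst ℝ ℝ ℝ).prod (fderiv ℝ (modelH k s) p)) p :=
    hasFDerivAt_fst.prodMk (hasFDerivAt_modelH k s p).differentiableAt.hasFDerivAt
  have h := (hG.hasFDerivAt.comp p h1).fderiv
  simp only [Function.comp_def] at h
  have h2 := modelD_modelH k s p
  unfold modelD at *
  rw [h, ContinuousLinearMap.comp_apply, ContinuousLinearMap.prod_apply, h2]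
  have : ((ContinuousLinearMap.fst ℝ ℝ ℝ) (modelV k s p), (0 : ℝ)) = (2 * p.2) • ((1, 0) : Plane) := by
    simp [modelV]
  rw [this, map_smul, smul_eq_mul]

/-- The operator `B ↦ D (ξ B)` in the coordinates `(x, h)`. -/
noncomputable def foldD (k : ℕ) (s : ℝ) (B : Plane → ℝ) (q : Plane) : ℝ :=
  2 * (q.2 - s * q.1 ^ k) * fderiv ℝ B q (1, 0) - s * k * q.1 ^ (k - 1) * B q

/-- In the coordinates `(x, h)` the field acts as `2ξ ∂_x`, while `D ξ = -s k x^(k-1)` and `ξ² = h -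
s x^k`. Hence `D` maps the even part `G` to an odd function and the odd part `ξ B` to an even one,
and the two equations decouple. -/
theorem modelD_fold {k : ℕ} {s : ℝ} {G B : Plane → ℝ} {p : Plane}
    (hG : DifferentiableAt ℝ G (foldMap k s p)) (hB : DifferentiableAt ℝ B (foldMap k s p)) :
    modelD k s (fun p => G (foldMap k s p) + p.2 * B (foldMap k s p)) p =
      foldD k s B (foldMap k s p) + p.2 * (2 * fderiv ℝ G (foldMap k s p) (1, 0)) := by
  have h1 : DifferentiableAt ℝ (foldMap k s) p := (analyticAt_foldMap k s p).differentiableAt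
  have h2 : DifferentiableAt ℝ (fun p => B (foldMap k s p)) p := hB.comp p h1
  have h3 : DifferentiableAt ℝ (fun p => G (foldMap k s p)) p := hG.comp p h1
  have h4 : DifferentiableAt ℝ (fun p => p.2 * B (foldMap k s p)) p := differentiableAt_snd.mul h2
  rw [modelD_add h3 h4, modelD_mul differentiableAt_snd h2,
    modelD_snd, modelD_comp_foldMap hG, modelD_comp_foldMap hB, foldD]
  simp only [foldMap, modelH]
  ring

/-! ### Even and odd parts in `ξ` -/

theorem AnalyticAt.exists_even_odd {f : Plane → ℝ} (hf : AnalyticAt ℝ f 0) :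
    ∃ F B : Plane → ℝ, AnalyticAt ℝ F 0 ∧ AnalyticAt ℝ B 0 ∧
      ∀ᶠ p in 𝓝 (0 : Plane), f p = F (p.1, p.2 ^ 2) + p.2 * B (p.1, p.2 ^ 2) := by
  obtain ⟨a, ⟨C, R, hC, hR, h⟩, h'⟩ := hf.exists_hasCoeffs
  have hb (e : ℕ) : GeomBounded fun i j => a i (2 * j + e) := by
    refine ⟨C * R ^ e, R ^ 2, by positivity, one_le_pow₀ hR, fun i j => (h _ _).trans ?_⟩
    rw [mul_assoc, ← pow_mul, ← pow_add]
    exact mul_le_mul_of_nonneg_left (pow_le_pow_right₀ hR (by omega)) hC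
  have hE := (hb 0).hasCoeffs_tsum
  have hO := (hb 1).hasCoeffs_tsum
  refine ⟨_, _, hE.analyticAt, hO.analyticAt, ?_⟩
  have ht : Tendsto (fun p : Plane => ((p.1, p.2 ^ 2) : Plane)) (𝓝 0) (𝓝 0) :=
    (by fun_prop : Continuous fun p : Plane => ((p.1, p.2 ^ 2) : Plane)).tendsto' _ _ (by simp)
  filter_upwards [h', ht.eventually hE.2, ht.eventually hO.2] with p h1 h2 h3
  generalize (∑' q : ℕ × ℕ, _ : ℝ) = u at h2 ⊢
  generalize (∑' q : ℕ × ℕ, _ : ℝ) = v at h3 ⊢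
  have h3 := h3.mul_left p.2
  let e (n : ℕ) : ℕ × ℕ → ℕ × ℕ := fun q => (q.1, 2 * q.2 + n)
  have he (n : ℕ) : Function.Injective (e n) := by
    rintro ⟨i, j⟩ ⟨i', j'⟩ hq
    simpa [e] using hq
  let g (n : ℕ) : ℕ × ℕ → ℝ :=
    fun q => if q.2 % 2 = n then a q.1 q.2 * (p.1 ^ q.1 * p.2 ^ q.2) else 0
  have hrange (n : ℕ) (hn : n < 2) : ∀ q ∉ Set.range (e n), g n q = 0 := by
    rintro ⟨i, j⟩ hq
    refine if_neg fun hj => hq ⟨(i, j / 2), ?_⟩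
    simp only [e, Prod.mk.injEq, true_and]
    omega
  have h4 : HasSum (g 0) u := by
    rw [← (he 0).hasSum_iff (hrange 0 (by omega))]
    convert! h2 using 2 with q
    simp [g, e, ← pow_mul]
  have h5 : HasSum (g 1) (p.2 * v) := by
    rw [← (he 1).hasSum_iff (hrange 1 (by omega))]
    convert! h3 using 2 with q
    simp [g, e, pow_succ, Nat.add_mod]
    ring
  refine h1.unique ?_
  convert! h4.add h5 using 2 with q
  rcases Nat.mod_two_eq_zero_or_one q.2 with h | h <;> simp [g, h]

/-- The parity splitting in `ξ`, followed by the substitution `ξ² = h - s x^k`. -/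
theorem AnalyticAt.exists_fold {k : ℕ} (hk : k ≠ 0) (s : ℝ) {f : Plane → ℝ}
    (hf : AnalyticAt ℝ f 0) :
    ∃ F B : Plane → ℝ, AnalyticAt ℝ F 0 ∧ AnalyticAt ℝ B 0 ∧
      ∀ᶠ p in 𝓝 (0 : Plane), f p = F (foldMap k s p) + p.2 * B (foldMap k s p) := by
  obtain ⟨F, B, hF, hB, h⟩ := hf.exists_even_odd
  have hm : AnalyticAt ℝ (fun q : Plane => ((q.1, q.2 - s * q.1 ^ k) : Plane)) 0 := by fun_prop
  have h0 : ((0 : Plane).1, (0 : Plane).2 - s * (0 : Plane).1 ^ k) = (0 : Plane) := by simp [hk]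
  refine ⟨fun q => F (q.1, q.2 - s * q.1 ^ k), fun q => B (q.1, q.2 - s * q.1 ^ k),
    AnalyticAt.fun_comp (by rwa [h0]) hm, AnalyticAt.fun_comp (by rwa [h0]) hm, ?_⟩
  filter_upwards [h] with p hp
  simpa [foldMap, modelH] using hp

/-- The image of `foldMap` is only the region `h ≥ s x^k`, not a neighbourhood of the origin. So `A`
is first shown to vanish near an interior point `(0, r²)` of that region, and the identity theorem
on a ball does the rest. -/
theorem eventually_eq_zero_of_fold {k : ℕ} (hk : k ≠ 0) {s : ℝ} {A : Plane → ℝ}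
    (hA : AnalyticAt ℝ A 0) (h : ∀ᶠ p in 𝓝 (0 : Plane), p.2 * A (foldMap k s p) = 0) :
    ∀ᶠ q in 𝓝 (0 : Plane), A q = 0 := by
  obtain ⟨δ, hδ, hball⟩ := Metric.eventually_nhds_iff_ball.1 hA.eventually_analyticAt
  obtain ⟨ε, hε, hball'⟩ := Metric.eventually_nhds_iff_ball.1 h
  -- `r < ε` keeps `(0, r)` where the hypothesis holds; `r < δ` and `r ≤ 1` keep `(0, r²)` where `A`
  -- is analytic.
  set r := min (min (δ / 2) (ε / 2)) 1 with hr
  have hr0 : 0 < r := by positivity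
  have hrδ : r < δ := by
    have : r ≤ δ / 2 := (min_le_left _ _).trans (min_le_left _ _)
    linarith
  have hrε : r < ε := by
    have : r ≤ ε / 2 := (min_le_left _ _).trans (min_le_right _ _)
    linarith
  have hr1 : r ≤ 1 := min_le_right _ _
  have hmem : ((0, r ^ 2) : Plane) ∈ Metric.ball (0 : Plane) δ := by
    rw [mem_ball_zero_iff, Prod.norm_def]
    simp only [norm_zero, norm_pow, Real.norm_eq_abs, abs_of_pos hr0]
    rw [max_lt_iff]
    exact ⟨hδ, by nlinarith⟩
  have hlift : ContinuousAt (fun q : Plane => ((q.1, √(q.2 - s * q.1 ^ k)) : Plane)) (0, r ^ 2) := by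
    fun_prop
  have hval : ((0 : ℝ), √(r ^ 2 - s * (0 : ℝ) ^ k)) = ((0, r) : Plane) := by
    simp [hk, Real.sqrt_sq hr0.le]
  have hnhds : Metric.ball (0 : Plane) ε ∩ {p | 0 < p.2} ∈ 𝓝 ((0, r) : Plane) := by
    refine IsOpen.mem_nhds (Metric.isOpen_ball.inter (isOpen_lt continuous_const continuous_snd)) ?_
    refine ⟨?_, hr0⟩
    rw [mem_ball_zero_iff, Prod.norm_def]
    simp [abs_of_pos hr0, hrε, hε]
  have hzero : A =ᶠ[𝓝 ((0, r ^ 2) : Plane)] 0 := by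
    have h1 := hlift.tendsto
    simp only at h1
    rw [hval] at h1
    filter_upwards [h1 hnhds] with q hq
    obtain ⟨hq1, hq2⟩ := hq
    have h2 := hball' _ hq1
    have h3 : 0 < q.2 - s * q.1 ^ k := Real.sqrt_pos.1 hq2
    simp only [foldMap, modelH, Real.sq_sqrt h3.le, sub_add_cancel] at h2
    exact (mul_eq_zero.1 h2).resolve_left (ne_of_gt hq2)
  have := AnalyticOnNhd.eqOn_zero_of_preconnected_of_eventuallyEq_zero (fun q hq => hball q hq)
    (convex_ball (0 : Plane) δ).isPreconnected hmem hzero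
  exact Filter.eventually_of_mem (Metric.ball_mem_nhds _ hδ) this

/-- The reflection `ξ ↦ -ξ` leaves `foldMap` unchanged, so the sum and the difference of the two
relations isolate `F` and `ξ B`. -/
theorem fold_unique {k : ℕ} (hk : k ≠ 0) {s : ℝ} {F B : Plane → ℝ}
    (hF : AnalyticAt ℝ F 0) (hB : AnalyticAt ℝ B 0)
    (h : ∀ᶠ p in 𝓝 (0 : Plane), F (foldMap k s p) + p.2 * B (foldMap k s p) = 0) :
    (∀ᶠ q in 𝓝 (0 : Plane), F q = 0) ∧ ∀ᶠ q in 𝓝 (0 : Plane), B q = 0 := by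
  have ht : Tendsto (fun p : Plane => ((p.1, -p.2) : Plane)) (𝓝 0) (𝓝 0) :=
    (by fun_prop : Continuous fun p : Plane => ((p.1, -p.2) : Plane)).tendsto' _ _ (by simp)
  have h' := ht.eventually h
  have hfold (p : Plane) : foldMap k s (p.1, -p.2) = foldMap k s p := by simp [foldMap, modelH]
  constructor
  · refine eventually_eq_zero_of_fold hk (s := s) hF ?_
    filter_upwards [h, h'] with p h1 h2
    rw [hfold] at h2
    have : F (foldMap k s p) = 0 := by linarith
    rw [this, mul_zero]
  · refine eventually_eq_zero_of_fold hk (s := s) hB ?_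
    filter_upwards [h, h'] with p h1 h2
    rw [hfold] at h2
    linarith

/-! ### Decomposition modulo derivatives along the field -/

/-- Coefficients (second index first) of the power series solution `B` of
`F = ∑_{i ≤ k - 2} x ^ i c_i(h) + foldD B`. -/
noncomputable def foldSolution (k : ℕ) (s : ℝ) (a : ℕ → ℕ → ℝ) : ℕ → ℕ → ℝ
  -- The coefficient of `x^(m+k-1) h^j` in the equation reads `a (m+k-1) j = 2(m+k) b (m+k) (j-1) -
  -- s(2m+k) b m j`, the first term being absent for `j = 0`. As `s² = 1`, this determines `b m j`
  -- from the previous `j`.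
  | 0, m => -s * a (m + k - 1) 0 / (2 * m + k)
  | j + 1, m => (-s * a (m + k - 1) (j + 1) +
      2 * s * (m + k) * foldSolution k s a j (m + k)) / (2 * m + k)

/-- Each step in `j` shifts `m` by `k`, which costs `R^k`, and the multiplier `2(m+k)/(2m+k)` is at
most `2`. So the solution grows at rate `R` in `m` and at most `M = R(1 + 2R^k)` in `j`. -/
theorem geomBounded_foldSolution {k : ℕ} (hk : k ≠ 0) {s : ℝ} (hs : |s| = 1) {a : ℕ → ℕ → ℝ}
    (ha : GeomBounded a) : GeomBounded fun i j => foldSolution k s a j i := by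
  obtain ⟨C, R, hC, hR, h⟩ := ha
  have hk1 : (1 : ℝ) ≤ k := by exact_mod_cast Nat.one_le_iff_ne_zero.2 hk
  have hR0 : 0 < R := by linarith
  set M := R * (1 + 2 * R ^ k) with hM
  have hRM : R ≤ M := le_mul_of_one_le_right hR0.le (by nlinarith [pow_pos hR0 k])
  have key : ∀ j m, |foldSolution k s a j m| ≤ C * R ^ k * (R ^ m * M ^ j) := by
    intro j
    induction j with
    | zero =>
      intro m
      have hd : (1 : ℝ) ≤ 2 * m + k := by linarith [(Nat.cast_nonneg m : (0 : ℝ) ≤ m)]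
      rw [foldSolution, abs_div, abs_mul, abs_neg, hs, one_mul,
        abs_of_pos (by linarith : (0 : ℝ) < 2 * m + k)]
      calc _ ≤ |a (m + k - 1) 0| := div_le_self (abs_nonneg _) hd
        _ ≤ C * R ^ (m + k - 1 + 0) := h _ _
        _ ≤ C * R ^ (k + m) := mul_le_mul_of_nonneg_left (pow_le_pow_right₀ hR (by omega)) hC
        _ = _ := by rw [pow_zero, pow_add]; ring
    | succ j ih =>
      intro m
      have hm : (0 : ℝ) ≤ m := Nat.cast_nonneg m
      have hd : (1 : ℝ) ≤ 2 * m + k := by linarith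
      rw [foldSolution, abs_div, abs_of_pos (by linarith : (0 : ℝ) < 2 * m + k),
        div_le_iff₀ (by linarith)]
      have h1 : |a (m + k - 1) (j + 1)| ≤ C * R ^ k * (R ^ m * M ^ j) := by
        calc _ ≤ C * R ^ (m + k - 1 + (j + 1)) := h _ _
          _ = C * R ^ k * (R ^ m * R ^ j) := by
            rw [show m + k - 1 + (j + 1) = k + m + j by omega, pow_add, pow_add]; ring
          _ ≤ _ := by gcongr
      have h2 := ih (m + k)
      calc _ ≤ |a (m + k - 1) (j + 1)| + 2 * (m + k) * |foldSolution k s a j (m + k)| := by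
            refine (abs_add_le _ _).trans (le_of_eq ?_)
            rw [abs_mul, abs_neg, hs, abs_mul, abs_mul, abs_mul, hs,
              abs_of_pos (by linarith : (0 : ℝ) < m + k)]
            simp
        _ ≤ C * R ^ k * (R ^ m * M ^ j) + 2 * (m + k) * (C * R ^ k * (R ^ (m + k) * M ^ j)) := by
            gcongr
        _ ≤ C * R ^ k * (R ^ m * M ^ j) * (2 * m + k) +
            2 * (2 * m + k) * (C * R ^ k * (R ^ (m + k) * M ^ j)) := by
            refine add_le_add (le_mul_of_one_le_right (by positivity) hd) ?_
            gcongr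
            linarith
        _ = C * R ^ k * (R ^ m * (M ^ j * (1 + 2 * R ^ k))) * (2 * m + k) := by
            rw [pow_add]; ring
        _ ≤ C * R ^ k * (R ^ m * M ^ (j + 1)) * (2 * m + k) := by
            rw [pow_succ]
            gcongr
            exact le_mul_of_one_le_left (by positivity) hR
  refine ⟨C * R ^ k, M, by positivity, hR.trans hRM, fun i j => (key j i).trans ?_⟩
  rw [pow_add]
  gcongr

theorem HasCoeffs.foldD {k : ℕ} {s : ℝ} {B : Plane → ℝ} {b : ℕ → ℕ → ℝ}
    (hB : HasCoeffs B b) : ∃ d : ℕ → ℕ → ℝ, HasCoeffs (foldD k s B) d ∧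
      (k ≠ 0 → ∀ m, d (m + k - 1) 0 = -(s * (2 * m + k) * b m 0)) ∧
      (k ≠ 0 → ∀ m j, d (m + k - 1) (j + 1) =
        2 * (m + k) * b (m + k) j - s * (2 * m + k) * b m (j + 1)) := by
  have h1 := ((hB.fderiv_fst.shift 0 1).const_mul 2).add
    (((hB.fderiv_fst.shift k 0).const_mul (-2 * s)).add
      ((hB.shift (k - 1) 0).const_mul (-(s * k))))
  refine ⟨_, h1.congr (Filter.Eventually.of_forall fun p => ?_), fun hk m => ?_, fun hk m j => ?_⟩
  · simp only [_root_.foldD]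
    ring
  · rcases m with _ | m
    · have h2 : ¬ k ≤ k - 1 := by omega
      simp [h2]
    · have h2 : k - 1 ≤ m + 1 + k - 1 := by omega
      have h3 : m + 1 + k - 1 - (k - 1) = m + 1 := by omega
      have h4 : m + 1 + k - 1 - k = m := by omega
      have h5 : k ≤ m + 1 + k - 1 := by omega
      have h8 : ¬ 1 ≤ 0 := by omega
      simp only [h2, h3, h4, h5, h8, Nat.zero_le, and_self, and_false, if_true, if_false,
        Nat.sub_zero]
      push_cast
      ring
  · have h6 : m + k - 1 + 1 = m + k := by omega
    have h7 : ((m + k - 1 : ℕ) : ℝ) + 1 = m + k := by exact_mod_cast h6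
    rcases m with _ | m
    · have h2 : ¬ k ≤ k - 1 := by omega
      simp at h6 h7
      simp [h2, h6, h7]
      ring
    · have h2 : k - 1 ≤ m + 1 + k - 1 := by omega
      have h3 : m + 1 + k - 1 - (k - 1) = m + 1 := by omega
      have h4 : m + 1 + k - 1 - k = m := by omega
      have h5 : k ≤ m + 1 + k - 1 := by omega
      have h8 : 1 ≤ j + 1 := by omega
      simp only [h2, h3, h4, h5, h6, h7, h8, Nat.zero_le, and_self, if_true, Nat.sub_zero,
        Nat.add_sub_cancel]
      push_cast
      ring

/-- By the choice of `B`, all rows of `F - foldD B` of index at least `k - 1` vanish; what is left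
is a polynomial in `x` of degree at most `k - 2` with coefficients analytic in `h`. -/
theorem exists_foldD_eq {k : ℕ} (hk : k ≠ 0) {s : ℝ} (hs : s = 1 ∨ s = -1) {F : Plane → ℝ}
    (hF : AnalyticAt ℝ F 0) :
    ∃ (c : ℕ → ℝ → ℝ) (B : Plane → ℝ), (∀ i, AnalyticAt ℝ (c i) 0) ∧ AnalyticAt ℝ B 0 ∧
      ∀ᶠ q in 𝓝 (0 : Plane), F q = ∑ i ∈ Finset.range (k - 1), q.1 ^ i * c i q.2 + foldD k s B q := by
  obtain ⟨a, ha⟩ := hF.exists_hasCoeffs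
  have hs1 : |s| = 1 := by rcases hs with rfl | rfl <;> simp
  have hs2 : s * s = 1 := by rcases hs with rfl | rfl <;> norm_num
  have hB := (geomBounded_foldSolution hk hs1 ha.1).hasCoeffs_tsum
  obtain ⟨d, hd, hd0, hd1⟩ := hB.foldD (k := k) (s := s)
  obtain ⟨c, hc, hsum⟩ := (ha.add (hd.const_mul (-1))).exists_eq_sum (N := k - 1) (by
    intro i j hi
    obtain ⟨m, rfl⟩ : ∃ m, i = m + k - 1 := ⟨i - (k - 1), by omega⟩
    have h2 : (0 : ℝ) < 2 * m + k := by
      have : 0 < k := Nat.pos_of_ne_zero hk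
      positivity
    rcases j with _ | j
    · rw [hd0 hk, foldSolution]
      field_simp
      linear_combination (- a (m + k - 1) 0) * hs2
    · rw [hd1 hk, foldSolution.eq_2]
      field_simp
      linear_combination
        (2 * (m + k) * foldSolution k s a j (m + k) - a (m + k - 1) (j + 1)) * hs2)
  refine ⟨c, _, hc, hB.analyticAt, ?_⟩
  filter_upwards [hsum] with q hq
  rw [← hq]
  ring

/-- The rows of index at least `k - 1` involve `B` alone, and the recursion in `j` kills its
coefficients because `2m + k ≠ 0`. With `B = 0` the remaining rows are the coefficients of the `c
i`. -/
theorem eq_zero_of_foldD_eq_zero {k : ℕ} (hk : k ≠ 0) {s : ℝ} (hs : s = 1 ∨ s = -1)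
    {c : ℕ → ℝ → ℝ} {B : Plane → ℝ} (hc : ∀ i < k - 1, AnalyticAt ℝ (c i) 0)
    (hB : AnalyticAt ℝ B 0)
    (h : ∀ᶠ q in 𝓝 (0 : Plane),
      ∑ i ∈ Finset.range (k - 1), q.1 ^ i * c i q.2 + foldD k s B q = 0) :
    (∀ i < k - 1, ∀ᶠ t in 𝓝 0, c i t = 0) ∧ ∀ᶠ q in 𝓝 (0 : Plane), B q = 0 := by
  obtain ⟨b, hb⟩ := hB.exists_hasCoeffs
  have hs0 : s ≠ 0 := by rcases hs with rfl | rfl <;> norm_num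
  choose! e he he0 using fun i (hi : i < k - 1) => hasCoeffs_comp_snd (hc i hi)
  obtain ⟨d, hd, hd0, hd1⟩ := hb.foldD (k := k) (s := s)
  have hsum : HasCoeffs (fun q => ∑ i ∈ Finset.range (k - 1), q.1 ^ i * q.2 ^ 0 * c i q.2) _ :=
    HasCoeffs.sum (Finset.range (k - 1)) fun i hi => (he i (Finset.mem_range.1 hi)).shift i 0
  have hrow (i' j : ℕ) : (∑ i ∈ Finset.range (k - 1),
      if i ≤ i' ∧ 0 ≤ j then e i (i' - i) (j - 0) else 0) = if i' < k - 1 then e i' 0 j else 0 := by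
    have h1 : ∀ i ∈ Finset.range (k - 1), (if i ≤ i' ∧ 0 ≤ j then e i (i' - i) (j - 0) else 0) =
        if i = i' then e i' 0 j else 0 := by
      intro i hi
      rcases lt_trichotomy i i' with h2 | h2 | h2
      · obtain ⟨n, rfl⟩ : ∃ n, i' = i + (n + 1) := ⟨i' - i - 1, by omega⟩
        have h3 := he0 i (Finset.mem_range.1 hi) n j
        simp [h3]
      · subst h2
        simp
      · rw [if_neg (by omega), if_neg (by omega)]
    rw [Finset.sum_congr rfl h1, Finset.sum_ite_eq']
    simp
  have htot := (hsum.add hd).congr (g := fun _ => 0) (by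
    filter_upwards [h] with q hq
    simpa using hq)
  have hcoef (i j : ℕ) := htot.eq_zero i j
  simp only [hrow] at hcoef
  have hbz : ∀ j m, b m j = 0 := by
    intro j
    induction j with
    | zero =>
      intro m
      have h1 := hcoef (m + k - 1) 0
      rw [if_neg (by omega), hd0 hk] at h1
      have h2 : (0 : ℝ) < 2 * m + k := by
        have : 0 < k := Nat.pos_of_ne_zero hk
        positivity
      simpa [hs0, h2.ne'] using h1
    | succ j ih =>
      intro m
      have h1 := hcoef (m + k - 1) (j + 1)
      rw [if_neg (by omega), hd1 hk, ih] at h1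
      have h2 : (0 : ℝ) < 2 * m + k := by
        have : 0 < k := Nat.pos_of_ne_zero hk
        positivity
      simpa [hs0, h2.ne'] using h1
  have hBz : ∀ᶠ q in 𝓝 (0 : Plane), B q = 0 := by
    refine hb.eventuallyEq (g := fun _ => 0) ?_
    have : b = fun _ _ => 0 := by ext m j; exact hbz j m
    rw [this]
    exact hasCoeffs_zero
  refine ⟨fun i hi => ?_, hBz⟩
  have hdz : ∀ i j, d i j = 0 := by
    refine (hd.congr (g := fun _ => 0) ?_).eq_zero
    filter_upwards [hBz.eventually_nhds] with q hq
    have h1 : B =ᶠ[𝓝 q] fun _ => 0 := hq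
    simp [_root_.foldD, h1.fderiv_eq, h1.self_of_nhds]
  have hez : e i = fun _ _ => 0 := by
    ext m j
    rcases m with _ | m
    · have h1 := hcoef i j
      rw [if_pos hi, hdz, add_zero] at h1
      exact h1
    · exact he0 i hi m j
  have h1 : (fun p : Plane => c i p.2) =ᶠ[𝓝 0] fun _ => 0 := by
    refine (he i hi).eventuallyEq ?_
    rw [hez]
    exact hasCoeffs_zero
  have ht : Tendsto (fun t : ℝ => ((0, t) : Plane)) (𝓝 0) (𝓝 0) :=
    (by fun_prop : Continuous fun t : ℝ => ((0, t) : Plane)).tendsto' _ _ rfl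
  exact ht.eventually h1

theorem exists_fderiv_fst_eq {B : Plane → ℝ} (hB : AnalyticAt ℝ B 0) :
    ∃ G : Plane → ℝ, AnalyticAt ℝ G 0 ∧ ∀ᶠ q in 𝓝 (0 : Plane), 2 * fderiv ℝ G q (1, 0) = B q := by
  obtain ⟨b, hb⟩ := hB.exists_hasCoeffs
  have hg : GeomBounded fun i j => if 1 ≤ i ∧ 0 ≤ j then b (i - 1) (j - 0) / (2 * i) else 0 := by
    refine (hb.shift 1 0).1.of_le fun i j => ?_
    split_ifs with hi
    · rw [abs_div]
      have : (1 : ℝ) ≤ i := by exact_mod_cast hi.1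
      refine div_le_self (abs_nonneg _) ?_
      rw [abs_of_pos (by positivity)]
      linarith
    · simp
  have hG := hg.hasCoeffs_tsum
  refine ⟨_, hG.analyticAt, ?_⟩
  refine HasCoeffs.eventuallyEq (a := b) ?_ hb
  convert! hG.fderiv_fst.const_mul 2 using 3 with i j
  have : (i : ℝ) + 1 ≠ 0 := by positivity
  simp
  field_simp

/-- Every analytic function is a combination of `1, x, …, x ^ (k - 2)` with coefficients that are
functions of `H`, up to a derivative along the Hamiltonian vector field. -/
theorem exists_decomposition {k : ℕ} (hk : k ≠ 0) {s : ℝ} (hs : s = 1 ∨ s = -1) {f : Plane → ℝ}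
    (hf : AnalyticAt ℝ f 0) :
    ∃ (c : ℕ → ℝ → ℝ) (η : Plane → ℝ), (∀ i, AnalyticAt ℝ (c i) 0) ∧ AnalyticAt ℝ η 0 ∧
      ∀ᶠ p in 𝓝 (0 : Plane), f p =
        ∑ i ∈ Finset.range (k - 1), p.1 ^ i * c i (modelH k s p) + modelD k s η p := by
  obtain ⟨F, B, hF, hB, hfold⟩ := hf.exists_fold hk s
  obtain ⟨c, A, hc, hA, hFA⟩ := exists_foldD_eq hk hs hF
  obtain ⟨G, hG, hGB⟩ := exists_fderiv_fst_eq hB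
  refine ⟨c, fun p => G (foldMap k s p) + p.2 * A (foldMap k s p), hc,
    (hG.comp_foldMap hk).add (analyticAt_snd.mul (hA.comp_foldMap hk)), ?_⟩
  have ht := tendsto_foldMap hk s
  filter_upwards [hfold, ht.eventually hFA, ht.eventually hGB,
    ht.eventually hG.eventually_differentiableAt, ht.eventually hA.eventually_differentiableAt]
    with p h1 h2 h3 h4 h5
  rw [modelD_fold h4 h5, h3, h1, h2]
  simp only [foldMap]
  ring

theorem AnalyticAt.fderiv_apply {f : Plane → ℝ} {p : Plane} (hf : AnalyticAt ℝ f p) (v : Plane) :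
    AnalyticAt ℝ (fun q => fderiv ℝ f q v) p :=
  ((ContinuousLinearMap.apply ℝ ℝ v).analyticAt _).fun_comp hf.fderiv

theorem analyticAt_foldD {k : ℕ} {s : ℝ} {B : Plane → ℝ} (hB : AnalyticAt ℝ B 0) :
    AnalyticAt ℝ (foldD k s B) 0 := by
  have := hB.fderiv_apply (1, 0)
  unfold foldD
  fun_prop

/-- The polynomial part is even in `ξ`, so it meets only `foldD B`; the odd part of the relation is
`2ξ ∂_x G = 0`. -/
theorem fold_of_decomposition_eq_zero {k : ℕ} (hk : k ≠ 0) {s : ℝ} (hs : s = 1 ∨ s = -1)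
    {c : ℕ → ℝ → ℝ} {G B : Plane → ℝ} (hc : ∀ i < k - 1, AnalyticAt ℝ (c i) 0)
    (hG : AnalyticAt ℝ G 0) (hB : AnalyticAt ℝ B 0)
    (h : ∀ᶠ p in 𝓝 (0 : Plane), ∑ i ∈ Finset.range (k - 1), p.1 ^ i * c i (modelH k s p) +
      modelD k s (fun p => G (foldMap k s p) + p.2 * B (foldMap k s p)) p = 0) :
    (∀ i < k - 1, ∀ᶠ t in 𝓝 0, c i t = 0) ∧ (∀ᶠ q in 𝓝 (0 : Plane), B q = 0) ∧
      ∀ᶠ q in 𝓝 (0 : Plane), fderiv ℝ G q (1, 0) = 0 := by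
  have ht := tendsto_foldMap hk s
  have hsum : AnalyticAt ℝ (fun q : Plane => ∑ i ∈ Finset.range (k - 1), q.1 ^ i * c i q.2) 0 := by
    refine Finset.analyticAt_fun_sum _ fun i hi => ?_
    exact (analyticAt_fst.pow i).mul (analyticAt_comp_snd (hc i (Finset.mem_range.1 hi)))
  obtain ⟨h1, h2⟩ := fold_unique hk (s := s) (hsum.add (analyticAt_foldD (k := k) (s := s) hB))
    (analyticAt_const.mul (hG.fderiv_apply (1, 0)) : AnalyticAt ℝ (fun q => 2 * fderiv ℝ G q (1, 0)) 0)
    (by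
      filter_upwards [h, ht.eventually hG.eventually_differentiableAt,
        ht.eventually hB.eventually_differentiableAt] with p h1 h2 h3
      rw [modelD_fold h2 h3, ← add_assoc] at h1
      exact h1)
  obtain ⟨h3, h4⟩ := eq_zero_of_foldD_eq_zero hk hs hc hB h1
  exact ⟨h3, h4, h2.mono fun q hq => (mul_eq_zero.1 hq).resolve_left two_ne_zero⟩

theorem modelD_congr {k : ℕ} {s : ℝ} {f g : Plane → ℝ} (h : f =ᶠ[𝓝 0] g) :
    modelD k s f =ᶠ[𝓝 0] modelD k s g := by
  filter_upwards [h.eventually_nhds] with p hp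
  rw [modelD, modelD, Filter.EventuallyEq.fderiv_eq hp]

theorem decomposition_unique {k : ℕ} (hk : k ≠ 0) {s : ℝ} (hs : s = 1 ∨ s = -1)
    {c : ℕ → ℝ → ℝ} {η : Plane → ℝ} (hc : ∀ i < k - 1, AnalyticAt ℝ (c i) 0)
    (hη : AnalyticAt ℝ η 0)
    (h : ∀ᶠ p in 𝓝 (0 : Plane), ∑ i ∈ Finset.range (k - 1), p.1 ^ i * c i (modelH k s p) +
      modelD k s η p = 0) {i : ℕ} (hi : i < k - 1) : ∀ᶠ t in 𝓝 0, c i t = 0 := by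
  obtain ⟨G, B, hG, hB, hfold⟩ := hη.exists_fold hk s
  refine (fold_of_decomposition_eq_zero hk hs hc hG hB ?_).1 i hi
  filter_upwards [h, modelD_congr (k := k) (s := s) hfold] with p h1 h2
  rwa [← h2]

/-- Analytic first integrals of the Hamiltonian vector field are functions of `H`. -/
theorem exists_eq_comp_modelH {k : ℕ} (hk : k ≠ 0) {s : ℝ} (hs : s = 1 ∨ s = -1) {K : Plane → ℝ}
    (hK : AnalyticAt ℝ K 0) (h : ∀ᶠ p in 𝓝 (0 : Plane), modelD k s K p = 0) :
    ∃ G : ℝ → ℝ, AnalyticAt ℝ G 0 ∧ ∀ᶠ p in 𝓝 (0 : Plane), K p = G (modelH k s p) := by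
  obtain ⟨G, B, hG, hB, hfold⟩ := hK.exists_fold hk s
  obtain ⟨-, hB0, hG0⟩ := fold_of_decomposition_eq_zero hk hs (c := fun _ _ => 0)
    (fun _ _ => analyticAt_const) hG hB (by
      filter_upwards [h, modelD_congr (k := k) (s := s) hfold] with p h1 h2
      simpa [← h2] using h1)
  obtain ⟨g, hg⟩ := hG.exists_hasCoeffs
  -- `G` does not depend on `x`, so only its row `0` survives.
  obtain ⟨c, hc, hGc⟩ := hg.exists_eq_sum (N := 1) (by
    intro i j hi
    obtain ⟨m, rfl⟩ : ∃ m, i = m + 1 := ⟨i - 1, by omega⟩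
    have h1 := (hg.fderiv_fst.congr hG0).eq_zero m j
    have h3 : (m : ℝ) + 1 ≠ 0 := by positivity
    exact (mul_eq_zero.1 h1).resolve_left h3)
  refine ⟨c 0, hc 0, ?_⟩
  have ht := tendsto_foldMap hk s
  filter_upwards [hfold, ht.eventually hB0, ht.eventually hGc] with p h1 h2 h3
  rw [h1, h2, h3]
  simp [foldMap]

/-! ### The Moser argument by analytic families of paths -/

/-- Analytic solutions of fixed-point equations `e = N (p, e)` with `∂N/∂e = 0` at the origin. -/
theorem exists_analytic_fixedPoint {P E : Type*} [NormedAddCommGroup P] [NormedSpace ℝ P]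
    [CompleteSpace P] [NormedAddCommGroup E] [NormedSpace ℝ E] [CompleteSpace E] {N : P × E → E}
    (hN : AnalyticAt ℝ N 0) (h0 : N 0 = 0) (h' : HasFDerivAt (fun e => N (0, e)) (0 : E →L[ℝ] E) 0) :
    ∃ e : P → E, AnalyticAt ℝ e 0 ∧ e 0 = 0 ∧ ∀ᶠ p in 𝓝 0, e p = N (p, e p) := by
  have hf : AnalyticAt ℝ (fun z : P × E => z.2 - N z) 0 := analyticAt_snd.sub hN
  -- The exponent `⊤` is `ω`, i.e. analyticity, so the implicit function obtained below is analytic.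
  -- The partial derivative of `e - N` in `e` is the identity.
  have hcd : ContDiffAt ℝ ⊤ (fun z : P × E => z.2 - N z) 0 := hf.contDiffAt
  have hpartial : fderiv ℝ (fun z : P × E => z.2 - N z) 0 ∘L .inr ℝ P E =
      ContinuousLinearMap.id ℝ E := by
    have h1 : HasFDerivAt (fun e : E => ((0, e) : P × E)) (.inr ℝ P E) 0 :=
      hasFDerivAt_prodMk_right (𝕜 := ℝ) (0 : P) (0 : E)
    have h2 : HasFDerivAt (fun e : E => e - N (0, e))
        (fderiv ℝ (fun z : P × E => z.2 - N z) 0 ∘L .inr ℝ P E) 0 :=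
      (hf.differentiableAt.hasFDerivAt (x := ((0 : P), (0 : E)))).comp (0 : E) h1
    have h3 := (hasFDerivAt_id (𝕜 := ℝ) (0 : E)).sub h'
    rw [sub_zero] at h3
    exact h2.unique h3
  have hinv : (fderiv ℝ (fun z : P × E => z.2 - N z) 0 ∘L .inr ℝ P E).IsInvertible := by
    rw [hpartial]
    exact ⟨ContinuousLinearEquiv.refl ℝ E, rfl⟩
  refine ⟨hcd.implicitFunction (by simp) hinv, ?_, ?_, ?_⟩
  · have := hcd.contDiffAt_implicitFunction (by simp) hinv
    exact this.analyticAt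
  · exact hcd.implicitFunction_apply_self (by simp) hinv
  · have := hcd.eventually_apply_implicitFunction (by simp) hinv
    filter_upwards [this] with p hp
    simpa [h0, sub_eq_zero] using hp

/-- Continuous functions on the unit interval. -/
abbrev PathSpace : Type := C(unitInterval, ℝ)

theorem continuous_primitive_path (y : PathSpace) :
    Continuous fun t : ℝ => ∫ u in (0 : ℝ)..t, Set.IccExtend zero_le_one y u :=
  intervalIntegral.continuous_primitive (fun _ _ => (y.continuous.Icc_extend').intervalIntegrable _ _) 0

/-- The primitive vanishing at `0`. -/
noncomputable def pathPrimitive : PathSpace →L[ℝ] PathSpace :=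
  LinearMap.mkContinuous
    { toFun := fun y => ⟨fun t => ∫ u in (0 : ℝ)..t, Set.IccExtend zero_le_one y u,
        (continuous_primitive_path y).comp continuous_subtype_val⟩
      map_add' := fun y z => by
        ext t
        exact intervalIntegral.integral_add ((y.continuous.Icc_extend').intervalIntegrable _ _)
          ((z.continuous.Icc_extend').intervalIntegrable _ _)
      map_smul' := fun r y => by
        ext t
        exact intervalIntegral.integral_smul r _ } 1 fun y => by
    rw [one_mul]
    refine (ContinuousMap.norm_le _ (norm_nonneg y)).2 fun t => ?_
    refine (intervalIntegral.norm_integral_le_of_norm_le_const (C := ‖y‖) fun u _ =>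
      y.norm_coe_le_norm _).trans ?_
    rw [sub_zero, abs_of_nonneg t.2.1]
    exact mul_le_of_le_one_right (norm_nonneg y) t.2.2

theorem pathPrimitive_apply (y : PathSpace) (t : unitInterval) :
    pathPrimitive y t = ∫ u in (0 : ℝ)..t, Set.IccExtend zero_le_one y u := rfl

theorem norm_pathPrimitive_le (y : PathSpace) : ‖pathPrimitive y‖ ≤ ‖y‖ := by
  have h := LinearMap.mkContinuous_norm_le (𝕜 := ℝ) _ zero_le_one _ |> fun h =>
    (pathPrimitive.le_of_opNorm_le h y)
  simpa using h

/-- Integration by parts. It is the product rule for paths that are given as primitives, and so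
replaces differentiability in the calculus of `HasPathDeriv`. -/
theorem pathPrimitive_mul (a b : PathSpace) :
    pathPrimitive a * pathPrimitive b = pathPrimitive (a * pathPrimitive b + pathPrimitive a * b) := by
  ext t
  let A := Set.IccExtend zero_le_one (a : unitInterval → ℝ)
  let B := Set.IccExtend zero_le_one (b : unitInterval → ℝ)
  have hA : Continuous A := a.continuous.Icc_extend'
  have hB : Continuous B := b.continuous.Icc_extend'
  have hAd (u : ℝ) : HasDerivAt (fun t => ∫ u in (0 : ℝ)..t, A u) (A u) u :=
    hA.integral_hasStrictDerivAt 0 u |>.hasDerivAt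
  have hBd (u : ℝ) : HasDerivAt (fun t => ∫ u in (0 : ℝ)..t, B u) (B u) u :=
    hB.integral_hasStrictDerivAt 0 u |>.hasDerivAt
  have h := intervalIntegral.integral_eq_sub_of_hasDerivAt (a := 0) (b := (t : ℝ))
    (fun u _ => (hAd u).mul (hBd u)) (Continuous.intervalIntegrable (by
      have := continuous_primitive_path a
      have := continuous_primitive_path b
      fun_prop) _ _)
  simp only [Pi.mul_apply, intervalIntegral.integral_same, mul_zero, sub_zero] at h
  rw [ContinuousMap.mul_apply, pathPrimitive_apply, pathPrimitive_apply, ← h, pathPrimitive_apply]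
  refine intervalIntegral.integral_congr fun u hu => ?_
  rw [Set.uIcc_of_le t.2.1] at hu
  have hu' : u ∈ Set.Icc (0 : ℝ) 1 := ⟨hu.1, hu.2.trans t.2.2⟩
  simp only [A, B, Set.IccExtend_of_mem zero_le_one _ hu', ContinuousMap.add_apply,
    ContinuousMap.mul_apply, pathPrimitive_apply]

theorem pathPrimitive_one_one : pathPrimitive 1 1 = 1 := by
  rw [pathPrimitive_apply]
  simp [Set.IccExtend]

theorem pathPrimitive_algebraMap_mul (r : ℝ) (y : PathSpace) :
    pathPrimitive (algebraMap ℝ PathSpace r * y) = algebraMap ℝ PathSpace r * pathPrimitive y := by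
  rw [← Algebra.smul_def, ← Algebra.smul_def, map_smul]

/-- `y` has initial value `c` and derivative `w`. -/
def HasPathDeriv (y : PathSpace) (c : ℝ) (w : PathSpace) : Prop :=
  y = algebraMap ℝ PathSpace c + pathPrimitive w

theorem HasPathDeriv.mul {y z w v : PathSpace} {c d : ℝ} (hy : HasPathDeriv y c w)
    (hz : HasPathDeriv z d v) : HasPathDeriv (y * z) (c * d) (w * z + y * v) := by
  unfold HasPathDeriv at *
  have h1 : w * z + y * v = algebraMap ℝ PathSpace d * w + algebraMap ℝ PathSpace c * v +
      (w * pathPrimitive v + pathPrimitive w * v) := by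
    rw [hy, hz]; ring
  rw [h1, map_add, ← pathPrimitive_mul, map_add, pathPrimitive_algebraMap_mul,
    pathPrimitive_algebraMap_mul, hy, hz, map_mul]
  ring

theorem HasPathDeriv.add {y z w v : PathSpace} {c d : ℝ} (hy : HasPathDeriv y c w)
    (hz : HasPathDeriv z d v) : HasPathDeriv (y + z) (c + d) (w + v) := by
  unfold HasPathDeriv at *
  rw [hy, hz, map_add, map_add]
  ring

theorem HasPathDeriv.const_mul {y w : PathSpace} {c : ℝ} (r : ℝ) (hy : HasPathDeriv y c w) :
    HasPathDeriv (algebraMap ℝ PathSpace r * y) (r * c) (algebraMap ℝ PathSpace r * w) := by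
  unfold HasPathDeriv at *
  rw [hy, pathPrimitive_algebraMap_mul, map_mul]
  ring

theorem hasPathDeriv_const (c : ℝ) : HasPathDeriv (algebraMap ℝ PathSpace c) c 0 := by
  simp [HasPathDeriv]

theorem HasPathDeriv.pow {y w : PathSpace} {c : ℝ} (hy : HasPathDeriv y c w) (n : ℕ) :
    HasPathDeriv (y ^ n) (c ^ n) (n * y ^ (n - 1) * w) := by
  induction n with
  | zero => simpa using hasPathDeriv_const 1
  | succ n ih =>
    rw [pow_succ, pow_succ]
    convert ih.mul hy using 1
    rcases n with _ | n
    · simp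
    · simp only [Nat.add_sub_cancel]
      push_cast
      ring

theorem HasPathDeriv.sum {ι : Type*} (s : Finset ι) {y w : ι → PathSpace} {c : ι → ℝ}
    (hy : ∀ i ∈ s, HasPathDeriv (y i) (c i) (w i)) :
    HasPathDeriv (∑ i ∈ s, y i) (∑ i ∈ s, c i) (∑ i ∈ s, w i) := by
  unfold HasPathDeriv at *
  rw [map_sum, map_sum, ← Finset.sum_add_distrib]
  exact Finset.sum_congr rfl hy

theorem HasPathDeriv.apply_one {y w : PathSpace} {c : ℝ} (hy : HasPathDeriv y c w) :
    y 1 = c + pathPrimitive w 1 := by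
  have := congrArg (fun z : PathSpace => z 1) hy
  simpa using this

/-- Uniqueness for the linearised flow by contraction: substituting one estimate in the other gives
`‖u‖ ≤ 2 (|τ| k)² ‖u‖ ≤ ‖u‖ / 2`. -/
theorem eq_zero_of_linear_system {k : ℕ} {s τ : ℝ} (hs : |s| = 1) {x u v : PathSpace}
    (hx : ‖x‖ ≤ 1) (hτ : |τ| * (2 * k) ≤ 1)
    (hu : u = algebraMap ℝ PathSpace (2 * τ) * pathPrimitive v)
    (hv : v = algebraMap ℝ PathSpace (-(s * k * τ)) *
      pathPrimitive ((k - 1 : ℕ) * x ^ (k - 2) * u)) : u = 0 ∧ v = 0 := by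
  have hu' : ‖u‖ ≤ 2 * |τ| * ‖v‖ := by
    rw [hu, ← Algebra.smul_def, norm_smul, Real.norm_eq_abs, abs_mul, abs_two]
    gcongr
    exact norm_pathPrimitive_le v
  have hv' : ‖v‖ ≤ k * |τ| * (k * ‖u‖) := by
    rw [hv, ← Algebra.smul_def, norm_smul, Real.norm_eq_abs, abs_neg, abs_mul, abs_mul, hs, one_mul,
      Nat.abs_cast]
    gcongr
    refine (norm_pathPrimitive_le _).trans ?_
    rw [mul_assoc, ← nsmul_eq_mul]
    refine (norm_nsmul_le).trans ?_
    have h1 : ‖x ^ (k - 2) * u‖ ≤ ‖u‖ := by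
      refine (norm_mul_le _ _).trans (mul_le_of_le_one_left (norm_nonneg u) ?_)
      exact (norm_pow_le x _).trans (pow_le_one₀ (norm_nonneg x) hx)
    gcongr
    omega
  have h1 : ‖u‖ ≤ 2 * (|τ| * k) ^ 2 * ‖u‖ := by
    calc ‖u‖ ≤ 2 * |τ| * (k * |τ| * (k * ‖u‖)) := hu'.trans (by gcongr)
      _ = _ := by ring
  have h2 : (|τ| * k) ^ 2 ≤ (1 / 2) ^ 2 := by
    gcongr
    linarith
  have h3 : ‖u‖ = 0 := by nlinarith [norm_nonneg u]
  have hu0 : u = 0 := norm_eq_zero.1 h3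
  refine ⟨hu0, ?_⟩
  rw [hv, hu0]
  simp

/-- At parameter `t` the path has flowed for the time `tτ`. A Hamiltonian field is invariant under
its own flow, so moving the initial point along the field, with `τ` changing at rate `τ'`, moves the
path by `(1 + tτ')` times the field. The proof checks that this candidate satisfies the linearised
integral equations and invokes their uniqueness. -/
theorem variation_eq {k : ℕ} {s τ τ' a b : ℝ} (hs : |s| = 1) {x ξ x' ξ' : PathSpace}
    (hxn : ‖x‖ ≤ 1) (hτ : |τ| * (2 * k) ≤ 1)
    (hx : HasPathDeriv x a (algebraMap ℝ PathSpace (2 * τ) * ξ))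
    (hξ : HasPathDeriv ξ b (algebraMap ℝ PathSpace (-(s * k * τ)) * x ^ (k - 1)))
    (hx' : x' = algebraMap ℝ PathSpace (2 * b) + (algebraMap ℝ PathSpace (2 * τ') * pathPrimitive ξ +
      algebraMap ℝ PathSpace (2 * τ) * pathPrimitive ξ'))
    (hξ' : ξ' = algebraMap ℝ PathSpace (-(s * k * a ^ (k - 1))) +
      (algebraMap ℝ PathSpace (-(s * k * τ')) * pathPrimitive (x ^ (k - 1)) +
      algebraMap ℝ PathSpace (-(s * k * τ)) *
        pathPrimitive ((k - 1 : ℕ) * x ^ (k - 2) * x'))) :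
    x' = (1 + algebraMap ℝ PathSpace τ' * pathPrimitive 1) * (algebraMap ℝ PathSpace 2 * ξ) ∧
      ξ' = (1 + algebraMap ℝ PathSpace τ' * pathPrimitive 1) *
        (algebraMap ℝ PathSpace (-(s * k)) * x ^ (k - 1)) := by
  set L := 1 + algebraMap ℝ PathSpace τ' * pathPrimitive 1 with hL
  have hLd : HasPathDeriv L 1 (algebraMap ℝ PathSpace τ') := by
    rw [HasPathDeriv, hL, ← pathPrimitive_algebraMap_mul, mul_one, map_one]
  have h1 := (hLd.mul hξ).const_mul 2
  have h2 := (hLd.mul (hx.pow (k - 1))).const_mul (-(s * k))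
  have e1 : L * (algebraMap ℝ PathSpace 2 * ξ) = algebraMap ℝ PathSpace (2 * b) +
      (algebraMap ℝ PathSpace (2 * τ') * pathPrimitive ξ + algebraMap ℝ PathSpace (2 * τ) *
        pathPrimitive (L * (algebraMap ℝ PathSpace (-(s * k)) * x ^ (k - 1)))) := by
    unfold HasPathDeriv at h1
    rw [← pathPrimitive_algebraMap_mul, ← pathPrimitive_algebraMap_mul, ← map_add]
    refine (by ring : _ = algebraMap ℝ PathSpace 2 * (L * ξ)).trans (h1.trans ?_)
    congr 1
    · rw [one_mul]
    · congr 1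
      simp only [map_mul, map_neg]
      ring
  have e2 : L * (algebraMap ℝ PathSpace (-(s * k)) * x ^ (k - 1)) =
      algebraMap ℝ PathSpace (-(s * k * a ^ (k - 1))) +
      (algebraMap ℝ PathSpace (-(s * k * τ')) * pathPrimitive (x ^ (k - 1)) +
      algebraMap ℝ PathSpace (-(s * k * τ)) * pathPrimitive ((k - 1 : ℕ) * x ^ (k - 2) *
        (L * (algebraMap ℝ PathSpace 2 * ξ)))) := by
    unfold HasPathDeriv at h2
    rw [← pathPrimitive_algebraMap_mul, ← pathPrimitive_algebraMap_mul, ← map_add]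
    refine (by ring : _ = algebraMap ℝ PathSpace (-(s * k)) * (L * x ^ (k - 1))).trans
      (h2.trans ?_)
    congr 1
    · rw [one_mul, neg_mul]
    · congr 1
      simp only [map_mul, map_neg, Nat.sub_sub]
      ring
  have h3 := eq_zero_of_linear_system hs hxn hτ
    (u := x' - L * (algebraMap ℝ PathSpace 2 * ξ))
    (v := ξ' - L * (algebraMap ℝ PathSpace (-(s * k)) * x ^ (k - 1)))
    (by
      nth_rewrite 1 [hx']
      nth_rewrite 1 [e1]
      rw [map_sub]
      ring)
    (by
      nth_rewrite 1 [hξ']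
      nth_rewrite 1 [e2]
      rw [mul_sub, map_sub]
      ring)
  exact ⟨sub_eq_zero.1 h3.1, sub_eq_zero.1 h3.2⟩

theorem hasFDerivAt_smul_of_eq_zero {E F : Type*} [NormedAddCommGroup E] [NormedSpace ℝ E]
    [NormedAddCommGroup F] [NormedSpace ℝ F] {r : E → ℝ} {g : E → F} {x : E}
    (hr : DifferentiableAt ℝ r x) (hg : DifferentiableAt ℝ g x) (hr0 : r x = 0) (hg0 : g x = 0) :
    HasFDerivAt (fun e => r e • g e) (0 : E →L[ℝ] F) x := by
  refine (hr.hasFDerivAt.smul hg.hasFDerivAt).congr_fderiv ?_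
  rw [hr0, hg0]
  simp

/-- The density `∑_{i ≤ k - 2} x ^ i c_i(H)`. -/
noncomputable def polyDensity (k : ℕ) (s : ℝ) (c : ℕ → ℝ → ℝ) (p : Plane) : ℝ :=
  ∑ i ∈ Finset.range (k - 1), p.1 ^ i * c i (modelH k s p)

/-- Paths along the Hamiltonian flow from `p`, travelled for a time `τ p` such that the integral of
the density along the path is `η p`. -/
theorem exists_moser_paths {k : ℕ} (hk : 2 ≤ k) (s : ℝ) {c : ℕ → ℝ → ℝ}
    (hc : ∀ i, AnalyticAt ℝ (c i) 0) (hc0 : c 0 0 ≠ 0) {η : Plane → ℝ}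
    (hη : AnalyticAt ℝ η 0) (hη0 : η 0 = 0) :
    ∃ (x ξ : Plane → PathSpace) (τ : Plane → ℝ), AnalyticAt ℝ x 0 ∧ AnalyticAt ℝ ξ 0 ∧
      AnalyticAt ℝ τ 0 ∧ x 0 = 0 ∧ ξ 0 = 0 ∧ τ 0 = 0 ∧ ∀ᶠ p in 𝓝 (0 : Plane),
        HasPathDeriv (x p) p.1 (algebraMap ℝ PathSpace (2 * τ p) * ξ p) ∧
        HasPathDeriv (ξ p) p.2 (algebraMap ℝ PathSpace (-(s * k * τ p)) * x p ^ (k - 1)) ∧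
        τ p * ∑ i ∈ Finset.range (k - 1), c i (modelH k s p) * pathPrimitive (x p ^ i) 1 = η p := by
  have hk0 : k ≠ 0 := by omega
  let E := PathSpace × PathSpace × ℝ
  let ev : PathSpace →L[ℝ] ℝ := ContinuousMap.evalCLM ℝ 1
  let Λ : Plane × E → ℝ := fun z => ∑ i ∈ Finset.range (k - 1),
    c i (modelH k s z.1) * ev (pathPrimitive (z.2.1 ^ i))
  -- The first two components are the integral form of Hamilton's equations in rescaled time. The
  -- third, `τ = c₀⁻¹ η + τ c₀⁻¹ (c₀ - Λ)` with `c₀ = c 0 0`, is a rewriting of `τ Λ = η`. Every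
  -- term involving the unknown `e` is `τ` times a factor vanishing at the origin, so the derivative
  -- of `N` in `e` is zero there.
  let N : Plane × E → E := fun z =>
    (z.1.1 • (1 : PathSpace) + z.2.2.2 • ((2 : ℝ) • pathPrimitive z.2.2.1),
      z.1.2 • (1 : PathSpace) + z.2.2.2 • ((-(s * k)) • pathPrimitive (z.2.1 ^ (k - 1))),
      (c 0 0)⁻¹ * η z.1 + z.2.2.2 • ((c 0 0)⁻¹ * (c 0 0 - Λ z)))
  have a1 : AnalyticAt ℝ (fun z : Plane × E => z.1) 0 := analyticAt_fst
  have a2 : AnalyticAt ℝ (fun z : Plane × E => z.2) 0 := analyticAt_snd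
  have ax : AnalyticAt ℝ (fun z : Plane × E => z.2.1) 0 := analyticAt_fst.fun_comp a2
  have a22 : AnalyticAt ℝ (fun z : Plane × E => z.2.2) 0 := analyticAt_snd.fun_comp a2
  have aξ : AnalyticAt ℝ (fun z : Plane × E => z.2.2.1) 0 := analyticAt_fst.fun_comp a22
  have aτ : AnalyticAt ℝ (fun z : Plane × E => z.2.2.2) 0 := analyticAt_snd.fun_comp a22
  have aI {g : Plane × E → PathSpace} (hg : AnalyticAt ℝ g 0) :
      AnalyticAt ℝ (fun z => pathPrimitive (g z)) 0 := (pathPrimitive.analyticAt _).fun_comp hg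
  have aΛ : AnalyticAt ℝ Λ 0 := by
    refine Finset.analyticAt_fun_sum _ fun i _ => ?_
    have h1 : AnalyticAt ℝ (fun z : Plane × E => c i (modelH k s z.1)) 0 :=
      AnalyticAt.fun_comp (g := fun p => c i (modelH k s p)) ((hc i).comp_modelH hk0) a1
    exact h1.mul ((ev.analyticAt _).fun_comp (aI (ax.pow i)))
  have hN : AnalyticAt ℝ N 0 := by
    have b1 : AnalyticAt ℝ (fun z : Plane × E => z.1.1) 0 := analyticAt_fst.fun_comp a1
    have b2 : AnalyticAt ℝ (fun z : Plane × E => z.1.2) 0 := analyticAt_snd.fun_comp a1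
    have b3 : AnalyticAt ℝ (fun z : Plane × E => η z.1) 0 :=
      AnalyticAt.fun_comp (g := η) hη a1
    refine AnalyticAt.prod ?_ (AnalyticAt.prod ?_ ?_)
    · exact (b1.smul analyticAt_const).add (aτ.smul ((analyticAt_const (v := (2 : ℝ))).smul (aI aξ)))
    · exact (b2.smul analyticAt_const).add
        (aτ.smul ((analyticAt_const (v := -(s * k))).smul (aI (ax.pow (k - 1)))))
    · exact (analyticAt_const.mul b3).add
        (aτ.smul (analyticAt_const.mul (analyticAt_const.sub aΛ)))
  have hΛ0 : Λ 0 = c 0 0 := by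
    have h1 : 0 ∈ Finset.range (k - 1) := Finset.mem_range.2 (by omega)
    simp only [Λ]
    rw [Finset.sum_eq_single_of_mem 0 h1]
    · simp only [Prod.fst_zero, Prod.snd_zero, pow_zero, modelH_zero hk0]
      have : ev (pathPrimitive 1) = 1 := pathPrimitive_one_one
      rw [this, mul_one]
    · intro i _ hi
      simp [hi]
  have hk1 : k - 1 ≠ 0 := by omega
  have hN0 : N 0 = 0 := by
    simp [N, hη0]
    rfl
  have hpart : HasFDerivAt (fun e => N (0, e)) (0 : E →L[ℝ] E) 0 := by
    have h0 : AnalyticAt ℝ (fun e : E => ((0, e) : Plane × E)) 0 :=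
      analyticAt_const.prod analyticAt_id
    have d {G : Type} [NormedAddCommGroup G] [NormedSpace ℝ G] {g : Plane × E → G}
        (hg : AnalyticAt ℝ g 0) :
        DifferentiableAt ℝ (fun e : E => g (0, e)) 0 :=
      (AnalyticAt.fun_comp (g := g) (f := fun e : E => ((0, e) : Plane × E)) hg h0).differentiableAt
    have h1 := hasFDerivAt_smul_of_eq_zero (d aτ)
      (d ((analyticAt_const (v := (2 : ℝ))).smul (aI aξ))) rfl (by simp)
    have h2 := hasFDerivAt_smul_of_eq_zero (d aτ)
      (d ((analyticAt_const (v := -(s * k))).smul (aI (ax.pow (k - 1))))) rfl (by simp [hk1])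
    have h3 := hasFDerivAt_smul_of_eq_zero (d aτ)
      (d ((analyticAt_const (v := (c 0 0)⁻¹)).mul ((analyticAt_const (v := c 0 0)).sub aΛ))) rfl (by
        have : Λ ((0 : Plane), (0 : E)) = c 0 0 := hΛ0
        simp [this])
    have h4 := h1.prodMk (h2.prodMk h3)
    refine (h4.congr_of_eventuallyEq (Eventually.of_forall fun e => ?_)).congr_fderiv ?_
    · simp [N, hη0]
    · ext <;> simp
  obtain ⟨e, he, he0, hfix⟩ := exists_analytic_fixedPoint hN hN0 hpart
  have he2 : AnalyticAt ℝ (fun p => (e p).2) 0 := analyticAt_snd.fun_comp he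
  refine ⟨fun p => (e p).1, fun p => (e p).2.1, fun p => (e p).2.2, analyticAt_fst.fun_comp he,
    analyticAt_fst.fun_comp he2, analyticAt_snd.fun_comp he2, by simp [he0], by simp [he0],
    by simp [he0], ?_⟩
  filter_upwards [hfix] with p hp
  have h1 : (e p).1 = (N (p, e p)).1 := congrArg Prod.fst hp
  have h2 : (e p).2.1 = (N (p, e p)).2.1 := congrArg (fun z => z.2.1) hp
  have h3 : (e p).2.2 = (N (p, e p)).2.2 := congrArg (fun z => z.2.2) hp
  refine ⟨?_, ?_, ?_⟩
  · rw [HasPathDeriv, pathPrimitive_algebraMap_mul]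
    refine h1.trans ?_
    simp only [N, Algebra.smul_def, map_mul]
    ring
  · rw [HasPathDeriv, pathPrimitive_algebraMap_mul]
    refine h2.trans ?_
    simp only [N, Algebra.smul_def, map_mul, map_neg]
    ring
  · simp only [N, smul_eq_mul] at h3
    field_simp at h3
    have h4 : Λ (p, e p) =
      ∑ i ∈ Finset.range (k - 1), c i (modelH k s p) * pathPrimitive ((e p).1 ^ i) 1 := rfl
    rw [← h4]
    linarith

theorem modelH_eq_of_hasPathDeriv {k : ℕ} {s τ : ℝ} {p : Plane} {x ξ : PathSpace}
    (hx : HasPathDeriv x p.1 (algebraMap ℝ PathSpace (2 * τ) * ξ))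
    (hξ : HasPathDeriv ξ p.2 (algebraMap ℝ PathSpace (-(s * k * τ)) * x ^ (k - 1))) :
    modelH k s (x 1, ξ 1) = modelH k s p := by
  have h := ((hξ.pow 2).add ((hx.pow k).const_mul s)).apply_one
  have h0 : (2 : ℕ) * ξ ^ (2 - 1) * (algebraMap ℝ PathSpace (-(s * k * τ)) * x ^ (k - 1)) +
      algebraMap ℝ PathSpace s * (k * x ^ (k - 1) * (algebraMap ℝ PathSpace (2 * τ) * ξ)) = 0 := by
    simp only [map_mul, map_neg, map_natCast, map_ofNat]
    push_cast
    ring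
  rw [h0] at h
  simpa [modelH] using h

theorem fderiv_apply_eq_of_hasDerivAt {F : Type*} [NormedAddCommGroup F] [NormedSpace ℝ F]
    {f : Plane → F} {p v : Plane} (hf : DifferentiableAt ℝ f p) :
    HasDerivAt (fun t : ℝ => f (p + t • v)) (fderiv ℝ f p v) 0 := by
  have h1 : HasDerivAt (fun t : ℝ => p + t • v) v 0 := by
    simpa using ((hasDerivAt_id (0 : ℝ)).smul_const v).const_add p
  have h2 : HasFDerivAt f (fderiv ℝ f p) (p + (0 : ℝ) • v) := by simpa using hf.hasFDerivAt
  exact h2.comp_hasDerivAt (0 : ℝ) h1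

/-- A symplectomorphism up to the density: `ψ` preserves `H`, and on each level it changes time so
as to realise the change of density by an exact term. -/
theorem exists_moser {k : ℕ} (hk : 2 ≤ k) {s : ℝ} (hs : |s| = 1) {c : ℕ → ℝ → ℝ}
    (hc : ∀ i, AnalyticAt ℝ (c i) 0) (hc0 : c 0 0 ≠ 0) {η : Plane → ℝ}
    (hη : AnalyticAt ℝ η 0) :
    ∃ ψ : Plane → Plane, AnalyticAt ℝ ψ 0 ∧ ψ 0 = 0 ∧
      (∀ᶠ p in 𝓝 (0 : Plane), modelH k s (ψ p) = modelH k s p) ∧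
      ∀ᶠ p in 𝓝 (0 : Plane), ∃ μ : ℝ, fderiv ℝ ψ p (modelV k s p) = μ • modelV k s (ψ p) ∧
        μ * polyDensity k s c (ψ p) = polyDensity k s c p + modelD k s η p := by
  have hk0 : k ≠ 0 := by omega
  -- Only derivatives of `η` matter; subtracting `η 0` makes `τ` vanish at the origin.
  obtain ⟨x, ξ, τ, hx, hξ, hτ, hx0, hξ0, hτ0, h⟩ := exists_moser_paths hk s hc hc0
    (hη.sub (analyticAt_const (v := η 0))) (by simp)
  let ev : PathSpace →L[ℝ] ℝ := ContinuousMap.evalCLM ℝ 1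
  have hψx : AnalyticAt ℝ (fun p => x p 1) 0 := (ev.analyticAt _).fun_comp hx
  have hψξ : AnalyticAt ℝ (fun p => ξ p 1) 0 := (ev.analyticAt _).fun_comp hξ
  have hH : ∀ᶠ p in 𝓝 (0 : Plane), modelH k s (x p 1, ξ p 1) = modelH k s p := by
    filter_upwards [h] with p hp using modelH_eq_of_hasPathDeriv hp.1 hp.2.1
  refine ⟨fun p => (x p 1, ξ p 1), hψx.prod hψξ, by simp [hx0, hξ0], hH, ?_⟩
  have hxs : ∀ᶠ p in 𝓝 (0 : Plane), ‖x p‖ ≤ 1 := by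
    have h1 : Tendsto (fun p => ‖x p‖) (𝓝 0) (𝓝 ‖x 0‖) := hx.continuousAt.norm
    rw [hx0, norm_zero] at h1
    exact (h1.eventually (gt_mem_nhds one_pos)).mono fun _ h => h.le
  have hτs : ∀ᶠ p in 𝓝 (0 : Plane), |τ p| * (2 * k) ≤ 1 := by
    have h1 : Tendsto (fun p => |τ p| * (2 * k)) (𝓝 0) (𝓝 (|τ 0| * (2 * k))) :=
      hτ.continuousAt.abs.mul tendsto_const_nhds
    rw [hτ0, abs_zero, zero_mul] at h1
    exact (h1.eventually (gt_mem_nhds one_pos)).mono fun _ h => h.le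
  have hcd : ∀ᶠ p in 𝓝 (0 : Plane), ∀ i ∈ Finset.range (k - 1),
      DifferentiableAt ℝ (c i) (modelH k s p) :=
    (Finset.eventually_all _).2 fun i _ =>
      (tendsto_modelH hk0 s).eventually (hc i).eventually_differentiableAt
  filter_upwards [h.eventually_nhds, hxs, hτs, hx.eventually_differentiableAt,
    hξ.eventually_differentiableAt, hτ.eventually_differentiableAt,
    hη.eventually_differentiableAt, hcd, hH] with p hp hxp hτp hdx hdξ hdτ hdη hcp hHp
  -- All quantities are differentiated at `p` in the direction `v` of the field, along the straight
  -- line `p + t v`.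
  set v := modelV k s p with hv
  have dx := fderiv_apply_eq_of_hasDerivAt (v := v) hdx
  have dξ := fderiv_apply_eq_of_hasDerivAt (v := v) hdξ
  have dτ := fderiv_apply_eq_of_hasDerivAt (v := v) hdτ
  have dη := fderiv_apply_eq_of_hasDerivAt (v := v) hdη
  have dι (r : ℝ → ℝ) (r' : ℝ) (hr : HasDerivAt r r' 0) :
      HasDerivAt (fun t => algebraMap ℝ PathSpace (r t)) (algebraMap ℝ PathSpace r') 0 :=
    ((Algebra.linearMap ℝ PathSpace).toContinuousLinearMap.hasFDerivAt).comp_hasDerivAt 0 hr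
  have dI (y : ℝ → PathSpace) (y' : PathSpace) (hy : HasDerivAt y y' 0) :
      HasDerivAt (fun t => pathPrimitive (y t)) (pathPrimitive y') 0 :=
    (pathPrimitive.hasFDerivAt).comp_hasDerivAt 0 hy
  have dev (y : ℝ → PathSpace) (y' : PathSpace) (hy : HasDerivAt y y' 0) :
      HasDerivAt (fun t => y t 1) (y' 1) 0 :=
    (ev.hasFDerivAt).comp_hasDerivAt 0 hy
  have d1 : HasDerivAt (fun t : ℝ => (p + t • v).1) (2 * p.2) 0 := by
    simpa [fderiv_fst, hv, modelV] using
      fderiv_apply_eq_of_hasDerivAt (v := v) (differentiableAt_fst (p := p) (𝕜 := ℝ))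
  have d2 : HasDerivAt (fun t : ℝ => (p + t • v).2) (-(s * k * p.1 ^ (k - 1))) 0 := by
    simpa [fderiv_snd, hv, modelV] using
      fderiv_apply_eq_of_hasDerivAt (v := v) (differentiableAt_snd (p := p) (𝕜 := ℝ))
  set x' := fderiv ℝ x p v
  set ξ' := fderiv ℝ ξ p v
  set τ' := fderiv ℝ τ p v
  have hline : ∀ᶠ t : ℝ in 𝓝 0, (fun q : Plane =>
      HasPathDeriv (x q) q.1 (algebraMap ℝ PathSpace (2 * τ q) * ξ q) ∧
      HasPathDeriv (ξ q) q.2 (algebraMap ℝ PathSpace (-(s * k * τ q)) * x q ^ (k - 1)) ∧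
      τ q * ∑ i ∈ Finset.range (k - 1), c i (modelH k s q) * pathPrimitive (x q ^ i) 1 =
        η q - η 0) (p + t • v) := by
    have : Tendsto (fun t : ℝ => p + t • v) (𝓝 0) (𝓝 p) :=
      (by fun_prop : Continuous fun t : ℝ => p + t • v).tendsto' _ _ (by simp)
    exact this.eventually hp
  obtain ⟨px, pξ, pη⟩ := hp.self_of_nhds
  have e1 : x' = algebraMap ℝ PathSpace (2 * p.2) + (algebraMap ℝ PathSpace (2 * τ') *
      pathPrimitive (ξ p) + algebraMap ℝ PathSpace (2 * τ p) * pathPrimitive ξ') := by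
    have h1 := (dι _ _ d1).add ((dι _ _ (dτ.const_mul 2)).mul (dI _ _ dξ))
    simp only [zero_smul, add_zero] at h1
    refine dx.unique (h1.congr_of_eventuallyEq ?_)
    filter_upwards [hline] with t ht
    have := ht.1
    rw [HasPathDeriv, pathPrimitive_algebraMap_mul] at this
    exact this
  have e2 : ξ' = algebraMap ℝ PathSpace (-(s * k * p.1 ^ (k - 1))) +
      (algebraMap ℝ PathSpace (-(s * k * τ')) * pathPrimitive (x p ^ (k - 1)) +
      algebraMap ℝ PathSpace (-(s * k * τ p)) *
        pathPrimitive ((k - 1 : ℕ) * x p ^ (k - 2) * x')) := by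
    have h1 := (dι _ _ d2).add ((dι _ _ ((dτ.const_mul (s * k)).neg)).mul
      (dI _ _ (dx.pow (k - 1))))
    simp only [zero_smul, add_zero, Nat.sub_sub, Pi.pow_apply, Pi.neg_apply] at h1
    refine dξ.unique (h1.congr_of_eventuallyEq ?_)
    filter_upwards [hline] with t ht
    have := ht.2.1
    rw [HasPathDeriv, pathPrimitive_algebraMap_mul] at this
    exact this
  obtain ⟨hx', hξ'⟩ := variation_eq hs hxp hτp px pξ e1 e2
  refine ⟨1 + τ', ?_, ?_⟩
  · have h1 : HasDerivAt (fun t : ℝ => ((x (p + t • v) 1, ξ (p + t • v) 1) : Plane)) (x' 1, ξ' 1) 0 :=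
      (dev _ _ dx).prodMk (dev _ _ dξ)
    have h2 := fderiv_apply_eq_of_hasDerivAt (v := v) (f := fun p => ((x p 1, ξ p 1) : Plane))
      (p := p) (((ev.differentiableAt).comp p hdx).prodMk ((ev.differentiableAt).comp p hdξ))
    rw [h2.unique h1, hx', hξ']
    simp [modelV, pathPrimitive_one_one, Algebra.algebraMap_eq_smul_one]
    constructor <;> ring
  -- The derivative along the field of the constraint `τ · ∫ density = η - η 0`; the factors `c i
  -- (H)` are constant in this direction.
  · have e3 : τ' * ∑ i ∈ Finset.range (k - 1), c i (modelH k s p) * pathPrimitive (x p ^ i) 1 +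
        τ p * ∑ i ∈ Finset.range (k - 1), c i (modelH k s p) *
          pathPrimitive (i * x p ^ (i - 1) * x') 1 = modelD k s η p := by
      have dc (i : ℕ) (hi : i ∈ Finset.range (k - 1)) :
          HasDerivAt (fun t : ℝ => c i (modelH k s (p + t • v))) 0 0 := by
        have h1 := fderiv_apply_eq_of_hasDerivAt (v := v) (f := fun q => c i (modelH k s q))
          (p := p) ((hcp i hi).comp p (analyticAt_modelH k s p).differentiableAt)
        have h2 := modelD_comp_modelH (hcp i hi)
        rw [modelD] at h2
        rwa [hv, h2] at h1
      have h1 := dτ.mul (HasDerivAt.fun_sum fun i hi =>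
        (dc i hi).mul (dev _ _ (dI _ _ (dx.pow i))))
      simp only [zero_smul, add_zero, zero_mul, zero_add, Pi.mul_apply, Pi.pow_apply] at h1
      refine h1.unique ((dη.sub_const (η 0)).congr_of_eventuallyEq ?_)
      filter_upwards [hline] with t ht using ht.2.2
    have hL : HasPathDeriv (1 + algebraMap ℝ PathSpace τ' * pathPrimitive 1) 1
        (algebraMap ℝ PathSpace τ') := by
      rw [HasPathDeriv, ← pathPrimitive_algebraMap_mul, mul_one, map_one]
    -- Integrate over the path the derivative of `(1 + tτ')` times the density. The endpoint values
    -- are `(1 + τ')` times the density at `ψ p`, and the density at `p`. By `hx'`, `(1 + tτ') · 2τξ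
    -- = τ x'`, so the integral is the left side of `e3`.
    have h5 := (hL.mul (HasPathDeriv.sum (Finset.range (k - 1)) fun i _ =>
      (px.pow i).const_mul (c i (modelH k s p)))).apply_one
    have h6 : (algebraMap ℝ PathSpace τ' * ∑ i ∈ Finset.range (k - 1),
          algebraMap ℝ PathSpace (c i (modelH k s p)) * x p ^ i +
        (1 + algebraMap ℝ PathSpace τ' * pathPrimitive 1) * ∑ i ∈ Finset.range (k - 1),
          algebraMap ℝ PathSpace (c i (modelH k s p)) *
            (i * x p ^ (i - 1) * (algebraMap ℝ PathSpace (2 * τ p) * ξ p))) =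
        algebraMap ℝ PathSpace τ' * ∑ i ∈ Finset.range (k - 1),
          algebraMap ℝ PathSpace (c i (modelH k s p)) * x p ^ i +
        algebraMap ℝ PathSpace (τ p) * ∑ i ∈ Finset.range (k - 1),
          algebraMap ℝ PathSpace (c i (modelH k s p)) * (i * x p ^ (i - 1) * x') := by
      congr 1
      rw [Finset.mul_sum, Finset.mul_sum]
      refine Finset.sum_congr rfl fun i _ => ?_
      rw [hx', map_mul]
      ring
    rw [h6, map_add, pathPrimitive_algebraMap_mul, pathPrimitive_algebraMap_mul, map_sum, map_sum]
      at h5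
    simp only [pathPrimitive_algebraMap_mul] at h5
    simp only [polyDensity, hHp]
    rw [← e3]
    simp [pathPrimitive_one_one, Algebra.algebraMap_eq_smul_one, ContinuousMap.coe_sum] at h5
    simp only [mul_comm _ (c _ _)]
    linarith

/-! ### Densities and Jacobians -/

/-- The Jacobian determinant of a map of the plane. -/
noncomputable def planeJac (ψ : Plane → Plane) (p : Plane) : ℝ :=
  (fderiv ℝ ψ p (1, 0)).1 * (fderiv ℝ ψ p (0, 1)).2 -
    (fderiv ℝ ψ p (0, 1)).1 * (fderiv ℝ ψ p (1, 0)).2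

theorem plane_clm_apply {F : Type*} [NormedAddCommGroup F] [NormedSpace ℝ F] (L : Plane →L[ℝ] F)
    (v : Plane) : L v = v.1 • L (1, 0) + v.2 • L (0, 1) := by
  rw [← map_smul, ← map_smul, ← map_add]
  simp

theorem planeJac_area (ψ : Plane → Plane) (p v w : Plane) :
    (fderiv ℝ ψ p v).1 * (fderiv ℝ ψ p w).2 - (fderiv ℝ ψ p v).2 * (fderiv ℝ ψ p w).1 =
      planeJac ψ p * (v.1 * w.2 - v.2 * w.1) := by
  rw [plane_clm_apply (fderiv ℝ ψ p) v, plane_clm_apply (fderiv ℝ ψ p) w]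
  simp [planeJac]
  ring

theorem planeJac_comp {ψ φ : Plane → Plane} {p : Plane} (hψ : DifferentiableAt ℝ ψ (φ p))
    (hφ : DifferentiableAt ℝ φ p) :
    planeJac (fun q => ψ (φ q)) p = planeJac ψ (φ p) * planeJac φ p := by
  have h := (hψ.hasFDerivAt.comp p hφ.hasFDerivAt).fderiv
  simp only [Function.comp_def] at h
  have h2 := planeJac_area ψ (φ p) (fderiv ℝ φ p (1, 0)) (fderiv ℝ φ p (0, 1))
  simp only [planeJac, h, ContinuousLinearMap.comp_apply] at h2 ⊢
  linarith

theorem planeJac_congr {ψ φ : Plane → Plane} {p : Plane} (h : ψ =ᶠ[𝓝 p] φ) :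
    planeJac ψ p = planeJac φ p := by
  rw [planeJac, planeJac, h.fderiv_eq]

theorem AnalyticAt.planeJac {ψ : Plane → Plane} {p : Plane} (h : AnalyticAt ℝ ψ p) :
    AnalyticAt ℝ (planeJac ψ) p := by
  have h1 (v : Plane) : AnalyticAt ℝ (fun q => fderiv ℝ ψ q v) p :=
    ((ContinuousLinearMap.apply ℝ Plane v).analyticAt _).fun_comp h.fderiv
  have h2 (v : Plane) : AnalyticAt ℝ (fun q => (fderiv ℝ ψ q v).1) p :=
    analyticAt_fst.fun_comp (h1 v)
  have h3 (v : Plane) : AnalyticAt ℝ (fun q => (fderiv ℝ ψ q v).2) p :=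
    analyticAt_snd.fun_comp (h1 v)
  exact ((h2 (1, 0)).mul (h3 (0, 1))).sub ((h2 (0, 1)).mul (h3 (1, 0)))

/-- The 2-form with a given density. -/
noncomputable def densityForm (f : Plane → ℝ) : TwoForm := fun p => f p • dXiWedgeDx

theorem pullbackForm_densityForm (ψ : Plane → Plane) (f : Plane → ℝ) (p : Plane) :
    pullbackForm ψ (densityForm f) p = densityForm (fun q => f (ψ q) * planeJac ψ q) p := by
  ext m
  have h := planeJac_area ψ p (m 0) (m 1)
  simp only [pullbackForm, densityForm, ContinuousAlternatingMap.compContinuousLinearMap_apply,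
    ContinuousAlternatingMap.smul_apply, dXiWedgeDx_apply, smul_eq_mul, Function.comp_apply]
  linear_combination -(f (ψ p)) * h

theorem densityForm_injective {f g : Plane → ℝ} {p : Plane}
    (h : densityForm f p = densityForm g p) : f p = g p := by
  have := congrArg (fun ω : Plane [⋀^Fin 2]→L[ℝ] ℝ => ω ![(0, 1), (1, 0)]) h
  simpa [densityForm, dXiWedgeDx_apply] using this

theorem eq_densityForm (ω : TwoForm) :
    ω = densityForm fun p => ω p ![(0, 1), (1, 0)] := by
  ext p m
  have h (v : Plane) : v = v.1 • ((1, 0) : Plane) + v.2 • ((0, 1) : Plane) := by simp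
  have hm : m = ![m 0, m 1] := by ext i <;> fin_cases i <;> rfl
  have u0 (z a v : Plane) : Function.update ![a, v] 0 z = ![z, v] := by
    ext i <;> fin_cases i <;> rfl
  have u1 (z a v : Plane) : Function.update ![v, a] 1 z = ![v, z] := by
    ext i <;> fin_cases i <;> rfl
  have hadd (a b v : Plane) : ω p ![a + b, v] = ω p ![a, v] + ω p ![b, v] := by
    simpa only [u0] using (ω p).map_update_add ![a, v] 0 a b
  have hadd' (a b v : Plane) : ω p ![v, a + b] = ω p ![v, a] + ω p ![v, b] := by
    simpa only [u1] using (ω p).map_update_add ![v, a] 1 a b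
  have hsm (r : ℝ) (a v : Plane) : ω p ![r • a, v] = r * ω p ![a, v] := by
    simpa only [u0, smul_eq_mul] using (ω p).map_update_smul ![a, v] 0 r a
  have hsm' (r : ℝ) (a v : Plane) : ω p ![v, r • a] = r * ω p ![v, a] := by
    simpa only [u1, smul_eq_mul] using (ω p).map_update_smul ![v, a] 1 r a
  have hself (a : Plane) : ω p ![a, a] = 0 :=
    (ω p).map_eq_zero_of_eq ![a, a] (i := 0) (j := 1) rfl (by decide)
  have hswap : ω p ![(1, 0), (0, 1)] = - ω p ![(0, 1), (1, 0)] := by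
    have h1 := hself ((1, 0) + (0, 1))
    rw [hadd, hadd', hadd', hself, hself] at h1
    linarith
  simp only [densityForm, ContinuousAlternatingMap.smul_apply, dXiWedgeDx_apply, smul_eq_mul]
  conv_lhs => rw [hm, h (m 0), h (m 1)]
  simp only [hadd, hadd', hsm, hsm', hself, hswap]
  ring

theorem analyticAt_density {ω : TwoForm} (hω : AnalyticAt ℝ ω 0) :
    AnalyticAt ℝ (fun p => ω p ![(0, 1), (1, 0)]) 0 :=
  ((ContinuousAlternatingMap.apply ℝ Plane ℝ ![((0, 1) : Plane), (1, 0)]).analyticAt _).fun_comp hω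

theorem IsAnalyticSymplecticGerm.exists_density {ω : TwoForm} (hω : IsAnalyticSymplecticGerm ω) :
    ∃ f : Plane → ℝ, AnalyticAt ℝ f 0 ∧ f 0 ≠ 0 ∧ ω = densityForm f := by
  refine ⟨_, analyticAt_density hω.1, fun h0 => ?_, eq_densityForm ω⟩
  have h1 := hω.2.2.self_of_nhds (1, 0) fun w => by
    rw [eq_densityForm ω]
    simp [densityForm, h0]
  simp at h1

theorem isAnalyticSymplecticGerm_densityForm {f : Plane → ℝ} (hf : AnalyticAt ℝ f 0)
    (hf0 : f 0 ≠ 0) : IsAnalyticSymplecticGerm (densityForm f) := by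
  refine ⟨hf.smul analyticAt_const, Eventually.of_forall fun p => ?_, ?_⟩
  -- Closedness is automatic: three vectors of the plane are linearly dependent, so every 3-form
  -- vanishes.
  · ext m
    refine (extDeriv (densityForm f) p).toAlternatingMap.map_linearDependent m fun hm => ?_
    have := hm.fintype_card_le_finrank
    simp at this
  · filter_upwards [hf.continuousAt.eventually_ne hf0] with p hp v hv
    have h1 := hv (1, 0)
    have h2 := hv (0, 1)
    simp [densityForm, dXiWedgeDx_apply, hp] at h1 h2
    exact Prod.ext h2 h1

/-! ### Analytic diffeomorphism germs -/

theorem isAnalyticDiffeoGerm_of_planeJac_ne_zero {ψ : Plane → Plane} (hψ : AnalyticAt ℝ ψ 0)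
    (h0 : ψ 0 = 0) (hJ : planeJac ψ 0 ≠ 0) : IsAnalyticDiffeoGerm ψ := by
  have hinj : Function.Injective (fderiv ℝ ψ 0 : Plane →ₗ[ℝ] Plane) := by
    rw [← LinearMap.ker_eq_bot, LinearMap.ker_eq_bot']
    intro v hv
    have hv' : fderiv ℝ ψ 0 v = 0 := hv
    have h1 := planeJac_area ψ 0 v (1, 0)
    have h2 := planeJac_area ψ 0 v (0, 1)
    rw [hv'] at h1 h2
    simp [hJ] at h1 h2
    exact Prod.ext h2 h1
  let L : Plane ≃L[ℝ] Plane := (LinearEquiv.ofInjectiveEndo _ hinj).toContinuousLinearEquiv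
  have hL : (L : Plane →L[ℝ] Plane) = fderiv ℝ ψ 0 := by
    ext <;> rfl
  have hd : HasFDerivAt ψ (L : Plane →L[ℝ] Plane) 0 := by
    rw [hL]; exact hψ.differentiableAt.hasFDerivAt
  have hcd : ContDiffAt ℝ ⊤ ψ 0 := hψ.contDiffAt
  let e := hcd.toOpenPartialHomeomorph ψ hd (by simp)
  have hmem : (0 : Plane) ∈ e.source := hcd.mem_toOpenPartialHomeomorph_source hd (by simp)
  have htgt : (0 : Plane) ∈ e.target := by
    have := hcd.image_mem_toOpenPartialHomeomorph_target hd (by simp)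
    rwa [h0] at this
  refine ⟨hψ, h0, e.symm, ?_, ?_, e.eventually_left_inverse hmem, e.eventually_right_inverse htgt⟩
  · have := hcd.to_localInverse hd (by simp)
    rw [h0] at this
    exact this.analyticAt
  · have := e.left_inv hmem
    have h1 : e 0 = 0 := h0
    rwa [h1] at this

theorem IsAnalyticDiffeoGerm.tendsto {ψ : Plane → Plane} (h : IsAnalyticDiffeoGerm ψ) :
    Tendsto ψ (𝓝 0) (𝓝 0) := by
  have := h.1.continuousAt.tendsto
  rwa [h.2.1] at this

theorem IsAnalyticDiffeoGerm.exists_inverse {ψ : Plane → Plane} (h : IsAnalyticDiffeoGerm ψ) :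
    ∃ χ, IsAnalyticDiffeoGerm χ ∧ (∀ᶠ p in 𝓝 (0 : Plane), χ (ψ p) = p) ∧
      ∀ᶠ p in 𝓝 (0 : Plane), ψ (χ p) = p := by
  obtain ⟨h1, h2, χ, h3, h4, h5, h6⟩ := h
  exact ⟨χ, ⟨h3, h4, ψ, h1, h2, h6, h5⟩, h5, h6⟩

theorem AnalyticAt.comp_of_eq_zero {E F G : Type*} [NormedAddCommGroup E]
    [NormedSpace ℝ E] [NormedAddCommGroup F] [NormedSpace ℝ F] [NormedAddCommGroup G]
    [NormedSpace ℝ G] {g : F → G} {f : E → F} (hg : AnalyticAt ℝ g 0)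
    (hf : AnalyticAt ℝ f 0) (h0 : f 0 = 0) : AnalyticAt ℝ (fun p => g (f p)) 0 :=
  AnalyticAt.fun_comp (by rwa [h0]) hf

theorem IsAnalyticDiffeoGerm.comp {ψ φ : Plane → Plane} (hψ : IsAnalyticDiffeoGerm ψ)
    (hφ : IsAnalyticDiffeoGerm φ) : IsAnalyticDiffeoGerm fun p => ψ (φ p) := by
  obtain ⟨ψ', hψ', h1, h2⟩ := hψ.exists_inverse
  obtain ⟨φ', hφ', h3, h4⟩ := hφ.exists_inverse
  refine ⟨hψ.1.comp_of_eq_zero hφ.1 hφ.2.1, by simp only [hφ.2.1, hψ.2.1], fun p => φ' (ψ' p),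
    hφ'.1.comp_of_eq_zero hψ'.1 hψ'.2.1, by simp only [hψ'.2.1, hφ'.2.1], ?_, ?_⟩
  · filter_upwards [hφ.tendsto.eventually h1, h3] with p hp hp'
    rw [hp, hp']
  · filter_upwards [hψ'.tendsto.eventually h4, h2] with p hp hp'
    rw [hp, hp']

theorem IsAnalyticDiffeoGerm.planeJac_ne_zero {ψ : Plane → Plane} (h : IsAnalyticDiffeoGerm ψ) :
    planeJac ψ 0 ≠ 0 := by
  obtain ⟨χ, hχ, h1, -⟩ := h.exists_inverse
  have h2 : planeJac (fun p => χ (ψ p)) 0 = planeJac χ (ψ 0) * planeJac ψ 0 :=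
    planeJac_comp (by rw [h.2.1]; exact hχ.1.differentiableAt) h.1.differentiableAt
  have h3 : (fun p => χ (ψ p)) =ᶠ[𝓝 0] id := h1
  rw [planeJac_congr h3] at h2
  intro h0
  rw [h0] at h2
  simp [planeJac] at h2

/-! ### The equivalence relation -/

theorem pullbackForm_comp {ψ φ : Plane → Plane} {p : Plane} (hψ : DifferentiableAt ℝ ψ (φ p))
    (hφ : DifferentiableAt ℝ φ p) (ω : TwoForm) :
    pullbackForm (fun q => ψ (φ q)) ω p = pullbackForm φ (pullbackForm ψ ω) p := by
  have h := (hψ.hasFDerivAt.comp p hφ.hasFDerivAt).fderiv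
  simp only [Function.comp_def] at h
  ext m
  simp only [pullbackForm, h]
  rfl

theorem pullbackForm_comp_eventually {ψ φ : Plane → Plane} (hψ : IsAnalyticDiffeoGerm ψ)
    (hφ : IsAnalyticDiffeoGerm φ) (ω : TwoForm) :
    ∀ᶠ p in 𝓝 (0 : Plane),
      pullbackForm (fun q => ψ (φ q)) ω p = pullbackForm φ (pullbackForm ψ ω) p := by
  filter_upwards [hφ.tendsto.eventually hψ.1.eventually_differentiableAt,
    hφ.1.eventually_differentiableAt] with p h1 h2 using pullbackForm_comp h1 h2 ω

theorem pullbackForm_eq_self {ψ : Plane → Plane} {p : Plane} (h : ψ =ᶠ[𝓝 p] id) (ω : TwoForm) :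
    pullbackForm ψ ω p = ω p := by
  ext m
  simp only [pullbackForm, h.fderiv_eq, h.self_of_nhds, fderiv_id]
  rfl

theorem pullbackForm_congr {ψ : Plane → Plane} (hψ : IsAnalyticDiffeoGerm ψ) {ω ω' : TwoForm}
    (h : ∀ᶠ p in 𝓝 (0 : Plane), ω p = ω' p) :
    ∀ᶠ p in 𝓝 (0 : Plane), pullbackForm ψ ω p = pullbackForm ψ ω' p := by
  filter_upwards [hψ.tendsto.eventually h] with p hp
  rw [pullbackForm, pullbackForm, hp]

theorem SameFoliation.symm {H H' : Plane → ℝ} (h : SameFoliation H H') : SameFoliation H' H :=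
  h.mono fun _ hp v => (hp v).symm

theorem SameFoliation.trans {H H' H'' : Plane → ℝ} (h : SameFoliation H H')
    (h' : SameFoliation H' H'') : SameFoliation H H'' := by
  filter_upwards [h, h'] with p h1 h2 v using (h1 v).trans (h2 v)

theorem sameFoliation_of_eventuallyEq {H H' : Plane → ℝ} (h : H =ᶠ[𝓝 0] H') :
    SameFoliation H H' := by
  filter_upwards [h.eventually_nhds] with p hp v
  rw [Filter.EventuallyEq.fderiv_eq hp]

theorem SameFoliation.comp {H H' : Plane → ℝ} (h : SameFoliation H H') (hH : AnalyticAt ℝ H 0)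
    (hH' : AnalyticAt ℝ H' 0) {ψ : Plane → Plane} (hψ : IsAnalyticDiffeoGerm ψ) :
    SameFoliation (fun p => H (ψ p)) fun p => H' (ψ p) := by
  filter_upwards [hψ.tendsto.eventually h, hψ.tendsto.eventually hH.eventually_differentiableAt,
    hψ.tendsto.eventually hH'.eventually_differentiableAt, hψ.1.eventually_differentiableAt]
    with p h1 h2 h3 h4 v
  have e1 := (h2.hasFDerivAt.comp p h4.hasFDerivAt).fderiv
  have e2 := (h3.hasFDerivAt.comp p h4.hasFDerivAt).fderiv
  simp only [Function.comp_def] at e1 e2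
  rw [e1, e2]
  exact h1 _

/-- The inverse map pulls `H₁ ∘ ψ` back to `H₁`, and `H₁ ∘ ψ` has the foliation of `H' ∘ ψ = H₀`. -/
theorem FibrationEquiv.symm {H₀ H₁ : Plane → ℝ} {ω₀ ω₁ : TwoForm} (hH₁ : AnalyticAt ℝ H₁ 0)
    (h : FibrationEquiv H₀ ω₀ H₁ ω₁) : FibrationEquiv H₁ ω₁ H₀ ω₀ := by
  obtain ⟨H', ψ, hH', hfol, hψ, hpull, hω⟩ := h
  obtain ⟨χ, hχ, h1, h2⟩ := hψ.exists_inverse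
  refine ⟨fun p => H₁ (ψ p), χ, hH₁.comp_of_eq_zero hψ.1 hψ.2.1, ?_, hχ, ?_, ?_⟩
  · exact (hfol.symm.comp hH₁ hH' hψ).trans (sameFoliation_of_eventuallyEq hpull)
  · filter_upwards [h2] with p hp
    rw [hp]
  · filter_upwards [pullbackForm_congr hχ hω, pullbackForm_comp_eventually hψ hχ ω₁,
      h2.eventually_nhds] with p h3 h4 h5
    rw [← h3, ← h4]
    exact pullbackForm_eq_self h5 ω₁

/-- For the composite `χ ∘ ψ` the intermediate Hamiltonian is `H₁' ∘ χ⁻¹`: it has the foliation of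
`H₁ ∘ χ⁻¹ = H₂'`, hence that of `H₂`. -/
theorem FibrationEquiv.trans {H₀ H₁ H₂ : Plane → ℝ} {ω₀ ω₁ ω₂ : TwoForm}
    (hH₁ : AnalyticAt ℝ H₁ 0) (h : FibrationEquiv H₀ ω₀ H₁ ω₁)
    (h' : FibrationEquiv H₁ ω₁ H₂ ω₂) : FibrationEquiv H₀ ω₀ H₂ ω₂ := by
  obtain ⟨H₁', ψ, hH₁', hfol₁, hψ, hpull₁, hω₁⟩ := h
  obtain ⟨H₂', χ, hH₂', hfol₂, hχ, hpull₂, hω₂⟩ := h'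
  obtain ⟨χ', hχ', h1, h2⟩ := hχ.exists_inverse
  refine ⟨fun p => H₁' (χ' p), fun p => χ (ψ p), hH₁'.comp_of_eq_zero hχ'.1 hχ'.2.1, ?_,
    hχ.comp hψ, ?_, ?_⟩
  · refine (hfol₁.comp hH₁' hH₁ hχ').trans (SameFoliation.trans ?_ hfol₂)
    refine sameFoliation_of_eventuallyEq ?_
    filter_upwards [hχ'.tendsto.eventually hpull₂, h2] with p h3 h4
    rw [← h3, h4]
  · filter_upwards [hψ.tendsto.eventually h1, hpull₁] with p h3 h4
    rw [h3, h4]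
  · filter_upwards [pullbackForm_comp_eventually hχ hψ ω₂, pullbackForm_congr hψ hω₂, hω₁]
      with p h3 h4 h5
    rw [h3, h4, h5]

/-! ### Reduction to densities for the model Hamiltonian -/

theorem fibrationEquiv_densityForm_of_preserves {k : ℕ} {s : ℝ} {f g : Plane → ℝ}
    {ψ : Plane → Plane} (hψ : IsAnalyticDiffeoGerm ψ)
    (hH : ∀ᶠ p in 𝓝 (0 : Plane), modelH k s (ψ p) = modelH k s p)
    (h : ∀ᶠ p in 𝓝 (0 : Plane), g (ψ p) * planeJac ψ p = f p) :
    FibrationEquiv (modelH k s) (densityForm f) (modelH k s) (densityForm g) := by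
  refine ⟨modelH k s, ψ, analyticAt_modelH k s 0, Eventually.of_forall fun _ _ => Iff.rfl, hψ, hH,
    ?_⟩
  filter_upwards [h] with p hp
  rw [pullbackForm_densityForm]
  simp only [densityForm, hp]

theorem planeJac_diag (a b : ℝ) (p : Plane) :
    planeJac (fun q : Plane => (a * q.1, b * q.2)) p = a * b := by
  have h1 : HasFDerivAt (fun q : Plane => ((a * q.1, b * q.2) : Plane))
      ((a • ContinuousLinearMap.fst ℝ ℝ ℝ).prod (b • ContinuousLinearMap.snd ℝ ℝ ℝ)) p :=
    (hasFDerivAt_fst.const_mul a).prodMk (hasFDerivAt_snd.const_mul b)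
  simp [planeJac, h1.fderiv]

theorem isAnalyticDiffeoGerm_diag {a b : ℝ} (ha : a ≠ 0) (hb : b ≠ 0) :
    IsAnalyticDiffeoGerm fun q : Plane => (a * q.1, b * q.2) :=
  isAnalyticDiffeoGerm_of_planeJac_ne_zero (by fun_prop) (by simp)
    (by rw [planeJac_diag]; exact mul_ne_zero ha hb)

/-- The adapted coordinates are used as the equivalence. The additive constant stays in the
intermediate Hamiltonian `modelH + a`, which has the same foliation as `modelH`. -/
theorem HasAnalyticASingularity.exists_fibrationEquiv {k : ℕ} {s : ℝ} {H : Plane → ℝ} {ω : TwoForm}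
    (hH : HasAnalyticASingularity k s H) (hω : IsAnalyticSymplecticGerm ω) :
    ∃ f : Plane → ℝ, AnalyticAt ℝ f 0 ∧ f 0 ≠ 0 ∧
      FibrationEquiv H ω (modelH k s) (densityForm f) := by
  obtain ⟨hHan, φ, hφ, a, hHφ⟩ := hH
  obtain ⟨g, hg, hg0, rfl⟩ := hω.exists_density
  obtain ⟨ψ, hψ, h1, h2⟩ := hφ.exists_inverse
  refine ⟨fun p => g (φ p) * planeJac φ p, (hg.comp_of_eq_zero hφ.1 hφ.2.1).mul hφ.1.planeJac,
    mul_ne_zero (by rwa [hφ.2.1]) hφ.planeJac_ne_zero, fun p => modelH k s p + a, ψ,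
    (analyticAt_modelH k s 0).add analyticAt_const, ?_, hψ, ?_, ?_⟩
  · refine Eventually.of_forall fun p v => ?_
    rw [fderiv_add_const]
  · filter_upwards [hψ.tendsto.eventually hHφ, h2] with p h3 h4
    rw [← h3, h4]
  · filter_upwards [pullbackForm_comp_eventually hφ hψ (densityForm g), h2.eventually_nhds]
      with p h3 h4
    have h5 := pullbackForm_eq_self h4 (densityForm g)
    rw [h3] at h5
    rw [← h5]
    congr 1
    ext q : 1
    exact (pullbackForm_densityForm φ g q).symm

theorem modelV_ne_zero {k : ℕ} {s : ℝ} (hk : 2 ≤ k) (hs : s ≠ 0) {p : Plane} (hp : p ≠ 0) :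
    modelV k s p ≠ 0 := by
  intro h
  apply hp
  have h1 : 2 * p.2 = 0 := congrArg Prod.fst h
  have h2 : -(s * k * p.1 ^ (k - 1)) = 0 := congrArg Prod.snd h
  have h3 : (k : ℝ) ≠ 0 := by
    have : k ≠ 0 := by omega
    exact_mod_cast this
  have h4 : p.1 ^ (k - 1) = 0 := by
    simpa [hs, h3] using h2
  exact Prod.ext (pow_eq_zero_iff (by omega) |>.1 h4) (by simpa using h1)

theorem eventually_of_punctured {f g : Plane → ℝ} (hf : ContinuousAt f 0) (hg : ContinuousAt g 0)
    (h : ∀ᶠ p in 𝓝 (0 : Plane), p ≠ 0 → f p = g p) : ∀ᶠ p in 𝓝 (0 : Plane), f p = g p :=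
  (hf.eventuallyEq_nhds_iff_eventuallyEq_nhdsNE hg).1 (eventually_nhdsWithin_iff.2 h)

/-- Equality of densities modulo exact terms gives equivalence by an `H`-preserving map. -/
theorem fibrationEquiv_polyDensity {k : ℕ} (hk : 2 ≤ k) {s : ℝ} (hs : s = 1 ∨ s = -1)
    {c : ℕ → ℝ → ℝ} (hc : ∀ i, AnalyticAt ℝ (c i) 0) (hc0 : c 0 0 ≠ 0) {f η : Plane → ℝ}
    (hη : AnalyticAt ℝ η 0) (hfa : AnalyticAt ℝ f 0) (hf0 : f 0 ≠ 0)
    (hf : ∀ᶠ p in 𝓝 (0 : Plane), f p = polyDensity k s c p + modelD k s η p) :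
    FibrationEquiv (modelH k s) (densityForm f) (modelH k s) (densityForm (polyDensity k s c)) := by
  have hs1 : |s| = 1 := by rcases hs with rfl | rfl <;> simp
  have hs0 : s ≠ 0 := by rcases hs with rfl | rfl <;> norm_num
  have hk0 : k ≠ 0 := by omega
  obtain ⟨ψ, hψ, hψ0, hH, h⟩ := exists_moser hk hs1 hc hc0 hη
  have hpoly : AnalyticAt ℝ (polyDensity k s c) 0 := by
    refine Finset.analyticAt_fun_sum _ fun i _ => ?_
    exact (analyticAt_fst.pow i).mul ((hc i).comp_modelH hk0)
  have hjac : ∀ᶠ p in 𝓝 (0 : Plane), polyDensity k s c (ψ p) * planeJac ψ p = f p := by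
    -- The Jacobian is found where the field does not vanish; both sides being continuous, the
    -- origin follows.
    refine eventually_of_punctured
      ((hpoly.comp_of_eq_zero hψ hψ0).mul hψ.planeJac).continuousAt hfa.continuousAt ?_
    filter_upwards [h, hH.eventually_nhds, hψ.eventually_differentiableAt, hf]
      with p ⟨μ, h1, h2⟩ h3 h4 h5 hp
    have h6 (w : Plane) : fderiv ℝ (modelH k s) (ψ p) (fderiv ℝ ψ p w) =
        fderiv ℝ (modelH k s) p w := by
      have e1 := ((analyticAt_modelH k s (ψ p)).differentiableAt.hasFDerivAt.comp p
        h4.hasFDerivAt).fderiv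
      have e2 : (modelH k s ∘ ψ) =ᶠ[𝓝 p] modelH k s := h3
      rw [← e2.fderiv_eq, e1]
      rfl
    have harea (q w : Plane) : fderiv ℝ (modelH k s) q w =
        (modelV k s q).1 * w.2 - (modelV k s q).2 * w.1 := by
      rw [fderiv_modelH, modelV]
      ring
    set v := modelV k s p with hv
    -- Apply the area rule to the field `v` and its rotation `w = (-v₂, v₁)`, which span area
    -- `|v|²`. Since `dψ v` is `μ` times the field at `ψ p`, and `dH` at `ψ p` takes on `dψ w` the
    -- value `dH(w) = |v|²`, the image area is `μ |v|²`. So the Jacobian is `μ`.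
    have h7 := planeJac_area ψ p v (-v.2, v.1)
    have h8 := h6 (-v.2, v.1)
    rw [harea, harea, ← hv] at h8
    rw [h1] at h7
    simp only [Prod.smul_fst, Prod.smul_snd, smul_eq_mul] at h7 h8
    have h9 : planeJac ψ p = μ := by
      have hne : v.1 * v.1 + v.2 * v.2 ≠ 0 := by
        intro h0
        apply modelV_ne_zero hk hs0 hp
        have hz1 : v.1 = 0 := by nlinarith [mul_self_nonneg v.1, mul_self_nonneg v.2]
        have hz2 : v.2 = 0 := by nlinarith [mul_self_nonneg v.1, mul_self_nonneg v.2]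
        exact Prod.ext hz1 hz2
      apply mul_right_cancel₀ hne
      linear_combination μ * h8 - h7
    rw [h9, mul_comm, h2, h5]
  refine fibrationEquiv_densityForm_of_preserves
    (isAnalyticDiffeoGerm_of_planeJac_ne_zero hψ hψ0 fun h0 => hf0 ?_) hH hjac
  rw [← hjac.self_of_nhds, h0, mul_zero]

/-! ### Normalising the leading coefficient -/

/-- The operator multiplies the coefficient of `h^i` by `1 + κ i ≥ 1`, so it is inverted termwise
without loss of convergence. One-variable series are handled as double series, restricted to `y = 0`
at the end. -/
theorem exists_euler_ode_solution {c : ℝ → ℝ} (hc : AnalyticAt ℝ c 0) {κ : ℝ} (hκ : 0 ≤ κ) :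
    ∃ L : ℝ → ℝ, AnalyticAt ℝ L 0 ∧ ∀ᶠ h in 𝓝 0, L h + κ * (h * deriv L h) = c h := by
  have hc1 : AnalyticAt ℝ (fun p : Plane => c p.1) 0 :=
    AnalyticAt.fun_comp (g := c) (f := fun p : Plane => p.1) hc analyticAt_fst
  obtain ⟨a, ha⟩ := hc1.exists_hasCoeffs
  have hl : GeomBounded fun i j => a i j / (1 + κ * i) := by
    refine ha.1.of_le fun i j => ?_
    rw [abs_div]
    have : 0 ≤ κ * i := by positivity
    refine div_le_self (abs_nonneg _) ?_
    rw [abs_of_pos (by linarith)]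
    linarith
  have hL := hl.hasCoeffs_tsum
  generalize (fun p : Plane => ∑' q : ℕ × ℕ, _ : Plane → ℝ) = M at hL
  have hM := hL.analyticAt
  have heq := (hL.add ((hL.fderiv_fst.shift 1 0).const_mul κ)).eventuallyEq (g := fun p => c p.1) (by
    convert! ha using 3 with i j
    rcases i with _ | i
    · simp
    · have : (1 + κ * ((i : ℝ) + 1)) ≠ 0 := by positivity
      simp
      field_simp)
  have hι (h : ℝ) : HasDerivAt (fun h : ℝ => ((h, 0) : Plane)) (1, 0) h :=
    (hasDerivAt_id h).prodMk (hasDerivAt_const _ _)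
  have ht : Tendsto (fun h : ℝ => ((h, 0) : Plane)) (𝓝 0) (𝓝 0) :=
    (by fun_prop : Continuous fun h : ℝ => ((h, 0) : Plane)).tendsto' _ _ rfl
  refine ⟨fun h => M (h, 0), AnalyticAt.fun_comp (g := M) (f := fun h : ℝ => ((h, 0) : Plane)) hM
    (analyticAt_id.prod analyticAt_const), ?_⟩
  filter_upwards [ht.eventually heq, ht.eventually hM.eventually_differentiableAt] with h h1 h2
  have h3 := (h2.hasFDerivAt.comp_hasDerivAt h (hι h)).deriv
  simp only [Function.comp_def] at h3
  rw [h3]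
  simpa using h1

/-- The substitution `L = l^(k+2)` turns the equation into the linear one `L + (2k/(k+2)) h L' = c`.
At `0` it reads `L 0 = c 0 > 0`, so the root can be taken analytically. -/
theorem exists_scaling {c : ℝ → ℝ} (hc : AnalyticAt ℝ c 0) (hc0 : 0 < c 0) (k : ℕ) :
    ∃ l : ℝ → ℝ, AnalyticAt ℝ l 0 ∧ l 0 ≠ 0 ∧
      ∀ᶠ h in 𝓝 0, l h ^ (k + 1) * (l h + 2 * k * deriv l h * h) = c h := by
  obtain ⟨L, hL, hode⟩ := exists_euler_ode_solution hc (κ := 2 * k / (k + 2)) (by positivity)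
  have hL0 : 0 < L 0 := by
    have := hode.self_of_nhds
    simp only [zero_mul, mul_zero, add_zero] at this
    rwa [this]
  have hLpos : ∀ᶠ h in 𝓝 0, 0 < L h := hL.continuousAt.eventually (lt_mem_nhds hL0)
  let l : ℝ → ℝ := fun h => L h ^ ((k + 2 : ℝ)⁻¹)
  have hl : AnalyticAt ℝ l 0 := by
    have : ContDiffAt ℝ ⊤ L 0 := hL.contDiffAt
    exact (this.rpow_const_of_ne hL0.ne').analyticAt
  have hpow : ∀ᶠ h in 𝓝 0, l h ^ (k + 2) = L h := by
    filter_upwards [hLpos] with h hh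
    have h1 := Real.rpow_inv_natCast_pow hh.le (n := k + 2) (by omega)
    push_cast at h1
    exact h1
  refine ⟨l, hl, (Real.rpow_pos_of_pos hL0 _).ne', ?_⟩
  filter_upwards [hode, hpow.eventually_nhds, hl.eventually_differentiableAt] with h h1 h2 h3
  have h4 : (fun h => l h ^ (k + 2)) =ᶠ[𝓝 h] L := h2
  have h5 := (h3.hasDerivAt.pow (k + 2)).deriv
  have h6 : deriv L h = ((k + 2 : ℕ) : ℝ) * l h ^ (k + 1) * deriv l h := by
    rw [← h4.deriv_eq]
    exact h5
  rw [← h1, ← h2.self_of_nhds, h6]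
  push_cast
  field_simp
  ring

theorem exists_analytic_inverse {g : ℝ → ℝ} (hg : AnalyticAt ℝ g 0) (hg0 : g 0 = 0)
    (hg' : deriv g 0 ≠ 0) : ∃ γ : ℝ → ℝ, AnalyticAt ℝ γ 0 ∧ γ 0 = 0 ∧ deriv γ 0 ≠ 0 ∧
      ∀ᶠ h in 𝓝 0, γ (g h) = h := by
  obtain ⟨γ, hγ, hleft⟩ : ∃ γ : ℝ → ℝ, AnalyticAt ℝ γ 0 ∧ ∀ᶠ h in 𝓝 0, γ (g h) = h := by
    have h2 := hg.analyticAt_localInverse hg'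
    rw [hg0] at h2
    exact ⟨_, h2, HasStrictFDerivAt.eventually_left_inverse _⟩
  refine ⟨γ, hγ, ?_, fun h0 => ?_, hleft⟩
  · have := hleft.self_of_nhds
    rwa [hg0] at this
  · have e1 : HasDerivAt γ 0 (g 0) := by
      have := hγ.differentiableAt.hasDerivAt
      rw [hg0]
      rwa [h0] at this
    have e2 := e1.comp (0 : ℝ) hg.differentiableAt.hasDerivAt
    have e3 : (γ ∘ g) =ᶠ[𝓝 0] id := hleft
    have e4 := (e2.congr_of_eventuallyEq e3.symm).unique (hasDerivAt_id 0)
    simp at e4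

theorem sameFoliation_comp_modelH {k : ℕ} (hk : k ≠ 0) (s : ℝ) {γ : ℝ → ℝ}
    (hγ : AnalyticAt ℝ γ 0) (hγ' : deriv γ 0 ≠ 0) :
    SameFoliation (fun p => γ (modelH k s p)) (modelH k s) := by
  filter_upwards [(tendsto_modelH hk s).eventually hγ.eventually_differentiableAt,
    (tendsto_modelH hk s).eventually (hγ.deriv.continuousAt.eventually_ne hγ')] with p h1 h2 v
  have h3 := (h1.hasDerivAt.comp_hasFDerivAt p
    (analyticAt_modelH k s p).differentiableAt.hasFDerivAt).fderiv
  simp only [Function.comp_def] at h3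
  rw [h3]
  simp [h2]

theorem sum_range_eq_add_sum_Icc {M : Type*} [AddCommMonoid M] {k : ℕ} (hk : 2 ≤ k) (F : ℕ → M) :
    ∑ i ∈ Finset.range (k - 1), F i = F 0 + ∑ i ∈ Finset.Icc 1 (k - 2), F i := by
  have h1 : Finset.Icc 1 (k - 2) = Finset.Ico 1 (k - 1) := by
    ext i
    simp only [Finset.mem_Icc, Finset.mem_Ico]
    omega
  rw [h1, Finset.range_eq_Ico, Finset.sum_eq_sum_Ico_succ_bot (by omega)]

/-- A quasi-homogeneous rescaling by a function of `H` normalises the leading coefficient. -/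
theorem fibrationEquiv_normalForm {k : ℕ} (hk : 2 ≤ k) (s : ℝ) {c : ℕ → ℝ → ℝ}
    (hc : ∀ i, AnalyticAt ℝ (c i) 0) (hc0 : 0 < c 0 0) :
    ∃ d : ℕ → ℝ → ℝ, (∀ i, AnalyticAt ℝ (d i) 0) ∧
      FibrationEquiv (modelH k s) (densityForm (polyDensity k s c)) (modelH k s)
        (normalForm k s d) := by
  have hk0 : k ≠ 0 := by omega
  obtain ⟨l, hl, hl0, hode⟩ := exists_scaling (hc 0) hc0 k
  obtain ⟨γ, hγ, hγ0, hγ', hleft⟩ := exists_analytic_inverse (g := fun h => l h ^ (2 * k) * h)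
    ((hl.pow _).mul analyticAt_id) (by simp) (by
      have h1 := ((hl.differentiableAt.hasDerivAt.pow (2 * k)).mul (hasDerivAt_id 0)).deriv
      have h2 : deriv (fun h => l h ^ (2 * k) * h) 0 = l 0 ^ (2 * k) := by
        refine Eq.trans h1 ?_
        simp
      rw [h2]
      exact pow_ne_zero _ hl0)
  -- With weights `2` for `x` and `k` for `ξ`, `H` is homogeneous of degree `2k`, so `S` acts on the
  -- values of `H` by `h ↦ l(h)^(2k) h`, of which `γ` is the inverse.
  let S : Plane → Plane := fun p => (l (modelH k s p) ^ 2 * p.1, l (modelH k s p) ^ k * p.2)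
  have hlH : AnalyticAt ℝ (fun p => l (modelH k s p)) 0 := hl.comp_modelH hk0
  have hS : AnalyticAt ℝ S 0 :=
    ((hlH.pow 2).mul analyticAt_fst).prod ((hlH.pow k).mul analyticAt_snd)
  have hS0 : S 0 = 0 := by simp [S]
  have hHS (p : Plane) : modelH k s (S p) = l (modelH k s p) ^ (2 * k) * modelH k s p := by
    simp only [S]
    generalize l (modelH k s p) = m
    simp only [modelH]
    ring
  have hjac : ∀ᶠ p in 𝓝 (0 : Plane), planeJac S p = c 0 (modelH k s p) := by
    filter_upwards [(tendsto_modelH hk0 s).eventually hode,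
      (tendsto_modelH hk0 s).eventually hl.eventually_differentiableAt] with p h1 h2
    have e0 := h2.hasDerivAt.comp_hasFDerivAt p (hasFDerivAt_modelH k s p)
    have e1 : HasFDerivAt (fun p : Plane => p.1) (ContinuousLinearMap.fst ℝ ℝ ℝ) p := hasFDerivAt_fst
    have e2 : HasFDerivAt (fun p : Plane => p.2) (ContinuousLinearMap.snd ℝ ℝ ℝ) p := hasFDerivAt_snd
    have e3 := ((e0.pow 2).mul e1).prodMk ((e0.pow k).mul e2)
    have e4 : fderiv ℝ S p = _ := e3.fderiv
    obtain ⟨n, rfl⟩ : ∃ n, k = n + 1 := ⟨k - 1, by omega⟩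
    simp only [Nat.add_sub_cancel] at e4
    rw [← h1, planeJac, e4]
    simp
    generalize deriv l _ = l'
    generalize l _ = m
    simp only [modelH]
    ring
  have hc0' : ∀ᶠ p in 𝓝 (0 : Plane), c 0 (modelH k s p) ≠ 0 :=
    (tendsto_modelH hk0 s).eventually ((hc 0).continuousAt.eventually_ne hc0.ne')
  have hl0' : ∀ᶠ p in 𝓝 (0 : Plane), l (modelH k s p) ≠ 0 :=
    (tendsto_modelH hk0 s).eventually (hl.continuousAt.eventually_ne hl0)
  -- Pulling back `x^i` produces `l^(2i) x^i` and the area form produces the Jacobian `c 0`; the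
  -- witness divides by both, after passing to the variable `γ h`.
  refine ⟨fun i h => c i (γ h) / (c 0 (γ h) * l (γ h) ^ (2 * i)), fun i => ?_,
    fun p => γ (modelH k s p), S, hγ.comp_modelH hk0, sameFoliation_comp_modelH hk0 s hγ hγ',
    isAnalyticDiffeoGerm_of_planeJac_ne_zero hS hS0 ?_, ?_, ?_⟩
  · refine ((hc i).comp_of_eq_zero hγ hγ0).div (((hc 0).comp_of_eq_zero hγ hγ0).mul
      ((hl.comp_of_eq_zero hγ hγ0).pow _)) ?_
    rw [hγ0]
    exact mul_ne_zero hc0.ne' (pow_ne_zero _ hl0)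
  · rw [hjac.self_of_nhds, modelH_zero hk0]
    exact hc0.ne'
  · filter_upwards [(tendsto_modelH hk0 s).eventually hleft] with p hp
    rw [hHS, hp]
  · filter_upwards [(tendsto_modelH hk0 s).eventually hleft, hjac, hc0', hl0'] with p h1 h2 h3 h4
    refine (pullbackForm_densityForm S _ p).trans ?_
    simp only [densityForm, hHS, h1, h2, polyDensity]
    congr 1
    rw [sum_range_eq_add_sum_Icc hk, add_mul, Finset.sum_mul]
    refine congrArg₂ (· + ·) (by simp) (Finset.sum_congr rfl fun i _ => ?_)
    · simp only [S]
      rw [mul_pow, ← pow_mul]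
      field_simp

theorem analyticAt_polyDensity {k : ℕ} (hk : k ≠ 0) (s : ℝ) {c : ℕ → ℝ → ℝ}
    (hc : ∀ i < k - 1, AnalyticAt ℝ (c i) 0) : AnalyticAt ℝ (polyDensity k s c) 0 :=
  Finset.analyticAt_fun_sum _ fun i hi =>
    (analyticAt_fst.pow i).mul ((hc i (Finset.mem_range.1 hi)).comp_modelH hk)

theorem polyDensity_zero {k : ℕ} (hk : 2 ≤ k) (s : ℝ) (c : ℕ → ℝ → ℝ) :
    polyDensity k s c 0 = c 0 0 := by
  have h1 : 0 ∈ Finset.range (k - 1) := Finset.mem_range.2 (by omega)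
  rw [polyDensity, Finset.sum_eq_single_of_mem 0 h1]
  · simp [modelH_zero (by omega : k ≠ 0)]
  · intro i _ hi
    simp [hi]

theorem exists_normalForm_of_density_pos {k : ℕ} (hk : 2 ≤ k) {s : ℝ} (hs : s = 1 ∨ s = -1)
    {f : Plane → ℝ} (hf : AnalyticAt ℝ f 0) (hf0 : 0 < f 0) :
    ∃ d : ℕ → ℝ → ℝ, (∀ i, AnalyticAt ℝ (d i) 0) ∧
      FibrationEquiv (modelH k s) (densityForm f) (modelH k s) (normalForm k s d) := by
  have hk0 : k ≠ 0 := by omega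
  obtain ⟨c, η, hc, hη, hdec⟩ := exists_decomposition hk0 hs hf
  -- The field vanishes at the origin, so the exact term does not affect the value there and `c 0 0
  -- = f 0`.
  have hV0 : modelV k s 0 = 0 := by
    have : k - 1 ≠ 0 := by omega
    simp [modelV, this]
  have h0 : f 0 = c 0 0 := by
    have h1 := hdec.self_of_nhds
    rw [modelD, hV0, map_zero, add_zero] at h1
    exact h1.trans (polyDensity_zero hk s c)
  obtain ⟨d, hd, hequiv⟩ := fibrationEquiv_normalForm hk s hc (by rwa [← h0])
  exact ⟨d, hd, (fibrationEquiv_polyDensity hk hs hc (by rw [← h0]; exact hf0.ne') hη hf hf0.ne'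
    hdec).trans (analyticAt_modelH k s 0) hequiv⟩

theorem exists_normalForm_of_density {k : ℕ} (hk : 2 ≤ k) {s : ℝ} (hs : s = 1 ∨ s = -1)
    {f : Plane → ℝ} (hf : AnalyticAt ℝ f 0) (hf0 : f 0 ≠ 0) :
    ∃ d : ℕ → ℝ → ℝ, (∀ i, AnalyticAt ℝ (d i) 0) ∧
      FibrationEquiv (modelH k s) (densityForm f) (modelH k s) (normalForm k s d) := by
  rcases hf0.lt_or_gt with h | h
  -- The reflection `ξ ↦ -ξ` preserves `H` and reverses orientation, which makes the density
  -- positive.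
  · have hflip := isAnalyticDiffeoGerm_diag (a := 1) (b := -1) one_ne_zero (by norm_num)
    obtain ⟨d, hd, hequiv⟩ := exists_normalForm_of_density_pos hk hs
      (f := fun p => -f (1 * p.1, -1 * p.2)) (hf.comp_of_eq_zero hflip.1 hflip.2.1).neg
      (by
        have h0 : ((1 * (0 : Plane).1, -1 * (0 : Plane).2) : Plane) = 0 := by simp
        simp only [h0]
        linarith)
    refine ⟨d, hd, FibrationEquiv.trans (analyticAt_modelH k s 0) ?_ hequiv⟩
    refine fibrationEquiv_densityForm_of_preserves hflip (Eventually.of_forall fun p => ?_)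
      (Eventually.of_forall fun p => ?_)
    · simp [modelH]
    · rw [planeJac_diag]
      simp
  · exact exists_normalForm_of_density_pos hk hs hf h

/-! ### Euler-type equations and division by `dH` -/

/-- If `φ = t^n g` with `g 0 ≠ 0`, then `n ≥ 1` because `φ 0 = 0`, and the lowest-order term of the
equation gives `(n + e 0) g 0 = 0`, which is excluded. -/
theorem euler_ode_unique {φ e : ℝ → ℝ} (hφ : AnalyticAt ℝ φ 0) (he : ContinuousAt e 0)
    (hφ0 : φ 0 = 0) (hne : ∀ n : ℕ, 1 ≤ n → (n : ℝ) + e 0 ≠ 0)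
    (h : ∀ᶠ t in 𝓝 0, t * deriv φ t + e t * φ t = 0) : ∀ᶠ t in 𝓝 0, φ t = 0 := by
  by_contra hcon
  obtain ⟨n, g, hg, hg0, hgeq⟩ := hφ.exists_eventuallyEq_pow_smul_nonzero_iff.2 hcon
  simp only [sub_zero, smul_eq_mul] at hgeq
  have hn : 1 ≤ n := by
    by_contra hn
    have h1 := hgeq.self_of_nhds
    have h2 : n = 0 := by omega
    rw [h2, hφ0] at h1
    simp at h1
    exact hg0 h1.symm
  have hlim : ContinuousAt (fun t => n * g t + t * deriv g t + e t * g t) 0 := by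
    have := hg.continuousAt
    have := hg.deriv.continuousAt
    fun_prop
  have hzero : ∀ᶠ t in 𝓝[≠] (0 : ℝ), n * g t + t * deriv g t + e t * g t = 0 := by
    rw [eventually_nhdsWithin_iff]
    filter_upwards [h, hgeq.eventually_nhds, hg.eventually_differentiableAt] with t h1 h2 h3 ht
    have h4 : φ =ᶠ[𝓝 t] fun t => t ^ n * g t := h2
    have h5 := ((hasDerivAt_pow n t).mul h3.hasDerivAt).deriv
    have h6 : deriv φ t = n * t ^ (n - 1) * g t + t ^ n * deriv g t := h4.deriv_eq.trans h5
    rw [h6, h2.self_of_nhds] at h1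
    have ht' : t ^ n ≠ 0 := pow_ne_zero n ht
    obtain ⟨m, rfl⟩ : ∃ m, n = m + 1 := ⟨n - 1, by omega⟩
    apply (mul_eq_zero.1 (_ : t ^ (m + 1) * _ = 0)).resolve_left ht'
    rw [← h1, Nat.add_sub_cancel]
    ring
  have h1 := tendsto_nhds_unique (hlim.tendsto.mono_left nhdsWithin_le_nhds)
    (tendsto_const_nhds.congr' (hzero.mono fun _ h => h.symm))
  apply hne n hn
  apply (mul_eq_zero.1 (_ : (n + e 0) * g 0 = 0)).resolve_right hg0
  linarith

theorem HasCoeffs.eventually_eq_zero_of_snd_mul {f : Plane → ℝ} (hf : AnalyticAt ℝ f 0)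
    (h : ∀ᶠ p in 𝓝 (0 : Plane), p.2 * f p = 0) : ∀ᶠ p in 𝓝 (0 : Plane), f p = 0 := by
  obtain ⟨a, ha⟩ := hf.exists_hasCoeffs
  have h1 := (ha.shift 0 1).congr (g := fun _ => 0) (by
    filter_upwards [h] with p hp
    simpa using hp)
  have h2 : a = fun _ _ => 0 := by
    ext i j
    simpa using h1.eq_zero i (j + 1)
  refine ha.eventuallyEq (g := fun _ => 0) ?_
  rw [h2]
  exact hasCoeffs_zero

/-- Division by the Hamiltonian differential. -/
theorem exists_division {m : ℕ} {r : ℝ} (hr : r ≠ 0) {P Q : Plane → ℝ}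
    (hP : AnalyticAt ℝ P 0) (hQ : AnalyticAt ℝ Q 0)
    (h : ∀ᶠ p in 𝓝 (0 : Plane), 2 * p.2 * P p = r * p.1 ^ m * Q p) :
    ∃ u : Plane → ℝ, AnalyticAt ℝ u 0 ∧ (∀ᶠ p in 𝓝 (0 : Plane), Q p = 2 * p.2 * u p) ∧
      ∀ᶠ p in 𝓝 (0 : Plane), P p = r * p.1 ^ m * u p := by
  obtain ⟨a, ha⟩ := hP.exists_hasCoeffs
  obtain ⟨b, hb⟩ := hQ.exists_hasCoeffs
  -- On `ξ = 0` the relation reads `r x^m Q = 0`, so `Q` has no terms free of `ξ` and is divisible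
  -- by `ξ`.
  have hb0 (i : ℕ) : b i 0 = 0 := by
    have h1 := (((ha.shift 0 1).const_mul 2).congr
      (g := fun p => r * (p.1 ^ m * p.2 ^ 0 * Q p)) (by
        filter_upwards [h] with p hp
        simp only [pow_zero, pow_one, one_mul, mul_one]
        linarith)).unique ((hb.shift m 0).const_mul r) (i + m) 0
    simpa [hr] using h1
  obtain ⟨C, R, hC, hR, hbd⟩ := hb.1
  have hu : GeomBounded fun i j => 1 / 2 * b i (j + 1) := by
    refine ⟨C * R, R, by positivity, hR, fun i j => ?_⟩
    have h1 := hbd i (j + 1)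
    rw [abs_mul, abs_of_pos (by norm_num : (0 : ℝ) < 1 / 2)]
    have : C * R * R ^ (i + j) = C * R ^ (i + (j + 1)) := by ring
    rw [this]
    linarith [abs_nonneg (b i (j + 1))]
  have hu := hu.hasCoeffs_tsum
  generalize (fun p : Plane => ∑' q : ℕ × ℕ, _ : Plane → ℝ) = u at hu
  have hQu : ∀ᶠ p in 𝓝 (0 : Plane), Q p = 2 * p.2 * u p := by
    refine hb.eventuallyEq (g := fun p => 2 * p.2 * u p) (HasCoeffs.congr (a := b)
      (f := fun p => 2 * (p.1 ^ 0 * p.2 ^ 1 * u p)) ?_ (Eventually.of_forall fun p => by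
        simp only [pow_zero, pow_one, one_mul, mul_assoc]))
    convert (hu.shift 0 1).const_mul 2 using 3 with i j
    rcases j with _ | j
    · simp [hb0]
    · simp
  refine ⟨u, hu.analyticAt, hQu, ?_⟩
  have hua := hu.analyticAt
  have h1 := HasCoeffs.eventually_eq_zero_of_snd_mul (f := fun p => P p - r * p.1 ^ m * u p)
    (by fun_prop) (by
      filter_upwards [h, hQu] with p h1 h2
      rw [h2] at h1
      linarith)
  exact h1.mono fun p hp => sub_eq_zero.1 hp

/-! ### Calculus of partial derivatives -/

/-- The partial derivative with respect to `x`. -/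
noncomputable def pdx (f : Plane → ℝ) (p : Plane) : ℝ := fderiv ℝ f p (1, 0)

/-- The partial derivative with respect to `ξ`. -/
noncomputable def pdy (f : Plane → ℝ) (p : Plane) : ℝ := fderiv ℝ f p (0, 1)

theorem AnalyticAt.pdx {f : Plane → ℝ} {p : Plane} (hf : AnalyticAt ℝ f p) :
    AnalyticAt ℝ (pdx f) p := hf.fderiv_apply (1, 0)

theorem AnalyticAt.pdy {f : Plane → ℝ} {p : Plane} (hf : AnalyticAt ℝ f p) :
    AnalyticAt ℝ (pdy f) p := hf.fderiv_apply (0, 1)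

section Calculus

variable {f g : Plane → ℝ} {p : Plane}

theorem pdx_mul (hf : DifferentiableAt ℝ f p) (hg : DifferentiableAt ℝ g p) :
    pdx (fun q => f q * g q) p = f p * pdx g p + pdx f p * g p := by
  simp [pdx, fderiv_fun_mul hf hg, mul_comm]

theorem pdy_mul (hf : DifferentiableAt ℝ f p) (hg : DifferentiableAt ℝ g p) :
    pdy (fun q => f q * g q) p = f p * pdy g p + pdy f p * g p := by
  simp [pdy, fderiv_fun_mul hf hg, mul_comm]

theorem pdx_add (hf : DifferentiableAt ℝ f p) (hg : DifferentiableAt ℝ g p) :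
    pdx (fun q => f q + g q) p = pdx f p + pdx g p := by
  simp [pdx, fderiv_fun_add hf hg]

theorem pdy_add (hf : DifferentiableAt ℝ f p) (hg : DifferentiableAt ℝ g p) :
    pdy (fun q => f q + g q) p = pdy f p + pdy g p := by
  simp [pdy, fderiv_fun_add hf hg]

theorem pdx_sub (hf : DifferentiableAt ℝ f p) (hg : DifferentiableAt ℝ g p) :
    pdx (fun q => f q - g q) p = pdx f p - pdx g p := by
  simp [pdx, fderiv_fun_sub hf hg]

theorem pdy_sub (hf : DifferentiableAt ℝ f p) (hg : DifferentiableAt ℝ g p) :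
    pdy (fun q => f q - g q) p = pdy f p - pdy g p := by
  simp [pdy, fderiv_fun_sub hf hg]

theorem pdx_pow (hf : DifferentiableAt ℝ f p) (n : ℕ) :
    pdx (fun q => f q ^ n) p = n * f p ^ (n - 1) * pdx f p := by
  simp [pdx, fderiv_fun_pow n hf]

theorem pdy_pow (hf : DifferentiableAt ℝ f p) (n : ℕ) :
    pdy (fun q => f q ^ n) p = n * f p ^ (n - 1) * pdy f p := by
  simp [pdy, fderiv_fun_pow n hf]

theorem pdx_const (c : ℝ) : pdx (fun _ => c) p = 0 := by simp [pdx]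

theorem pdy_const (c : ℝ) : pdy (fun _ => c) p = 0 := by simp [pdy]

theorem pdx_fst : pdx (fun q => q.1) p = 1 := by simp [pdx, fderiv_fst]

theorem pdx_snd : pdx (fun q => q.2) p = 0 := by simp [pdx, fderiv_snd]

theorem pdy_fst : pdy (fun q => q.1) p = 0 := by simp [pdy, fderiv_fst]

theorem pdy_snd : pdy (fun q => q.2) p = 1 := by simp [pdy, fderiv_snd]

theorem pdx_sum {ι : Type*} (t : Finset ι) {F : ι → Plane → ℝ}
    (hF : ∀ i ∈ t, DifferentiableAt ℝ (F i) p) :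
    pdx (fun q => ∑ i ∈ t, F i q) p = ∑ i ∈ t, pdx (F i) p := by
  simp [pdx, fderiv_fun_sum hF]

theorem pdy_sum {ι : Type*} (t : Finset ι) {F : ι → Plane → ℝ}
    (hF : ∀ i ∈ t, DifferentiableAt ℝ (F i) p) :
    pdy (fun q => ∑ i ∈ t, F i q) p = ∑ i ∈ t, pdy (F i) p := by
  simp [pdy, fderiv_fun_sum hF]

theorem pdx_congr (h : f =ᶠ[𝓝 p] g) : pdx f p = pdx g p := by rw [pdx, pdx, h.fderiv_eq]

theorem pdy_congr (h : f =ᶠ[𝓝 p] g) : pdy f p = pdy g p := by rw [pdy, pdy, h.fderiv_eq]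

theorem pdy_pdx (hf : AnalyticAt ℝ f p) : pdy (pdx f) p = pdx (pdy f) p := by
  have h1 (v w : Plane) : fderiv ℝ (fun q => fderiv ℝ f q v) p w = fderiv ℝ (fderiv ℝ f) p w v := by
    have := (hf.fderiv.differentiableAt.hasFDerivAt.clm_apply (hasFDerivAt_const v p)).fderiv
    rw [this]
    simp
  have h2 : IsSymmSndFDerivAt ℝ f p :=
    (hf.contDiffAt (n := ⊤)).isSymmSndFDerivAt (by simp)
  exact (h1 (1, 0) (0, 1)).trans ((h2 _ _).trans (h1 (0, 1) (1, 0)).symm)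

theorem modelD_eq (k : ℕ) (s : ℝ) (f : Plane → ℝ) (p : Plane) :
    modelD k s f p = 2 * p.2 * pdx f p - s * k * p.1 ^ (k - 1) * pdy f p := by
  rw [modelD, plane_clm_apply, modelV, pdx, pdy]
  simp only [smul_eq_mul]
  ring

variable {k : ℕ} {s : ℝ}

theorem pdx_modelH : pdx (modelH k s) p = s * k * p.1 ^ (k - 1) := by
  rw [pdx, fderiv_modelH]
  ring

theorem pdy_modelH : pdy (modelH k s) p = 2 * p.2 := by
  rw [pdy, fderiv_modelH]
  ring

theorem fderiv_comp_scalar {c : ℝ → ℝ} (hc : DifferentiableAt ℝ c (f p))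
    (hf : DifferentiableAt ℝ f p) (v : Plane) :
    fderiv ℝ (fun q => c (f q)) p v = deriv c (f p) * fderiv ℝ f p v := by
  have h := (hc.hasDerivAt.comp_hasFDerivAt p hf.hasFDerivAt).fderiv
  simp only [Function.comp_def] at h
  rw [h]
  simp

theorem pdx_comp_modelH {c : ℝ → ℝ} (hc : DifferentiableAt ℝ c (modelH k s p)) :
    pdx (fun q => c (modelH k s q)) p = deriv c (modelH k s p) * (s * k * p.1 ^ (k - 1)) := by
  rw [pdx, fderiv_comp_scalar hc (analyticAt_modelH k s p).differentiableAt, ← pdx, pdx_modelH]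

theorem pdy_comp_modelH {c : ℝ → ℝ} (hc : DifferentiableAt ℝ c (modelH k s p)) :
    pdy (fun q => c (modelH k s q)) p = deriv c (modelH k s p) * (2 * p.2) := by
  rw [pdy, fderiv_comp_scalar hc (analyticAt_modelH k s p).differentiableAt, ← pdy, pdy_modelH]

end Calculus

/-! ### The Gauss–Manin relation -/

theorem pdx_modelH_comp {k : ℕ} {s : ℝ} {X Y : Plane → ℝ} {p : Plane}
    (hX : DifferentiableAt ℝ X p) (hY : DifferentiableAt ℝ Y p) :
    pdx (fun q => modelH k s (X q, Y q)) p =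
      2 * Y p * pdx Y p + s * k * X p ^ (k - 1) * pdx X p := by
  simp only [modelH]
  rw [pdx_add (hY.fun_pow 2) ((hX.fun_pow k).const_mul s), pdx_pow hY,
    pdx_mul (differentiableAt_const s) (hX.fun_pow k), pdx_pow hX, pdx_const]
  push_cast
  ring

theorem pdy_modelH_comp {k : ℕ} {s : ℝ} {X Y : Plane → ℝ} {p : Plane}
    (hX : DifferentiableAt ℝ X p) (hY : DifferentiableAt ℝ Y p) :
    pdy (fun q => modelH k s (X q, Y q)) p =
      2 * Y p * pdy Y p + s * k * X p ^ (k - 1) * pdy X p := by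
  simp only [modelH]
  rw [pdy_add (hY.fun_pow 2) ((hX.fun_pow k).const_mul s), pdy_pow hY,
    pdy_mul (differentiableAt_const s) (hX.fun_pow k), pdy_pow hX, pdy_const]
  push_cast
  ring

/-- The exterior derivative of the pull-back of `x ^ i (k ξ dx - 2 x dξ)`. -/
theorem pdy_sub_pdx_pullback {k i : ℕ} {X Y : Plane → ℝ} {p : Plane}
    (hX : AnalyticAt ℝ X p) (hY : AnalyticAt ℝ Y p) :
    pdy (fun q => X q ^ i * (k * Y q * pdx X q - 2 * X q * pdx Y q)) p -
        pdx (fun q => X q ^ i * (k * Y q * pdy X q - 2 * X q * pdy Y q)) p =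
      (k + 2 + 2 * i) * (X p ^ i * (pdx X p * pdy Y p - pdy X p * pdx Y p)) := by
  have dX := hX.differentiableAt
  have dY := hY.differentiableAt
  have dXx := hX.pdx.differentiableAt
  have dXy := hX.pdy.differentiableAt
  have dYx := hY.pdx.differentiableAt
  have dYy := hY.pdy.differentiableAt
  have dkY : DifferentiableAt ℝ (fun q => (k : ℝ) * Y q) p := dY.const_mul _
  have d2X : DifferentiableAt ℝ (fun q => (2 : ℝ) * X q) p := dX.const_mul _
  have hc (c : ℝ) : DifferentiableAt ℝ (fun _ : Plane => c) p := differentiableAt_const c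
  rw [pdy_mul (dX.fun_pow i) ((dkY.fun_mul dXx).fun_sub (d2X.fun_mul dYx)),
    pdx_mul (dX.fun_pow i) ((dkY.fun_mul dXy).fun_sub (d2X.fun_mul dYy)),
    pdy_sub (dkY.fun_mul dXx) (d2X.fun_mul dYx), pdx_sub (dkY.fun_mul dXy) (d2X.fun_mul dYy),
    pdy_mul dkY dXx, pdy_mul d2X dYx, pdx_mul dkY dXy, pdx_mul d2X dYy,
    pdy_mul (hc _) dY, pdy_mul (hc _) dX, pdx_mul (hc _) dY, pdx_mul (hc _) dX,
    pdx_const, pdx_const, pdy_const, pdy_const, pdx_pow dX, pdy_pow dX, pdy_pdx hX, pdy_pdx hY]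
  rcases i with _ | i
  · simp
    ring
  · simp only [Nat.add_sub_cancel]
    push_cast
    ring

theorem planeJac_eq {ψ : Plane → Plane} {p : Plane} (h : DifferentiableAt ℝ ψ p) :
    planeJac ψ p = pdx (fun q => (ψ q).1) p * pdy (fun q => (ψ q).2) p -
      pdy (fun q => (ψ q).1) p * pdx (fun q => (ψ q).2) p := by
  have h1 := (hasFDerivAt_fst.comp p h.hasFDerivAt).fderiv
  have h2 := (hasFDerivAt_snd.comp p h.hasFDerivAt).fderiv
  simp only [Function.comp_def] at h1 h2
  simp [planeJac, pdx, pdy, h1, h2]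

/-- By quasi-homogeneity `dH ∧ (k ξ dx - 2 x dξ) = 2 k H dξ ∧ dx`. This is the pull-back by `ψ` of
`x^i` times that identity, where `H ∘ ψ = G(H)` turns `dH` into `G'(H) dH`. -/
theorem gaussManin_relation {k : ℕ} {s : ℝ} {i : ℕ} {ψ : Plane → Plane} {G : ℝ → ℝ} {p : Plane}
    (hψ : DifferentiableAt ℝ ψ p) (hG : DifferentiableAt ℝ G (modelH k s p))
    (h : ∀ᶠ q in 𝓝 p, modelH k s (ψ q) = G (modelH k s q)) :
    deriv G (modelH k s p) *
      (2 * p.2 * ((ψ p).1 ^ i * (k * (ψ p).2 * pdx (fun q => (ψ q).1) p -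
          2 * (ψ p).1 * pdx (fun q => (ψ q).2) p)) -
        s * k * p.1 ^ (k - 1) * ((ψ p).1 ^ i * (k * (ψ p).2 * pdy (fun q => (ψ q).1) p -
          2 * (ψ p).1 * pdy (fun q => (ψ q).2) p))) =
      2 * k * G (modelH k s p) * ((ψ p).1 ^ i * planeJac ψ p) := by
  have hX : DifferentiableAt ℝ (fun q => (ψ q).1) p := differentiableAt_fst.comp p hψ
  have hY : DifferentiableAt ℝ (fun q => (ψ q).2) p := differentiableAt_snd.comp p hψ
  have h1 := pdx_congr (p := p) (f := fun q => modelH k s ((ψ q).1, (ψ q).2)) h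
  have h2 := pdy_congr (p := p) (f := fun q => modelH k s ((ψ q).1, (ψ q).2)) h
  rw [pdx_modelH_comp hX hY, pdx_comp_modelH hG] at h1
  rw [pdy_modelH_comp hX hY, pdy_comp_modelH hG] at h2
  have h3 := h.self_of_nhds
  rw [planeJac_eq hψ, ← h3]
  have h4 : modelH k s (ψ p) = (ψ p).2 ^ 2 + s * (ψ p).1 ^ k := rfl
  rw [h4]
  rcases k with _ | k
  · simp only [Nat.cast_zero] at h1 h2 ⊢
    simp only [mul_zero, zero_mul, sub_zero, zero_sub, add_zero] at h1 h2 ⊢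
    linear_combination (-(2 * (ψ p).1 ^ i * (ψ p).1 * pdx (fun q => (ψ q).2) p)) * (-h2) -
      (2 * (ψ p).1 ^ i * (ψ p).1 * pdy (fun q => (ψ q).2) p) * h1
  simp only [Nat.add_sub_cancel] at h1 h2 ⊢
  linear_combination (-((ψ p).1 ^ i * (((k + 1 : ℕ) : ℝ) * (ψ p).2 * pdx (fun q => (ψ q).1) p -
    2 * (ψ p).1 * pdx (fun q => (ψ q).2) p))) * h2 +
    ((ψ p).1 ^ i * (((k + 1 : ℕ) : ℝ) * (ψ p).2 * pdy (fun q => (ψ q).1) p -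
    2 * (ψ p).1 * pdy (fun q => (ψ q).2) p)) * h1

/-- The exterior derivative of `∑ x ^ j b_j(H) (k ξ dx - 2 x dξ)`. -/
theorem pdy_sub_pdx_euler {k : ℕ} {s : ℝ} (hk : k ≠ 0) {b : ℕ → ℝ → ℝ} {p : Plane}
    (hb : ∀ j ∈ Finset.range (k - 1), DifferentiableAt ℝ (b j) (modelH k s p)) :
    pdy (fun q => polyDensity k s b q * (k * q.2)) p -
        pdx (fun q => polyDensity k s b q * (-2 * q.1)) p =
      ∑ j ∈ Finset.range (k - 1), p.1 ^ j *
        ((k + 2 + 2 * j) * b j (modelH k s p) +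
          2 * k * (modelH k s p * deriv (b j) (modelH k s p))) := by
  have hbH (j) (hj : j ∈ Finset.range (k - 1)) :
      DifferentiableAt ℝ (fun q => b j (modelH k s q)) p :=
    (hb j hj).comp p (analyticAt_modelH k s p).differentiableAt
  have hpow (j : ℕ) : DifferentiableAt ℝ (fun q : Plane => q.1 ^ j) p := by fun_prop
  have hterm (j) (hj : j ∈ Finset.range (k - 1)) :
      DifferentiableAt ℝ (fun q => q.1 ^ j * b j (modelH k s q)) p := (hpow j).fun_mul (hbH j hj)
  have hpoly : DifferentiableAt ℝ (polyDensity k s b) p := DifferentiableAt.fun_sum hterm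
  have h2 : DifferentiableAt ℝ (fun q : Plane => (k : ℝ) * q.2) p := by fun_prop
  have h3 : DifferentiableAt ℝ (fun q : Plane => (-2 : ℝ) * q.1) p := by fun_prop
  rw [pdy_mul hpoly h2, pdx_mul hpoly h3, pdy_mul (differentiableAt_const _) differentiableAt_snd,
    pdx_mul (differentiableAt_const _) differentiableAt_fst, pdy_const, pdx_const, pdy_snd, pdx_fst]
  have e1 : pdy (polyDensity k s b) p = ∑ j ∈ Finset.range (k - 1),
      p.1 ^ j * (deriv (b j) (modelH k s p) * (2 * p.2)) := by
    refine (pdy_sum _ hterm).trans (Finset.sum_congr rfl fun j hj => ?_)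
    rw [pdy_mul (hpow j) (hbH j hj), pdy_comp_modelH (hb j hj), pdy_pow differentiableAt_fst,
      pdy_fst]
    ring
  have e2 : pdx (polyDensity k s b) p = ∑ j ∈ Finset.range (k - 1),
      (p.1 ^ j * (deriv (b j) (modelH k s p) * (s * k * p.1 ^ (k - 1))) +
        j * p.1 ^ (j - 1) * b j (modelH k s p)) := by
    refine (pdx_sum _ hterm).trans (Finset.sum_congr rfl fun j hj => ?_)
    rw [pdx_mul (hpow j) (hbH j hj), pdx_comp_modelH (hb j hj), pdx_pow differentiableAt_fst,
      pdx_fst]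
    ring
  rw [e1, e2, polyDensity, Finset.sum_mul, Finset.sum_mul, Finset.sum_mul, Finset.sum_mul,
    ← Finset.sum_add_distrib, ← Finset.sum_add_distrib, ← Finset.sum_sub_distrib]
  -- Termwise, the derivatives of `b j (H)` contribute with the factor `2kξ² + 2 s k x^k = 2kH`, and
  -- the remaining terms give the weight `k + 2 + 2j`.
  refine Finset.sum_congr rfl fun j _ => ?_
  have h4 : modelH k s p = p.2 ^ 2 + s * p.1 ^ k := rfl
  generalize deriv (b j) _ = b'
  generalize b j _ = b0
  rw [h4]
  obtain ⟨n, rfl⟩ : ∃ n, k = n + 1 := ⟨k - 1, by omega⟩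
  rcases j with _ | j
  · simp only [Nat.add_sub_cancel]
    push_cast
    ring
  · simp only [Nat.add_sub_cancel]
    push_cast
    ring

/-- A map which carries `H` to a function of `H` acts on the classes of the forms
`x ^ i dξ ∧ dx` compatibly with the Gauss–Manin connection. -/
theorem gaussManin_compat {k : ℕ} (hk : 2 ≤ k) {s : ℝ} (hs : s = 1 ∨ s = -1) {ψ : Plane → Plane}
    (hψ : AnalyticAt ℝ ψ 0) {G r : ℝ → ℝ} (hG : AnalyticAt ℝ G 0) (hG' : deriv G 0 ≠ 0)
    (hr : AnalyticAt ℝ r 0) (hGr : ∀ᶠ h in 𝓝 0, G h = deriv G h * (h * r h))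
    (h : ∀ᶠ p in 𝓝 (0 : Plane), modelH k s (ψ p) = G (modelH k s p))
    {i : ℕ} {a : ℕ → ℝ → ℝ} (ha : ∀ j < k - 1, AnalyticAt ℝ (a j) 0) {η : Plane → ℝ}
    (hη : AnalyticAt ℝ η 0)
    (hdec : ∀ᶠ p in 𝓝 (0 : Plane),
      (ψ p).1 ^ i * planeJac ψ p = polyDensity k s a p + modelD k s η p) {j : ℕ} (hj : j < k - 1) :
    ∀ᶠ t in 𝓝 0, (k + 2 + 2 * j) * (r t * a j t) +
      2 * k * (t * deriv (fun t => r t * a j t) t) = (k + 2 + 2 * i) * a j t := by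
  have hk0 : k ≠ 0 := by omega
  have hs0 : s ≠ 0 := by rcases hs with rfl | rfl <;> norm_num
  have hkr : (k : ℝ) ≠ 0 := by exact_mod_cast hk0
  have tH := tendsto_modelH hk0 s
  have hX : AnalyticAt ℝ (fun p => (ψ p).1) 0 := analyticAt_fst.fun_comp hψ
  have hY : AnalyticAt ℝ (fun p => (ψ p).2) 0 := analyticAt_snd.fun_comp hψ
  set X := fun p => (ψ p).1
  set Y := fun p => (ψ p).2
  -- `P dx + Q dξ` is the pull-back by `ψ` of `x^i (k ξ dx - 2 x dξ)`.
  let P := fun q => X q ^ i * (k * Y q * pdx X q - 2 * X q * pdx Y q)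
  let Q := fun q => X q ^ i * (k * Y q * pdy X q - 2 * X q * pdy Y q)
  have hP : AnalyticAt ℝ P 0 := by
    have := hX.pdx
    have := hY.pdx
    fun_prop
  have hQ : AnalyticAt ℝ Q 0 := by
    have := hX.pdy
    have := hY.pdy
    fun_prop
  let b : ℕ → ℝ → ℝ := fun j t => r t * a j t
  have hb : ∀ j < k - 1, AnalyticAt ℝ (b j) 0 := fun j hj => hr.mul (ha j hj)
  let ρ : ℝ → ℝ := fun t => 2 * k * (t * r t)
  have hρ : AnalyticAt ℝ ρ 0 := analyticAt_const.mul (analyticAt_id.mul hr)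
  have hρH : AnalyticAt ℝ (fun p => ρ (modelH k s p)) 0 := hρ.comp_modelH hk0
  have hB : AnalyticAt ℝ (polyDensity k s b) 0 := analyticAt_polyDensity hk0 s hb
  have hE1 : AnalyticAt ℝ (fun q => polyDensity k s b q * (k * q.2)) 0 := by fun_prop
  have hE2 : AnalyticAt ℝ (fun q => polyDensity k s b q * (-2 * q.1)) 0 := by fun_prop
  have hR1 : AnalyticAt ℝ (fun q => ρ (modelH k s q) * pdx η q) 0 := hρH.mul hη.pdx
  have hR2 : AnalyticAt ℝ (fun q => ρ (modelH k s q) * pdy η q) 0 := hρH.mul hη.pdy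
  have hrel : ∀ᶠ p in 𝓝 (0 : Plane), 2 * p.2 * P p - s * k * p.1 ^ (k - 1) * Q p =
      ρ (modelH k s p) * (polyDensity k s a p + modelD k s η p) := by
    filter_upwards [h.eventually_nhds, hψ.eventually_differentiableAt,
      tH.eventually hG.eventually_differentiableAt, tH.eventually hGr, hdec,
      tH.eventually (hG.deriv.continuousAt.eventually_ne hG')] with p h1 h2 h3 h4 h5 h6
    have h7 := gaussManin_relation (i := i) h2 h3 h1
    apply mul_left_cancel₀ h6
    rw [← h5]
    refine h7.trans ?_
    rw [h4]
    simp only [ρ]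
    ring
  have hbpoly (p : Plane) : polyDensity k s b p = r (modelH k s p) * polyDensity k s a p := by
    simp only [polyDensity, b, Finset.mul_sum]
    exact Finset.sum_congr rfl fun _ _ => by ring
  -- The form `P dx + Q dξ` and the form `∑ x^j b_j(H) (k ξ dx - 2 x dξ) + ρ(H) dη` have the same
  -- wedge product with `dH`, so their difference is `u dH`.
  obtain ⟨u, hu, hQu, hPu⟩ := exists_division (m := k - 1) (r := s * k) (mul_ne_zero hs0 hkr)
    (hP.sub (hE1.add hR1)) (hQ.sub (hE2.add hR2)) (by
      filter_upwards [hrel] with p hp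
      simp only [Pi.sub_apply, Pi.add_apply, hbpoly]
      rw [modelD_eq] at hp
      have h4 : modelH k s p = p.2 ^ 2 + s * (p.1 ^ (k - 1) * p.1) := by
        rw [← pow_succ, Nat.sub_add_cancel (by omega)]
        rfl
      have h5 : ρ (modelH k s p) =
          2 * k * ((p.2 ^ 2 + s * (p.1 ^ (k - 1) * p.1)) * r (modelH k s p)) := by
        simp only [ρ]
        rw [← h4]
      rw [h5] at hp ⊢
      linear_combination hp)
  -- The defect in the claimed differential equation. It appears as the coefficient of `x^j` in a
  -- vanishing decomposition, so it is zero by uniqueness.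
  let e : ℕ → ℝ → ℝ := fun j t =>
    (k + 2 + 2 * j) * b j t + 2 * k * (t * deriv (b j) t) + (-(k + 2 + 2 * i)) * a j t
  have he : ∀ j < k - 1, AnalyticAt ℝ (e j) 0 := fun j hj =>
    ((analyticAt_const.mul (hb j hj)).add
      (analyticAt_const.mul (analyticAt_id.mul (hb j hj).deriv))).add
      (analyticAt_const.mul (ha j hj))
  have hρ'H : AnalyticAt ℝ (fun p => deriv ρ (modelH k s p)) 0 := hρ.deriv.comp_modelH hk0
  have hcη : AnalyticAt ℝ (fun p => (deriv ρ (modelH k s p) + (-(k + 2 + 2 * i))) * η p) 0 :=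
    (hρ'H.add analyticAt_const).mul hη
  have hfinal : ∀ᶠ p in 𝓝 (0 : Plane), ∑ j ∈ Finset.range (k - 1), p.1 ^ j * e j (modelH k s p) +
      modelD k s (fun p => (deriv ρ (modelH k s p) + (-(k + 2 + 2 * i))) * η p + (-1) * u p) p
        = 0 := by
    have hbd : ∀ᶠ p in 𝓝 (0 : Plane), ∀ j ∈ Finset.range (k - 1),
        DifferentiableAt ℝ (b j) (modelH k s p) := (Finset.eventually_all _).2 fun j hj =>
      tH.eventually (hb j (Finset.mem_range.1 hj)).eventually_differentiableAt
    filter_upwards [hQu.eventually_nhds, hPu.eventually_nhds, hX.eventually_analyticAt,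
      hY.eventually_analyticAt, hbd, hdec, hE1.eventually_differentiableAt,
      hE2.eventually_differentiableAt, hη.eventually_analyticAt, hu.eventually_differentiableAt,
      tH.eventually hρ.eventually_analyticAt, hψ.eventually_differentiableAt]
      with p h1 h2 h3 h4 h5 h6 h7 h8 h9 h10 h11 h12
    have hη' := h9.differentiableAt
    have dρ : DifferentiableAt ℝ (fun q => ρ (modelH k s q)) p :=
      h11.differentiableAt.comp p (analyticAt_modelH k s p).differentiableAt
    have dρ' : DifferentiableAt ℝ (fun q => deriv ρ (modelH k s q)) p :=
      h11.deriv.differentiableAt.comp p (analyticAt_modelH k s p).differentiableAt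
    have dx := h9.pdx.differentiableAt
    have dy := h9.pdy.differentiableAt
    have dpow : DifferentiableAt ℝ (fun q : Plane => s * k * q.1 ^ (k - 1)) p := by fun_prop
    have d2 : DifferentiableAt ℝ (fun q : Plane => 2 * q.2) p := by fun_prop
    have eP : P =ᶠ[𝓝 p] fun q => (polyDensity k s b q * (k * q.2) +
        ρ (modelH k s q) * pdx η q) + s * k * q.1 ^ (k - 1) * u q := by
      filter_upwards [h2] with q hq
      rw [← hq]
      simp
    have eQ : Q =ᶠ[𝓝 p] fun q => (polyDensity k s b q * (-2 * q.1) +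
        ρ (modelH k s q) * pdy η q) + 2 * q.2 * u q := by
      filter_upwards [h1] with q hq
      rw [← hq]
      simp
    -- Take exterior derivatives in `P dx + Q dξ = ∑ x^j b_j(H) (k ξ dx - 2 x dξ) + ρ(H) dη + u dH`.
    -- The last two terms give the densities `D(ρ'(H) η)` and `-D u`, which are exact.
    have hw := pdy_sub_pdx_pullback (k := k) (i := i) h3 h4
    rw [← planeJac_eq h12, h6] at hw
    change pdy P p - pdx Q p = _ at hw
    rw [pdy_congr eP, pdx_congr eQ, pdy_add (h7.fun_add (dρ.fun_mul dx)) (dpow.fun_mul h10),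
      pdx_add (h8.fun_add (dρ.fun_mul dy)) (d2.fun_mul h10), pdy_add h7 (dρ.fun_mul dx),
      pdx_add h8 (dρ.fun_mul dy), pdy_mul dρ dx, pdx_mul dρ dy, pdy_mul dpow h10, pdx_mul d2 h10,
      pdy_comp_modelH h11.differentiableAt, pdx_comp_modelH h11.differentiableAt,
      pdy_pdx h9] at hw
    have z1 : pdy (fun q : Plane => s * k * q.1 ^ (k - 1)) p = 0 := by
      rw [pdy_mul (differentiableAt_const _) (by fun_prop), pdy_const,
        pdy_pow differentiableAt_fst, pdy_fst]
      ring
    have z2 : pdx (fun q : Plane => 2 * q.2) p = 0 := by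
      rw [pdx_mul (differentiableAt_const _) differentiableAt_snd, pdx_const, pdx_snd]
      ring
    rw [z1, z2] at hw
    have heul := pdy_sub_pdx_euler hk0 h5
    rw [modelD_add ((dρ'.add_const _).fun_mul hη') (h10.const_mul (-1)),
      modelD_mul (dρ'.add_const _) hη', modelD_mul (differentiableAt_const _) h10,
      modelD_add dρ' (differentiableAt_const _),
      modelD_comp_modelH (c := deriv ρ) h11.deriv.differentiableAt]
    have hconst (c : ℝ) : modelD k s (fun _ => c) p = 0 := by simp [modelD]
    rw [hconst, hconst]
    have hesum : ∑ j ∈ Finset.range (k - 1), p.1 ^ j * e j (modelH k s p) =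
        (∑ j ∈ Finset.range (k - 1), p.1 ^ j * ((k + 2 + 2 * j) * b j (modelH k s p) +
          2 * k * (modelH k s p * deriv (b j) (modelH k s p)))) +
        (-(k + 2 + 2 * i)) * polyDensity k s a p := by
      rw [polyDensity, Finset.mul_sum, ← Finset.sum_add_distrib]
      exact Finset.sum_congr rfl fun j _ => by simp only [e]; ring
    rw [hesum, ← heul]
    rw [modelD_eq] at hw
    rw [modelD_eq, modelD_eq]
    linear_combination hw
  have hz := decomposition_unique hk0 hs he (hcη.add (analyticAt_const.mul hu)) hfinal hj
  filter_upwards [hz] with t ht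
  simp only [e] at ht
  linarith

/-! ### The induced map on the values of `H` -/

/-- The Hamiltonian field spans directions in `ker dH = ker d(H ∘ ψ)`, so `H ∘ ψ` is a first
integral. -/
theorem exists_eq_comp_of_sameFoliation {k : ℕ} (hk : k ≠ 0) {s : ℝ} (hs : s = 1 ∨ s = -1)
    {ψ : Plane → Plane} (hψ : IsAnalyticDiffeoGerm ψ)
    (h : SameFoliation (modelH k s) fun p => modelH k s (ψ p)) :
    ∃ G : ℝ → ℝ, AnalyticAt ℝ G 0 ∧ G 0 = 0 ∧
      ∀ᶠ p in 𝓝 (0 : Plane), modelH k s (ψ p) = G (modelH k s p) := by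
  have hHψ : AnalyticAt ℝ (fun p => modelH k s (ψ p)) 0 :=
    (analyticAt_modelH k s _).comp_of_eq_zero hψ.1 hψ.2.1
  obtain ⟨G, hG, hGH⟩ := exists_eq_comp_modelH hk hs hHψ (by
    filter_upwards [h] with p hp
    exact (hp _).1 (modelD_modelH k s p))
  refine ⟨G, hG, ?_, hGH⟩
  have := hGH.self_of_nhds
  rwa [hψ.2.1, modelH_zero hk, eq_comm] at this

/-- `H` may take only nonnegative values (`s = 1`, `k` even), so `G ∘ F` is known to be the identity
only on some `[0, ε)`, reached along `x = 0`. Its right derivative at `0` is then `1`, which rules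
out `G'(0) = 0`. -/
theorem deriv_ne_zero_of_comp_modelH {k : ℕ} (hk : k ≠ 0) {s : ℝ} {F G : ℝ → ℝ}
    (hF : AnalyticAt ℝ F 0) (hG : AnalyticAt ℝ G 0) (hF0 : F 0 = 0)
    (h : ∀ᶠ p in 𝓝 (0 : Plane), G (F (modelH k s p)) = modelH k s p) : deriv G 0 ≠ 0 := by
  intro h0
  have h1 : HasDerivAt (G ∘ F) (deriv G 0 * deriv F 0) 0 := by
    have := hG.differentiableAt.hasDerivAt
    rw [← hF0] at this
    have h2 := this.comp (0 : ℝ) hF.differentiableAt.hasDerivAt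
    rwa [hF0] at h2
  rw [h0, zero_mul] at h1
  have ht : Tendsto (fun u : ℝ => ((0, √u) : Plane)) (𝓝[≥] 0) (𝓝 0) :=
    ((by fun_prop : Continuous fun u : ℝ => ((0, √u) : Plane)).tendsto' 0 0 (by simp)).mono_left
      nhdsWithin_le_nhds
  have h3 : G ∘ F =ᶠ[𝓝[≥] 0] id := by
    filter_upwards [ht.eventually h, self_mem_nhdsWithin] with u hu hu0
    have : modelH k s (0, √u) = u := by simp [modelH, hk, Real.sq_sqrt hu0]
    rwa [this] at hu
  have h4 := (h1.hasDerivWithinAt (s := Set.Ici 0)).congr_of_eventuallyEq h3.symm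
    (h3.eq_of_nhdsWithin Set.self_mem_Ici).symm
  have h5 := (uniqueDiffOn_Ici (0 : ℝ) 0 Set.self_mem_Ici).eq_deriv _ h4 (hasDerivWithinAt_id 0 _)
  norm_num at h5

/-- A diffeomorphism preserving the foliation carries `H` to a function of `H`. -/
theorem exists_base_of_sameFoliation {k : ℕ} (hk : k ≠ 0) {s : ℝ} (hs : s = 1 ∨ s = -1)
    {ψ : Plane → Plane} (hψ : IsAnalyticDiffeoGerm ψ)
    (h : SameFoliation (modelH k s) fun p => modelH k s (ψ p)) :
    ∃ G : ℝ → ℝ, AnalyticAt ℝ G 0 ∧ G 0 = 0 ∧ deriv G 0 ≠ 0 ∧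
      ∀ᶠ p in 𝓝 (0 : Plane), modelH k s (ψ p) = G (modelH k s p) := by
  obtain ⟨G, hG, hG0, hGH⟩ := exists_eq_comp_of_sameFoliation hk hs hψ h
  obtain ⟨χ, hχ, -, h2⟩ := hψ.exists_inverse
  have hHψ : AnalyticAt ℝ (fun p => modelH k s (ψ p)) 0 :=
    (analyticAt_modelH k s _).comp_of_eq_zero hψ.1 hψ.2.1
  -- The inverse map preserves the foliation as well; its base map `F` is a right inverse of `G` on
  -- the values of `H`.
  obtain ⟨F, hF, hF0, hFH⟩ := exists_eq_comp_of_sameFoliation hk hs hχ (by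
    refine SameFoliation.trans ?_ (h.symm.comp hHψ (analyticAt_modelH k s 0) hχ)
    refine sameFoliation_of_eventuallyEq ?_
    filter_upwards [h2] with p hp
    rw [hp])
  refine ⟨G, hG, hG0, deriv_ne_zero_of_comp_modelH (k := k) (s := s) hk hF hG hF0 ?_, hGH⟩
  filter_upwards [hχ.tendsto.eventually hGH, h2, hFH] with p h3 h4 h5
  rw [← h5, ← h3, h4]

/-- `ρ = G / (t G')`, with the removable singularity at `0` filled in by `dslope`. The condition `ρ
= 1` expresses that `G` is linear. -/
theorem exists_logarithmic_slope {G : ℝ → ℝ} (hG : AnalyticAt ℝ G 0) (hG0 : G 0 = 0)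
    (hG' : deriv G 0 ≠ 0) : ∃ ρ : ℝ → ℝ, AnalyticAt ℝ ρ 0 ∧ ρ 0 = 1 ∧
      ∀ᶠ t in 𝓝 0, G t = deriv G t * (t * ρ t) := by
  have hg : AnalyticAt ℝ (dslope G 0) 0 := by
    obtain ⟨p, hp⟩ := hG
    exact ⟨_, hp.has_fpower_series_dslope_fslope⟩
  refine ⟨fun t => dslope G 0 t / deriv G t, hg.div hG.deriv hG', ?_, ?_⟩
  · simp [div_self hG']
  · filter_upwards [hG.deriv.continuousAt.eventually_ne hG'] with t ht
    have h1 := sub_smul_dslope G 0 t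
    rw [hG0, smul_eq_mul, sub_zero, sub_zero] at h1
    rw [← h1]
    field_simp

/-- A function which agrees with its linear approximation along the Euler field is linear. -/
theorem eventually_eq_linear {G : ℝ → ℝ} (hG : AnalyticAt ℝ G 0)
    (h : ∀ᶠ t in 𝓝 0, G t = deriv G t * t) : ∀ᶠ t in 𝓝 0, G t = deriv G 0 * t := by
  -- Differentiating `G = t G'` gives `t G'' = 0`.
  have h1 := euler_ode_unique (φ := fun t => deriv G t - deriv G 0) (e := fun _ => 0)
    (hG.deriv.sub analyticAt_const) continuousAt_const (by simp)
    (fun n hn => by simp; omega) (by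
      filter_upwards [h.eventually_nhds, hG.deriv.eventually_differentiableAt] with t h1 h2
      have h3 : G =ᶠ[𝓝 t] fun t => deriv G t * t := h1
      have h4 := h3.deriv_eq
      have h5 := (h2.hasDerivAt.mul (hasDerivAt_id t)).deriv
      have h6 := h4.trans h5
      rw [deriv_sub_const]
      simp at h6 ⊢
      tauto)
  filter_upwards [h, h1] with t h2 h3
  rw [h2, sub_eq_zero.1 h3]

theorem eventually_eq_const {a : ℝ → ℝ} (ha : AnalyticAt ℝ a 0)
    (h : ∀ᶠ t in 𝓝 0, t * deriv a t = 0) : ∀ᶠ t in 𝓝 0, a t = a 0 := by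
  have h1 := euler_ode_unique (φ := fun t => a t - a 0) (e := fun _ => 0)
    (ha.sub analyticAt_const) continuousAt_const (by simp)
    (fun n hn => by simp; omega) (by
      filter_upwards [h] with t h1
      rw [deriv_sub_const]
      simpa using h1)
  exact h1.mono fun t ht => sub_eq_zero.1 ht

/-- The classes of `x ^ i dξ ∧ dx` are carried to multiples of themselves. -/
theorem exists_diagonal_decomposition {k : ℕ} (hk : 2 ≤ k) {s : ℝ} (hs : s = 1 ∨ s = -1)
    {ψ : Plane → Plane} (hψ : AnalyticAt ℝ ψ 0) {G ρ : ℝ → ℝ} (hG : AnalyticAt ℝ G 0)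
    (hG' : deriv G 0 ≠ 0) (hρ : AnalyticAt ℝ ρ 0) (hρ0 : ρ 0 = 1)
    (hGρ : ∀ᶠ t in 𝓝 0, G t = deriv G t * (t * ρ t))
    (h : ∀ᶠ p in 𝓝 (0 : Plane), modelH k s (ψ p) = G (modelH k s p)) {i : ℕ} (hi : i < k - 1) :
    ∃ (a : ℝ → ℝ) (η : Plane → ℝ), AnalyticAt ℝ a 0 ∧ AnalyticAt ℝ η 0 ∧
      (∀ᶠ p in 𝓝 (0 : Plane),
        (ψ p).1 ^ i * planeJac ψ p = p.1 ^ i * a (modelH k s p) + modelD k s η p) ∧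
      ∀ᶠ t in 𝓝 0, (k + 2 + 2 * i) * (ρ t * a t) + 2 * k * (t * deriv (fun t => ρ t * a t) t) =
        (k + 2 + 2 * i) * a t := by
  have hk0 : k ≠ 0 := by omega
  have hX : AnalyticAt ℝ (fun p => (ψ p).1) 0 := analyticAt_fst.fun_comp hψ
  obtain ⟨a, η, ha, hη, hdec⟩ := exists_decomposition hk0 hs ((hX.pow i).mul hψ.planeJac)
  have hode (j : ℕ) (hj : j < k - 1) := gaussManin_compat hk hs hψ hG hG' hρ hGρ h
    (fun j _ => ha j) hη hdec hj
  -- At `t = 0`, where `ρ = 1`, the compatibility equation says `2(j - i) a_j(0) = 0`. A solution of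
  -- order `n ≥ 1` would need `n k + j - i = 0`, impossible as `|j - i| < k`.
  have hvanish (j : ℕ) (hj : j < k - 1) (hij : j ≠ i) : ∀ᶠ t in 𝓝 0, a j t = 0 := by
    have hkr : (0 : ℝ) < k := by exact_mod_cast Nat.pos_of_ne_zero hk0
    have hij' : (j : ℝ) - i ≠ 0 := sub_ne_zero.2 (by exact_mod_cast hij)
    have ha0 : a j 0 = 0 := by
      have h1 := (hode j hj).self_of_nhds
      simp only [hρ0, zero_mul, mul_zero, add_zero, one_mul] at h1
      have h2 : ((j : ℝ) - i) * a j 0 = 0 := by linarith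
      exact (mul_eq_zero.1 h2).resolve_left hij'
    have hρne : ∀ᶠ t in 𝓝 0, ρ t ≠ 0 := hρ.continuousAt.eventually_ne (by simp [hρ0])
    have h1 := euler_ode_unique (φ := fun t => ρ t * a j t)
      (e := fun t => ((k + 2 + 2 * j) - (k + 2 + 2 * i) / ρ t) / (2 * k))
      (hρ.mul (ha j))
      (((continuousAt_const.sub (continuousAt_const.div hρ.continuousAt (by simp [hρ0]))).div_const
        _)) (by simp [ha0]) (fun n hn h0 => by
          rw [hρ0] at h0
          field_simp at h0
          have h2 : (n : ℤ) * k + j - i = 0 := by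
            have : (n : ℝ) * k + j - i = 0 := by linarith
            exact_mod_cast this
          have h3 : (1 : ℤ) * k ≤ n * k := by gcongr; exact_mod_cast hn
          omega) (by
        filter_upwards [hode j hj, hρne] with t h2 h3
        field_simp
        linarith)
    filter_upwards [h1, hρne] with t h2 h3
    exact (mul_eq_zero.1 h2).resolve_left h3
  refine ⟨a i, η, ha i, hη, ?_, hode i hi⟩
  have hall : ∀ᶠ t in 𝓝 0, ∀ j ∈ Finset.range (k - 1), j ≠ i → a j t = 0 :=
    (Finset.eventually_all _).2 fun j hj => by
      by_cases hij : j = i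
      · simp [hij]
      · filter_upwards [hvanish j (Finset.mem_range.1 hj) hij] with t ht _ using ht
  filter_upwards [hdec, (tendsto_modelH hk0 s).eventually hall] with p h1 h2
  refine h1.trans ?_
  rw [Finset.sum_eq_single_of_mem i (Finset.mem_range.2 hi) fun j hj hij => by
    rw [h2 j hj hij, mul_zero]]

theorem modelD_sum {k : ℕ} {s : ℝ} {ι : Type*} (t : Finset ι) {F : ι → Plane → ℝ} {p : Plane}
    (hF : ∀ i ∈ t, DifferentiableAt ℝ (F i) p) :
    modelD k s (fun q => ∑ i ∈ t, F i q) p = ∑ i ∈ t, modelD k s (F i) p := by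
  simp [modelD, fderiv_fun_sum hF]

/-- A diffeomorphism carrying one normal form to another acts linearly on the base, and
multiplies the classes of `x ^ i dξ ∧ dx` by constants. -/
theorem exists_linear_base {k : ℕ} (hk : 2 ≤ k) {s : ℝ} (hs : s = 1 ∨ s = -1)
    {ψ : Plane → Plane} (hψ : IsAnalyticDiffeoGerm ψ)
    (h : SameFoliation (modelH k s) fun p => modelH k s (ψ p)) {c c' : ℕ → ℝ → ℝ}
    (hc : ∀ i < k - 1, AnalyticAt ℝ (c i) 0) (hc' : ∀ i < k - 1, AnalyticAt ℝ (c' i) 0)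
    (hc0 : ∀ t, c 0 t = 1) (hc0' : ∀ t, c' 0 t = 1)
    (hJ : ∀ᶠ p in 𝓝 (0 : Plane), polyDensity k s c' (ψ p) * planeJac ψ p = polyDensity k s c p) :
    ∃ (γ : ℝ) (α : ℕ → ℝ), (∀ᶠ p in 𝓝 (0 : Plane), modelH k s (ψ p) = γ * modelH k s p) ∧
      α 0 = 1 ∧ ∀ i < k - 1, (∀ᶠ t in 𝓝 0, c i t = c' i (γ * t) * α i) ∧
        ∃ η : Plane → ℝ, AnalyticAt ℝ η 0 ∧ ∀ᶠ p in 𝓝 (0 : Plane),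
          (ψ p).1 ^ i * planeJac ψ p = p.1 ^ i * α i + modelD k s η p := by
  have hk0 : k ≠ 0 := by omega
  have hkr : (k : ℝ) ≠ 0 := by exact_mod_cast hk0
  have tH := tendsto_modelH hk0 s
  obtain ⟨G, hG, hG0, hG', hGH⟩ := exists_base_of_sameFoliation hk0 hs hψ h
  obtain ⟨ρ, hρ, hρ0, hGρ⟩ := exists_logarithmic_slope hG hG0 hG'
  have hd (i : ℕ) (hi : i < k - 1) :=
    exists_diagonal_decomposition hk hs hψ.1 hG hG' hρ hρ0 hGρ hGH hi
  choose! a η ha hη hdec hode using hd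
  have tG : Tendsto G (𝓝 0) (𝓝 0) := by
    have := hG.continuousAt.tendsto
    rwa [hG0] at this
  have hE (i) (hi : i < k - 1) : AnalyticAt ℝ (fun t => c' i (G t)) 0 :=
    (hc' i hi).comp_of_eq_zero hG hG0
  have hEH (i) (hi : i < k - 1) : AnalyticAt ℝ (fun p => -c' i (G (modelH k s p))) 0 :=
    (hE i hi).neg.comp_modelH hk0
  -- Substitute the decompositions of the classes in the Jacobian identity. Coefficients that are
  -- functions of `H` pass through `D`, so both sides are decompositions of one density and agree by
  -- uniqueness.
  have hca (i) (hi : i < k - 1) : ∀ᶠ t in 𝓝 0, c i t = c' i (G t) * a i t := by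
    have h1 := decomposition_unique hk0 hs (c := fun i t => c i t - c' i (G t) * a i t)
      (η := fun p => ∑ i ∈ Finset.range (k - 1), -c' i (G (modelH k s p)) * η i p)
      (fun i hi => (hc i hi).sub ((hE i hi).mul (ha i hi)))
      (Finset.analyticAt_fun_sum _ fun i hi =>
        (hEH i (Finset.mem_range.1 hi)).mul (hη i (Finset.mem_range.1 hi))) (by
        have e1 : ∀ᶠ p in 𝓝 (0 : Plane), ∀ i ∈ Finset.range (k - 1),
            (ψ p).1 ^ i * planeJac ψ p = p.1 ^ i * a i (modelH k s p) + modelD k s (η i) p :=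
          (Finset.eventually_all _).2 fun i hi => hdec i (Finset.mem_range.1 hi)
        have e2 : ∀ᶠ p in 𝓝 (0 : Plane), ∀ i ∈ Finset.range (k - 1),
            DifferentiableAt ℝ (η i) p :=
          (Finset.eventually_all _).2 fun i hi =>
            (hη i (Finset.mem_range.1 hi)).eventually_differentiableAt
        have e3 : ∀ᶠ p in 𝓝 (0 : Plane), ∀ i ∈ Finset.range (k - 1),
            DifferentiableAt ℝ (fun t => -c' i (G t)) (modelH k s p) :=
          (Finset.eventually_all _).2 fun i hi =>
            tH.eventually (hE i (Finset.mem_range.1 hi)).neg.eventually_differentiableAt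
        filter_upwards [hJ, hGH, e1, e2, e3] with p h1 h2 h3 h4 h5
        have h6 (i) (hi : i ∈ Finset.range (k - 1)) :
            DifferentiableAt ℝ (fun p => -c' i (G (modelH k s p))) p :=
          (h5 i hi).comp p (analyticAt_modelH k s p).differentiableAt
        rw [modelD_sum _ fun i hi => (h6 i hi).fun_mul (h4 i hi), ← Finset.sum_add_distrib]
        rw [polyDensity, polyDensity, h2, Finset.sum_mul, ← sub_eq_zero,
          ← Finset.sum_sub_distrib] at h1
        rw [← neg_eq_zero, ← Finset.sum_neg_distrib, ← h1]
        refine Finset.sum_congr rfl fun i hi => ?_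
        rw [modelD_mul (h6 i hi) (h4 i hi),
          modelD_comp_modelH (c := fun t => -c' i (G t)) (h5 i hi)]
        linear_combination -(c' i (G (modelH k s p))) * h3 i hi) hi
    exact h1.mono fun t ht => sub_eq_zero.1 ht
  have h0 : 0 < k - 1 := by omega
  have ha0 : ∀ᶠ t in 𝓝 0, a 0 t = 1 := by
    filter_upwards [hca 0 h0] with t ht
    rw [hc0, hc0', one_mul] at ht
    exact ht.symm
  -- With `a_0 = 1` the equation for `i = 0` becomes `(k+2)(ρ - 1) + 2k t ρ' = 0`, whose only
  -- analytic solution is `ρ = 1`.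
  have hρ1 : ∀ᶠ t in 𝓝 0, ρ t = 1 := by
    have h1 := euler_ode_unique (φ := fun t => ρ t - 1) (e := fun _ => (k + 2) / (2 * k))
      (hρ.sub analyticAt_const) continuousAt_const (by simp [hρ0])
      (fun n _ => by positivity) (by
        filter_upwards [hode 0 h0, ha0.eventually_nhds] with t h1 h2
        have h3 : (fun t => ρ t * a 0 t) =ᶠ[𝓝 t] ρ := h2.mono fun u hu => by simp [hu]
        rw [h3.deriv_eq, h2.self_of_nhds] at h1
        rw [deriv_sub_const]
        field_simp
        push_cast at h1
        linarith)
    exact h1.mono fun t ht => sub_eq_zero.1 ht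
  have hGlin : ∀ᶠ t in 𝓝 0, G t = deriv G 0 * t := eventually_eq_linear hG (by
    filter_upwards [hGρ, hρ1] with t h1 h2
    rw [h1, h2, mul_one])
  -- Once `ρ = 1`, the equation for `a_i` reduces to `2k t a_i' = 0`.
  have haconst (i) (hi : i < k - 1) : ∀ᶠ t in 𝓝 0, a i t = a i 0 :=
    eventually_eq_const (ha i hi) (by
      filter_upwards [hode i hi, hρ1.eventually_nhds] with t h1 h2
      have h3 : (fun t => ρ t * a i t) =ᶠ[𝓝 t] a i := h2.mono fun u hu => by simp [hu]
      rw [h3.deriv_eq, h2.self_of_nhds] at h1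
      have h4 : (2 * k : ℝ) * (t * deriv (a i) t) = 0 := by linarith
      exact (mul_eq_zero.1 h4).resolve_left (by positivity))
  refine ⟨deriv G 0, fun i => a i 0, ?_, ha0.self_of_nhds, fun i hi => ⟨?_, η i, hη i hi, ?_⟩⟩
  · filter_upwards [hGH, tH.eventually hGlin] with p h1 h2
    rw [h1, h2]
  · filter_upwards [hca i hi, hGlin, haconst i hi] with t h1 h2 h3
    rw [h1, h2, h3]
  · filter_upwards [hdec i hi, tH.eventually (haconst i hi)] with p h1 h2
    rw [h1, h2]

/-! ### The linear part at the origin -/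

theorem tendsto_div_fst {f : Plane → ℝ} (hf : DifferentiableAt ℝ f 0) (hf0 : f 0 = 0) :
    Tendsto (fun t : ℝ => f (t, 0) / t) (𝓝[≠] 0) (𝓝 (pdx f 0)) := by
  have h1 := (hf.hasFDerivAt.comp_hasDerivAt_of_eq (0 : ℝ)
    ((hasDerivAt_id (0 : ℝ)).prodMk (hasDerivAt_const (0 : ℝ) (0 : ℝ))) rfl)
  have h2 := hasDerivAt_iff_tendsto_slope_zero.1 h1
  refine h2.congr fun t => ?_
  have : f ((0 : ℝ), (0 : ℝ)) = 0 := hf0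
  simp [this, div_eq_inv_mul]

theorem tendsto_div_snd {f : Plane → ℝ} (hf : DifferentiableAt ℝ f 0) (hf0 : f 0 = 0) :
    Tendsto (fun t : ℝ => f (0, t) / t) (𝓝[≠] 0) (𝓝 (pdy f 0)) := by
  have h1 := (hf.hasFDerivAt.comp_hasDerivAt_of_eq (0 : ℝ)
    ((hasDerivAt_const (0 : ℝ) (0 : ℝ)).prodMk (hasDerivAt_id (0 : ℝ))) rfl)
  have h2 := hasDerivAt_iff_tendsto_slope_zero.1 h1
  refine h2.congr fun t => ?_
  have : f ((0 : ℝ), (0 : ℝ)) = 0 := hf0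
  simp [this, div_eq_inv_mul]

theorem tendsto_axis_fst : Tendsto (fun t : ℝ => ((t, 0) : Plane)) (𝓝[≠] 0) (𝓝 0) :=
  ((by fun_prop : Continuous fun t : ℝ => ((t, 0) : Plane)).tendsto' 0 0 rfl).mono_left
    nhdsWithin_le_nhds

theorem tendsto_axis_snd : Tendsto (fun t : ℝ => ((0, t) : Plane)) (𝓝[≠] 0) (𝓝 0) :=
  ((by fun_prop : Continuous fun t : ℝ => ((0, t) : Plane)).tendsto' 0 0 rfl).mono_left
    nhdsWithin_le_nhds

theorem tendsto_pow_zero {n : ℕ} (hn : n ≠ 0) :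
    Tendsto (fun t : ℝ => t ^ n) (𝓝[≠] 0) (𝓝 0) :=
  ((by fun_prop : Continuous fun t : ℝ => t ^ n).tendsto' 0 0 (by simp [hn])).mono_left
    nhdsWithin_le_nhds

/-- The class of the pull-back of `x ^ i dξ ∧ dx` is read off from the linear part. -/
theorem multiplier_eq {k : ℕ} {s : ℝ} {ψ : Plane → Plane} (hψ : AnalyticAt ℝ ψ 0) (hψ0 : ψ 0 = 0)
    {i : ℕ} (hi : i < k - 1) {α : ℝ} {η : Plane → ℝ} (hη : AnalyticAt ℝ η 0)
    (h : ∀ᶠ p in 𝓝 (0 : Plane), (ψ p).1 ^ i * planeJac ψ p = p.1 ^ i * α + modelD k s η p) :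
    pdx (fun p => (ψ p).1) 0 ^ i * planeJac ψ 0 = α := by
  have hX : AnalyticAt ℝ (fun p => (ψ p).1) 0 := analyticAt_fst.fun_comp hψ
  have h1 := ((tendsto_div_fst hX.differentiableAt (by simp [hψ0])).pow i).mul
    (hψ.planeJac.continuousAt.tendsto.comp tendsto_axis_fst)
  -- On `ξ = 0` the exact term is `-s k t^(k-1) ∂_ξ η`; after division by `t^i` it still carries a
  -- positive power of `t`.
  have h2 : Tendsto (fun t : ℝ => α - s * k * t ^ (k - 1 - i) * pdy η (t, 0)) (𝓝[≠] 0) (𝓝 α) := by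
    have := ((tendsto_pow_zero (n := k - 1 - i) (by omega)).const_mul (s * k)).mul
      (hη.pdy.continuousAt.tendsto.comp tendsto_axis_fst)
    simpa using this.const_sub α
  refine tendsto_nhds_unique (h1.congr' ?_) h2
  filter_upwards [tendsto_axis_fst.eventually h, self_mem_nhdsWithin] with t h3 ht
  have ht' : t ≠ 0 := ht
  rw [modelD_eq] at h3
  have h4 : t ^ (k - 1) = t ^ i * t ^ (k - 1 - i) := by rw [← pow_add]; congr 1; omega
  simp only [h4] at h3
  simp only [Function.comp_apply]
  rw [div_pow]
  field_simp
  linarith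

/-- The linear part of a map with Jacobian one at the origin multiplying `H` by a constant. -/
theorem linear_part_constraints {k : ℕ} (hk : 3 ≤ k) {s : ℝ} (hs : s ≠ 0) {ψ : Plane → Plane}
    (hψ : AnalyticAt ℝ ψ 0) (hψ0 : ψ 0 = 0) (hJ : planeJac ψ 0 = 1) {γ : ℝ}
    (h : ∀ᶠ p in 𝓝 (0 : Plane), modelH k s (ψ p) = γ * modelH k s p) :
    γ * pdx (fun p => (ψ p).1) 0 ^ 2 = 1 ∧ γ = pdx (fun p => (ψ p).1) 0 ^ k := by
  have hX : AnalyticAt ℝ (fun p => (ψ p).1) 0 := analyticAt_fst.fun_comp hψ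
  have hY : AnalyticAt ℝ (fun p => (ψ p).2) 0 := analyticAt_snd.fun_comp hψ
  rw [planeJac_eq hψ.differentiableAt] at hJ
  have hX0 : (ψ 0).1 = 0 := by simp [hψ0]
  have hY0 : (ψ 0).2 = 0 := by simp [hψ0]
  have hH : ∀ᶠ p in 𝓝 (0 : Plane),
      (ψ p).2 ^ 2 + s * (ψ p).1 ^ k = γ * (p.2 ^ 2 + s * p.1 ^ k) := h
  have hpow (u t : ℝ) (n m : ℕ) (ht : t ≠ 0) (hnm : n ≤ m) :
      u ^ m / t ^ n = (u / t) ^ n * u ^ (m - n) := by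
    obtain ⟨d, rfl⟩ := Nat.exists_eq_add_of_le hnm
    rw [Nat.add_sub_cancel_left, div_pow, pow_add]
    ring
  have hXx := tendsto_div_fst hX.differentiableAt hX0
  have hYx := tendsto_div_fst hY.differentiableAt hY0
  have hXy := tendsto_div_snd hX.differentiableAt hX0
  have hYy := tendsto_div_snd hY.differentiableAt hY0
  have hX1 : Tendsto (fun t : ℝ => (ψ (t, 0)).1) (𝓝[≠] 0) (𝓝 0) := by
    have := hX.continuousAt.tendsto.comp tendsto_axis_fst
    rwa [hX0] at this
  have hX2 : Tendsto (fun t : ℝ => (ψ (0, t)).1) (𝓝[≠] 0) (𝓝 0) := by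
    have := hX.continuousAt.tendsto.comp tendsto_axis_snd
    rwa [hX0] at this
  have hk2 : k - 2 ≠ 0 := by omega
  -- Write `ψ = (X, Y)`. Compare terms of order `t²` on `x = 0`: since `k ≥ 3`, `X^k / t² = (X/t)²
  -- X^(k-2)` tends to `0`.
  have hγβ : γ = pdy (fun p => (ψ p).2) 0 ^ 2 := by
    have h1 := (hYy.pow 2).add (((hXy.pow 2).mul (hX2.pow (k - 2))).const_mul s)
    simp only [zero_pow hk2, mul_zero, add_zero] at h1
    refine (tendsto_nhds_unique (h1.congr' ?_) tendsto_const_nhds).symm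
    filter_upwards [tendsto_axis_snd.eventually hH, self_mem_nhdsWithin] with t h2 ht
    have ht' : t ≠ 0 := ht
    rw [zero_pow (by omega), mul_zero, add_zero] at h2
    rw [← hpow _ _ 2 k ht' (by omega), div_pow]
    field_simp
    linarith
  -- The same comparison on `ξ = 0`, where the right side is `γ s t^(k-2)` after division by `t²`.
  have hYx0 : pdx (fun p => (ψ p).2) 0 = 0 := by
    have h1 := (hYx.pow 2).add (((hXx.pow 2).mul (hX1.pow (k - 2))).const_mul s)
    simp only [zero_pow hk2, mul_zero, add_zero] at h1
    have h3 := (tendsto_pow_zero hk2).const_mul (γ * s)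
    rw [mul_zero] at h3
    refine pow_eq_zero_iff two_ne_zero |>.1 (tendsto_nhds_unique (h1.congr' ?_) h3)
    filter_upwards [tendsto_axis_fst.eventually hH, self_mem_nhdsWithin] with t h2 ht
    have ht' : t ≠ 0 := ht
    have h4 : t ^ k = t ^ 2 * t ^ (k - 2) := by rw [← pow_add]; congr 1; omega
    rw [zero_pow two_ne_zero, zero_add] at h2
    simp only [h4] at h2
    rw [← hpow _ _ 2 k ht' (by omega), div_pow]
    field_simp
    linarith
  rw [hYx0, mul_zero, sub_zero] at hJ
  have hβ : pdy (fun p => (ψ p).2) 0 ≠ 0 := right_ne_zero_of_mul_eq_one hJ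
  refine ⟨by rw [hγβ, ← mul_pow, mul_comm, hJ, one_pow], ?_⟩
  -- To isolate `X^k` at order `t^k` on `ξ = 0`, `Y² / t^k` has to vanish in the limit.
  -- Differentiating `H ∘ ψ = γ H` in `ξ` there gives `2 Y ∂_ξ Y = -s k X^(k-1) ∂_ξ X`, so `Y =
  -- O(t^(k-1))`, and `2(k-1) > k`.
  have hYlim : Tendsto (fun t : ℝ => (ψ (t, 0)).2 / t ^ (k - 1)) (𝓝[≠] 0)
      (𝓝 (-(s * k * pdx (fun p => (ψ p).1) 0 ^ (k - 1) * pdy (fun p => (ψ p).1) 0) /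
        (2 * pdy (fun p => (ψ p).2) 0))) := by
    have hYyc := hY.pdy.continuousAt.tendsto.comp tendsto_axis_fst
    have h1 := ((((hXx.pow (k - 1)).const_mul (s * k)).mul
      (hX.pdy.continuousAt.tendsto.comp tendsto_axis_fst)).neg).div
      (hYyc.const_mul 2) (by simpa using hβ)
    refine h1.congr' ?_
    filter_upwards [tendsto_axis_fst.eventually h.eventually_nhds, self_mem_nhdsWithin,
      tendsto_axis_fst.eventually hX.eventually_differentiableAt,
      tendsto_axis_fst.eventually hY.eventually_differentiableAt, hYyc.eventually_ne hβ]
      with t h2 ht h3 h4 h5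
    have ht' : t ≠ 0 := ht
    have h6 := pdy_congr (f := fun q => modelH k s ((ψ q).1, (ψ q).2)) h2
    rw [pdy_modelH_comp h3 h4, pdy_mul (differentiableAt_const _)
      (analyticAt_modelH k s _).differentiableAt, pdy_const, pdy_modelH] at h6
    simp only [Function.comp_apply, Pi.div_apply] at h5 ⊢
    simp only [mul_zero, zero_mul, add_zero] at h6
    rw [div_pow]
    field_simp
    linarith
  have h1 := ((hYlim.pow 2).mul (tendsto_pow_zero hk2)).add ((hXx.pow k).const_mul s)
  rw [mul_zero, zero_add] at h1
  have h3 := tendsto_nhds_unique (h1.congr' ?_) (tendsto_const_nhds (x := γ * s))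
  · exact mul_left_cancel₀ hs (by rw [h3, mul_comm])
  filter_upwards [tendsto_axis_fst.eventually hH, self_mem_nhdsWithin] with t h2 ht
  have ht' : t ≠ 0 := ht
  have h4 : t ^ k * t ^ (k - 2) = (t ^ (k - 1)) ^ 2 := by
    rw [← pow_add, ← pow_mul]
    congr 1
    omega
  rw [zero_pow two_ne_zero, zero_add] at h2
  rw [div_pow, div_pow, ← h4]
  field_simp
  linarith

/-! ### Uniqueness and completeness of the invariants -/

/-- The coefficients of a normal form, with the leading coefficient included. -/
def withLeadingOne (c : ℕ → ℝ → ℝ) : ℕ → ℝ → ℝ := Function.update c 0 fun _ => 1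

theorem withLeadingOne_of_ne_zero {c : ℕ → ℝ → ℝ} {i : ℕ} (hi : i ≠ 0) :
    withLeadingOne c i = c i := by
  simp [withLeadingOne, hi]

theorem withLeadingOne_zero (c : ℕ → ℝ → ℝ) (t : ℝ) : withLeadingOne c 0 t = 1 := by
  simp [withLeadingOne]

theorem IsAnalyticFamily.withLeadingOne {k : ℕ} {c : ℕ → ℝ → ℝ} (hc : IsAnalyticFamily k c) :
    ∀ i < k - 1, AnalyticAt ℝ (withLeadingOne c i) 0 := by
  intro i hi
  rcases eq_or_ne i 0 with rfl | h0
  · exact (analyticAt_const (v := (1 : ℝ))).congr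
      (Eventually.of_forall fun t => (withLeadingOne_zero c t).symm)
  · rw [withLeadingOne_of_ne_zero h0]
    exact hc i (Finset.mem_Icc.2 ⟨Nat.pos_of_ne_zero h0, by omega⟩)

theorem normalForm_eq {k : ℕ} (hk : 2 ≤ k) (s : ℝ) (c : ℕ → ℝ → ℝ) :
    normalForm k s c = densityForm (polyDensity k s (withLeadingOne c)) := by
  funext p
  simp only [normalForm, densityForm, polyDensity]
  rw [sum_range_eq_add_sum_Icc hk, withLeadingOne_zero, pow_zero, mul_one]
  congr 2
  refine Finset.sum_congr rfl fun i hi => ?_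
  rw [withLeadingOne_of_ne_zero (by have := (Finset.mem_Icc.1 hi).1; omega)]

theorem SameInvariants.of_fibrationEquiv {k : ℕ} (hk : 2 ≤ k) {s : ℝ} (hs : s = 1 ∨ s = -1)
    {c c' : ℕ → ℝ → ℝ} (hc : IsAnalyticFamily k c) (hc' : IsAnalyticFamily k c')
    (h : FibrationEquiv (modelH k s) (normalForm k s c) (modelH k s) (normalForm k s c')) :
    SameInvariants k c c' := by
  -- For `k = 2` the index set is empty; the study of the linear part needs `k ≥ 3`.
  rcases hk.eq_or_lt with rfl | hk3
  · exact Or.inl fun i hi => by simp at hi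
  have hs0 : s ≠ 0 := by rcases hs with rfl | rfl <;> norm_num
  obtain ⟨H', ψ, hH', hfol, hψ, hHψ, hω⟩ := h
  have hfol' : SameFoliation (modelH k s) fun p => modelH k s (ψ p) :=
    (sameFoliation_of_eventuallyEq hHψ).symm.trans (hfol.comp hH' (analyticAt_modelH k s 0) hψ)
  obtain ⟨γ, α, hγ, hα0, hα⟩ := exists_linear_base hk hs hψ hfol' hc.withLeadingOne
    hc'.withLeadingOne (withLeadingOne_zero c) (withLeadingOne_zero c') (by
      filter_upwards [hω] with p hp
      rw [normalForm_eq hk, normalForm_eq hk, pullbackForm_densityForm] at hp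
      exact densityForm_injective (f := fun q => _) hp)
  have hmul (i) (hi : i < k - 1) : pdx (fun p => (ψ p).1) 0 ^ i * planeJac ψ 0 = α i := by
    obtain ⟨-, η, hη, hdec⟩ := hα i hi
    exact multiplier_eq hψ.1 hψ.2.1 hi hη hdec
  have hJ : planeJac ψ 0 = 1 := by simpa [hα0] using hmul 0 (by omega)
  obtain ⟨h1, h2⟩ := linear_part_constraints hk3 hs0 hψ.1 hψ.2.1 hJ hγ
  have hc_eq (i) (hi : i ∈ Finset.Icc 1 (k - 2)) :
      ∀ᶠ t in 𝓝 0, c i t = c' i (γ * t) * pdx (fun p => (ψ p).1) 0 ^ i := by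
    obtain ⟨hi1, hi2⟩ := Finset.mem_Icc.1 hi
    have h3 := (hα i (by omega)).1
    rwa [withLeadingOne_of_ne_zero (by omega), withLeadingOne_of_ne_zero (by omega),
      ← hmul i (by omega), hJ, mul_one] at h3
  generalize pdx (fun p => (ψ p).1) 0 = a at h1 h2 hc_eq
  -- The only real roots of unity are `±1`, and `-1` occurs only when `k + 2` is even. In both cases
  -- `γ = a^k = 1`.
  have h3 : a ^ (k + 2) = 1 := by rw [pow_add, ← h2, h1]
  rcases (pow_eq_one_iff_cases.1 h3).resolve_left (by omega) with rfl | ⟨rfl, heven⟩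
  · rw [one_pow] at h2
    refine Or.inl fun i hi => (hc_eq i hi).mono fun t ht => ?_
    simpa [h2] using ht
  · have hk' : Even k := by simpa [Nat.even_add] using heven
    rw [hk'.neg_one_pow] at h2
    refine Or.inr ⟨hk', fun i hi => (hc_eq i hi).mono fun t ht => ?_⟩
    rw [ht, h2, one_mul, mul_comm]

/-- Realised by `(x, ξ) ↦ (ε x, ε ξ)`, which preserves `H` and has Jacobian `ε² = 1`; for `ε = -1`
this needs `k` even. -/
theorem fibrationEquiv_of_diag {k : ℕ} (hk : k ≠ 0) {s : ℝ} {c c' : ℕ → ℝ → ℝ} {ε : ℝ}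
    (hε : ε ^ 2 = 1) (hεk : ε ^ k = 1)
    (h : ∀ i ∈ Finset.Icc 1 (k - 2), c i =ᶠ[𝓝 0] fun t => ε ^ i * c' i t) :
    FibrationEquiv (modelH k s) (normalForm k s c) (modelH k s) (normalForm k s c') := by
  have hε0 : ε ≠ 0 := by
    rintro rfl
    norm_num at hε
  have hH (p : Plane) : modelH k s (ε * p.1, ε * p.2) = modelH k s p := by
    simp [modelH, mul_pow, hε, hεk]
  refine fibrationEquiv_densityForm_of_preserves (isAnalyticDiffeoGerm_diag hε0 hε0)
    (Eventually.of_forall hH) ?_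
  filter_upwards [(tendsto_modelH hk s).eventually ((Finset.eventually_all _).2 h)] with p hp
  rw [planeJac_diag, ← pow_two, hε, mul_one]
  congr 1
  refine Finset.sum_congr rfl fun i hi => ?_
  rw [hH, hp i hi]
  ring

theorem SameInvariants.fibrationEquiv {k : ℕ} (hk : k ≠ 0) (s : ℝ) {c c' : ℕ → ℝ → ℝ}
    (h : SameInvariants k c c') :
    FibrationEquiv (modelH k s) (normalForm k s c) (modelH k s) (normalForm k s c') := by
  rcases h with h | ⟨hk', h⟩
  · exact fibrationEquiv_of_diag hk (ε := 1) (by norm_num) (one_pow k) (by simpa using h)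
  · exact fibrationEquiv_of_diag hk (ε := -1) (by norm_num) hk'.neg_one_pow h

theorem fibrationEquiv_normalForm_iff {k : ℕ} (hk : 2 ≤ k) {s : ℝ} (hs : s = 1 ∨ s = -1)
    {c c' : ℕ → ℝ → ℝ} (hc : IsAnalyticFamily k c) (hc' : IsAnalyticFamily k c') :
    FibrationEquiv (modelH k s) (normalForm k s c) (modelH k s) (normalForm k s c') ↔
      SameInvariants k c c' :=
  ⟨.of_fibrationEquiv hk hs hc hc', fun h => h.fibrationEquiv (by omega) s⟩

theorem hasAnalyticASingularity_modelH (k : ℕ) (s : ℝ) :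
    HasAnalyticASingularity k s (modelH k s) :=
  ⟨analyticAt_modelH k s 0, _, isAnalyticDiffeoGerm_diag one_ne_zero one_ne_zero, 0,
    Eventually.of_forall fun p => by simp⟩

theorem isAnalyticSymplecticGerm_normalForm {k : ℕ} (hk : 2 ≤ k) (s : ℝ) {c : ℕ → ℝ → ℝ}
    (hc : IsAnalyticFamily k c) : IsAnalyticSymplecticGerm (normalForm k s c) := by
  rw [normalForm_eq hk]
  refine isAnalyticSymplecticGerm_densityForm
    (analyticAt_polyDensity (by omega) s hc.withLeadingOne) ?_
  rw [polyDensity_zero hk, withLeadingOne_zero]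
  exact one_ne_zero

theorem mainTheorem8 (k : ℕ) (hk : 2 ≤ k) (s : ℝ) (hs : s = 1 ∨ s = -1) :
    -- existence of the normal form
    (∀ (H : Plane → ℝ) (ω : TwoForm),
      HasAnalyticASingularity k s H → IsAnalyticSymplecticGerm ω →
        ∃ c : ℕ → ℝ → ℝ, IsAnalyticFamily k c ∧
          FibrationEquiv H ω (modelH k s) (normalForm k s c)) ∧
    -- its uniqueness up to the sign change, with no further relation and no fewer
    (∀ (H : Plane → ℝ) (ω : TwoForm),
      HasAnalyticASingularity k s H → IsAnalyticSymplecticGerm ω →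
        ∀ c c' : ℕ → ℝ → ℝ, IsAnalyticFamily k c → IsAnalyticFamily k c' →
          FibrationEquiv H ω (modelH k s) (normalForm k s c) →
            (FibrationEquiv H ω (modelH k s) (normalForm k s c') ↔ SameInvariants k c c')) ∧
    -- completeness of the invariants
    (∀ (H₀ : Plane → ℝ) (ω₀ : TwoForm) (H₁ : Plane → ℝ) (ω₁ : TwoForm),
      HasAnalyticASingularity k s H₀ → IsAnalyticSymplecticGerm ω₀ →
      HasAnalyticASingularity k s H₁ → IsAnalyticSymplecticGerm ω₁ →
        ∀ c₀ c₁ : ℕ → ℝ → ℝ, IsAnalyticFamily k c₀ → IsAnalyticFamily k c₁ →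
          FibrationEquiv H₀ ω₀ (modelH k s) (normalForm k s c₀) →
          FibrationEquiv H₁ ω₁ (modelH k s) (normalForm k s c₁) →
            (FibrationEquiv H₀ ω₀ H₁ ω₁ ↔ SameInvariants k c₀ c₁)) ∧
    -- every family of analytic germs occurs
    (∀ c : ℕ → ℝ → ℝ, IsAnalyticFamily k c →
      HasAnalyticASingularity k s (modelH k s) ∧
        IsAnalyticSymplecticGerm (normalForm k s c)) := by
  refine ⟨fun H ω hH hω => ?_, fun H ω hH _ c c' hc hc' h => ?_,
    fun H₀ ω₀ H₁ ω₁ hH₀ _ hH₁ _ c₀ c₁ hc₀ hc₁ h₀ h₁ => ?_, fun c hc =>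
    ⟨hasAnalyticASingularity_modelH k s, isAnalyticSymplecticGerm_normalForm hk s hc⟩⟩
  · obtain ⟨f, hf, hf0, hHf⟩ := hH.exists_fibrationEquiv hω
    obtain ⟨d, hd, hfd⟩ := exists_normalForm_of_density hk hs hf hf0
    exact ⟨d, fun i _ => hd i, hHf.trans (analyticAt_modelH k s 0) hfd⟩
  · rw [← fibrationEquiv_normalForm_iff hk hs hc hc']
    exact ⟨fun h' => (h.symm (analyticAt_modelH k s 0)).trans hH.1 h',
      fun h' => h.trans (analyticAt_modelH k s 0) h'⟩
  · rw [← fibrationEquiv_normalForm_iff hk hs hc₀ hc₁]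
    exact ⟨fun h => ((h₀.symm (analyticAt_modelH k s 0)).trans hH₀.1 h).trans hH₁.1 h₁,
      fun h => (h₀.trans (analyticAt_modelH k s 0) h).trans (analyticAt_modelH k s 0)
        (h₁.symm (analyticAt_modelH k s 0))⟩
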